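/- \textbf{Setting.} A \emph{network} $\Gamma=(V,E\cup\partial\Gamma)$ is a finite graph in which each vertex $x\in V$ has three numbered legs; each leg is either glued to exactly one other leg (a link in $E$; multiple links are allowed) or open (a link in $\partial\Gamma$, closed by a virtual single-valent boundary node, one for each open leg). Let $\partial\Gamma=A\cup B$ be a disjoint partition. A set $\sigma\subset E\cup\partial\Gamma$ of links \emph{separates} $A$ and $B$ if after its omission no boundary node of $A$ is connected to one of $B$. $\Gamma$ is \emph{coarse-grainable to a tree} if $V\cup\partial\Gamma$ has a partition into regions, with all boundary nodes in a common region and no region equal to the whole set, such that the graph whose nodes are the regions and whose links are the links of $\Gamma$ between different regions has no cycles (in particular no double links). \textbf{Diagrams.} Fix $N\ge2$; each vertex carries $N$ incoming and $N$ outgoing copies of its field, each with three arguments (one for each leg). A link of $E$ identifies the arguments of equal incoming copies, and of equal outgoing copies, at its two legs; at an open leg the $k$-th incoming argument is identified with the $\tau(k)$-th outgoing one. In the situation $Z_0^{(N)}$ the permutation is $\tau=\mathbb I$ at all open legs, in the situation $Z_A^{(N)}$ it is the cyclic permutation $\tau=\mathbb F$ on $A$ and $\mathbb I$ on $B$. A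 \emph{free local diagram} is given by $\pi_x\in S_N$ for $x\in V$: the three arguments $g_a$ of the incoming copy $k$ of $x$ and $\bar g_a$ of the outgoing copy $\pi_x(k)$ are joined by strands $\delta(h_{x,k}g_a\bar g_a^{-1})$. A \emph{diagram with a single local interaction process} is given by such permutations, a vertex $v$ and copies $i\neq j$: at $v$ the incoming copies $i,j$, with arguments $g^{(1)},g^{(2)}$, and the outgoing copies $\pi_v(i),\pi_v(j)$, with arguments $\bar g^{(1)},\bar g^{(2)}$, are joined instead by $$\delta(h_1g^{(1)}_1,h_3\bar g^{(1)}_1)\,\delta(h_1g^{(1)}_2,h_4\bar g^{(2)}_2)\,\delta(h_1g^{(1)}_3,h_2g^{(2)}_3)\,\delta(h_2g^{(2)}_1,h_4\bar g^{(2)}_1)\,\delta(h_2g^{(2)}_2,h_3\bar g^{(1)}_2)\,\delta(h_3\bar g^{(1)}_3,h_4\bar g^{(2)}_3)$$ with four independent gauge parameters. The faces $f$ of a diagram $\mathcal G$ are its closed strands. Its amplitude is $\mathcal A[\mathcal G]=\int\prod_l dh_l\prod_f\delta\big(\prod_{l\in\partial f}h_l^{\pm1}\big)$, over all gauge parameters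 with normalised Haar measure, and its divergence degree $\Omega$ is defined by $\mathcal A[\mathcal G]=\delta(e)^{\Omega[\mathcal G]}$. Here either (a) $G$ is a finite group of order $D\ge 2$ and $\delta=D\,1_{\{e\}}$, so that $\delta(e)=D$; or (b) $G$ is a compact group with a left-invariant metric whose Haar measure $\mu$ is locally uniformly doubling (for example $SU(2)$), and $\delta$ is replaced by a sequence of measurable functions $\delta_n\ge0$ with $\int\delta_n\,d\mu=1$, $\delta_n(g)=\delta_n(kgk^{-1})=\delta_n(g^{-1})\le\delta_n(e)$, $\delta_n(e)\to\infty$, such that for some $c>0$ and some radii $r_n>0$ one has $\delta_n\ge c\,\delta_n(e)$ on the closed ball $\bar B(e,r_n)$ and $\delta_n(e)\,\mu(\bar B(e,r_n))\ge c$ for all $n$; then amplitudes and degrees depend on $n$. For real $\lambda$ let $Z_{0}^{\lambda}$, $Z_A^{\lambda}$ be the sum of the amplitudes of all free local diagrams minus $\lambda$ times the sum of the amplitudes of all diagrams with a single local interaction process (over all permutations, vertices $v$ and ordered pairs $i\ne j$), in the respective boundary situation, and let $S_N(A)=\frac{1}{1-N}\ln\frac{Z_A^{\lambda}}{Z_0^{\lambda}}$,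 the approximated mean R\'enyi entropy up to linear order in $\lambda$. \textbf{Theorem.} Let $\Gamma$ be connected with $\partial\Gamma\neq\emptyset$, not coarse-grainable to a tree, and suppose that among the sets of links that separate $A$ and $B$ there is a unique one, $\sigma_{\min}$, of minimal cardinality. In the situation $Z_0^{(N)}$ let $\pi^*_x=\mathbb I$ for all $x$ and $\Omega^*=N(|E\cup\partial\Gamma|-|V|)$; in the situation $Z_A^{(N)}$ let $\pi^*_x=\mathbb F$ if $x$ is connected to $A$ after omission of $\sigma_{\min}$ and $\pi^*_x=\mathbb I$ otherwise, and $\Omega^*=N(|E\cup\partial\Gamma|-|V|)-(N-1)|\sigma_{\min}|$. In both situations: (a) For every finite group $G$ of order $D\ge2$, the free local diagram of $\pi^*$ has degree $\Omega^*$, and every other free local diagram and every diagram with a single local interaction process has strictly smaller degree. For every $\lambda\in\mathbb R$ there are $C$ and $D_0$, depending only on $\Gamma,A,N,\lambda$, such that for all finite groups of order $D=\delta(e)\ge D_0$ one has $Z_0^\lambda,Z_A^\lambda>0$ and $\big|S_N(A)-|\sigma_{\min}|\ln\delta(e)\big|\le C/\delta(e)$. (b) For every compact group and every regularisation as above, the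 degree of the free local diagram of $\pi^*$ tends to $\Omega^*$ as $n\to\infty$, and for every other free local diagram and every diagram with a single local interaction process there is $\omega<\Omega^*$ such that its degree is at most $\omega$ for all large $n$. For every $\lambda\in\mathbb R$ one has $Z_0^\lambda,Z_A^\lambda>0$ for all large $n$ and $S_N(A)=|\sigma_{\min}|\ln\delta_n(e)+O(1)$ as $n\to\infty$. -/

import Mathlib

open MeasureTheory Filter Topology Asymptotics

noncomputable section

open scoped Classical

namespace GFT

universe u v w

/-! ### Network graphs -/

/-- A three-valent open network graph with vertex set `V`. The legs of the vertex `x` are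
`(x, 0), (x, 1), (x, 2)`; the involution `glue` pairs two legs to a link of `E`, and its fixed
points are the open legs, that is, the elements of `∂Γ`. -/
structure Network (V : Type u) where
  glue : V × Fin 3 → V × Fin 3
  glue_glue : ∀ l, glue (glue l) = l

namespace Network

variable {V : Type u} (Γ : Network V)

/-- The open links `∂Γ`; each of them is closed by a virtual single-valent boundary node. -/
def OpenLeg : Type u := {l : V × Fin 3 // Γ.glue l = l}

/-- All links, that is, `E ∪ ∂Γ`. -/
def Link : Type u := {e : Sym2 (V × Fin 3) // ∃ l, e = s(l, Γ.glue l)}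

/-- The link that contains the leg `l`. -/
def link (l : V × Fin 3) : Γ.Link := ⟨s(l, Γ.glue l), l, rfl⟩

/-- The vertices together with the virtual boundary nodes. -/
abbrev Node : Type u := V ⊕ Γ.OpenLeg

/-- The node at the other end of the link of the leg `l` (whose first end is `l.1`). -/
def farEnd (l : V × Fin 3) : Γ.Node :=
  if h : Γ.glue l = l then Sum.inr ⟨l, h⟩ else Sum.inl (Γ.glue l).1

/-- The link `e` joins the nodes `x` and `y`. -/
def Joins (e : Γ.Link) (x y : Γ.Node) : Prop :=
  ∃ l, e = Γ.link l ∧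
    ((x = Sum.inl l.1 ∧ y = Γ.farEnd l) ∨ (y = Sum.inl l.1 ∧ x = Γ.farEnd l))

/-- The graph on all nodes that is left after omission of the links in `σ`. -/
def graphOff (σ : Set Γ.Link) : SimpleGraph Γ.Node :=
  SimpleGraph.fromRel fun x y => ∃ e, e ∉ σ ∧ Γ.Joins e x y

/-- `Γ` is connected. -/
def Connected : Prop := (Γ.graphOff ∅).Connected

/-- The link set `σ` separates the boundary region `A` from its complement `B = ∂Γ \ A`. -/
def Separates (A : Set Γ.OpenLeg) (σ : Set Γ.Link) : Prop :=
  ∀ a ∈ A, ∀ b ∉ A, ¬ (Γ.graphOff σ).Reachable (Sum.inr a) (Sum.inr b)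

/-- `σ` is a separating link set of minimal cardinality. -/
def IsMinCut (A : Set Γ.OpenLeg) (σ : Set Γ.Link) : Prop :=
  Γ.Separates A σ ∧ ∀ τ, Γ.Separates A τ → σ.ncard ≤ τ.ncard

/-- The links between two different regions `m`, `m'` of a partition of the nodes. -/
def linksBetween (P : Setoid Γ.Node) (m m' : Quotient P) : Set Γ.Link :=
  {e | ∃ x y, Γ.Joins e x y ∧ Quotient.mk P x = m ∧ Quotient.mk P y = m'}

/-- The coarse-grained graph of a partition (without the multiplicities of its links, which
are the numbers `(Γ.linksBetween P m m').ncard`). -/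
def coarseGraph (P : Setoid Γ.Node) : SimpleGraph (Quotient P) :=
  SimpleGraph.fromRel fun m m' => (Γ.linksBetween P m m').Nonempty

/-- `Γ` is coarse-grainable to a tree: the nodes have a partition, with the boundary nodes in a
common region and no region consisting of all nodes, whose coarse-grained graph has no cycles,
neither multiple links nor longer ones. -/
def CoarseGrainable : Prop :=
  ∃ P : Setoid Γ.Node,
    (∀ w w' : Γ.OpenLeg, Quotient.mk P (Sum.inr w) = Quotient.mk P (Sum.inr w')) ∧
    (∀ m : Quotient P, ∃ x, Quotient.mk P x ≠ m) ∧
    (∀ m m' : Quotient P, m ≠ m' → (Γ.linksBetween P m m').ncard ≤ 1) ∧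
    (Γ.coarseGraph P).IsAcyclic

end Network

/-! ### Stranded diagrams and their amplitudes -/

/-- A fully contracted stranded diagram. `P` is the set of strand ends (field arguments) and `L`
the set of edges (propagators) that carry a gauge parameter. `strand` pairs the two arguments
joined by a delta function of a propagation or interaction kernel, `contract` the two arguments
joined by the contraction pattern of the network. The delta function of a strand from `p` to
`p'` imposes `gauge p * g = gauge p' * g'` on the arguments `g`, `g'`. -/
structure StrandedDiagram (P : Type v) (L : Type w) where
  contract : P → P
  strand : P → P
  contract_invol : Function.Involutive contract
  strand_invol : Function.Involutive strand
  gauge : P → FreeGroup L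

namespace StrandedDiagram

variable {P : Type v} {L : Type w} (𝒢 : StrandedDiagram P L)

/-- Two strand ends are on the same closed strand. -/
def faceSetoid : Setoid P :=
  Relation.EqvGen.setoid fun p p' => p' = 𝒢.strand p ∨ p' = 𝒢.contract p

/-- The faces: closed strands. -/
def Face : Type v := Quotient 𝒢.faceSetoid

instance [Finite P] : Finite 𝒢.Face := inferInstanceAs (Finite (Quotient 𝒢.faceSetoid))

instance [Finite P] : Fintype 𝒢.Face := Fintype.ofFinite _

/-- The parallel transport `g' = transport p * g` along the strand from `p` to `strand p`. -/
def transport (p : P) : FreeGroup L := (𝒢.gauge (𝒢.strand p))⁻¹ * 𝒢.gauge p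

/-- One step along a face: a strand followed by a contraction. -/
def step (p : P) : P := 𝒢.contract (𝒢.strand p)

/-- The holonomy word collected on the way around the face through `p`, starting at `p`. -/
def word (p : P) : FreeGroup L :=
  ((List.range (Function.minimalPeriod 𝒢.step p)).map
    fun i => 𝒢.transport (𝒢.step^[i] p)).reverse.prod

/-- The holonomy of a face, with an arbitrary base point and orientation: a change of these
conjugates or inverts it. -/
def holonomy {G : Type*} [Group G] (h : L → G) (f : 𝒢.Face) : G :=
  FreeGroup.lift h (𝒢.word (Quotient.out (s := 𝒢.faceSetoid) f))

/-- The amplitude `∫ ∏ dh_l ∏_f δ(∏_{l ∈ ∂f} h_l)`. -/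
def amplitude [Finite P] [Fintype L] {G : Type*} [Group G] [MeasurableSpace G]
    (μ : Measure G) (δ : G → ℝ) : ℝ :=
  ∫ h : L → G, ∏ f : 𝒢.Face, δ (𝒢.holonomy h f) ∂(Measure.pi fun _ => μ)

/-- The divergence degree `Ω`, the exponent in `amplitude = δ(e) ^ Ω`. -/
def degree [Finite P] [Fintype L] {G : Type*} [Group G] [MeasurableSpace G]
    (μ : Measure G) (δ : G → ℝ) : ℝ :=
  Real.logb (δ 1) (𝒢.amplitude μ δ)

end StrandedDiagram

/-! ### Local processes -/

/-- The `N` incoming (`inl`) and the `N` outgoing (`inr`) copies of the field at a node. -/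
abbrev Copies (N : ℕ) : Type := Fin N ⊕ Fin N

/-- Propagation of the incoming copy `k` to the outgoing copy `π k`. -/
def freeStrand {N : ℕ} (π : Equiv.Perm (Fin N)) : Copies N → Copies N
  | Sum.inl k => Sum.inr (π k)
  | Sum.inr k => Sum.inl (π.symm k)

/-- The strands of a local process in which the incoming copies `i`, `j` and the outgoing copies
`π i`, `π j` interact and every other incoming copy `k` propagates to `π k`. The first argument
is the index of the leg: on the first one the interaction joins `i` with `π i` and `j` with
`π j`, on the second one `i` with `π j` and `j` with `π i`, on the third one `i` with `j` and
`π i` with `π j`. -/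
def intStrand {N : ℕ} (π : Equiv.Perm (Fin N)) (i j : Fin N) : Fin 3 → Copies N → Copies N
  | 0, c => freeStrand π c
  | 1, c => freeStrand (π * Equiv.swap i j) c
  | 2, Sum.inl k => if k = i then Sum.inl j else if k = j then Sum.inl i else Sum.inr (π k)
  | 2, Sum.inr k =>
      if k = π i then Sum.inr (π j) else if k = π j then Sum.inr (π i)
      else Sum.inl (π.symm k)

lemma freeStrand_invol {N : ℕ} (π : Equiv.Perm (Fin N)) :
    Function.Involutive (freeStrand π) := by
  rintro (k | k) <;> simp [freeStrand]

lemma intStrand_invol {N : ℕ} (π : Equiv.Perm (Fin N)) (i j : Fin N) (a : Fin 3) :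
    Function.Involutive (intStrand π i j a) := by
  intro c
  fin_cases a
  · exact freeStrand_invol π c
  · exact freeStrand_invol _ c
  · rcases c with k | k
    · by_cases h1 : k = i
      · by_cases h3 : j = i <;> simp [intStrand, h1, h3]
      · by_cases h2 : k = j
        · by_cases h3 : j = i <;> simp [intStrand, h2, h3]
        · simp [intStrand, h1, h2]
    · by_cases h1 : k = π i
      · by_cases h3 : j = i <;> simp [intStrand, h1, h3]
      · by_cases h2 : k = π j
        · by_cases h3 : j = i <;> simp [intStrand, h2, h3]
        · have h1' : π.symm k ≠ i := fun h => h1 (by rw [← h]; simp)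
          have h2' : π.symm k ≠ j := fun h => h2 (by rw [← h]; simp)
          simp [intStrand, h1, h2, h1', h2']

namespace Network

variable {V : Type u} (Γ : Network V)

/-- The field arguments: a leg of a vertex and one of the copies of its field. -/
abbrev Point (V : Type u) (N : ℕ) : Type u := (V × Fin 3) × Copies N

/-- The fixed propagation at a boundary node: the cyclic permutation on the region `R` and the
identity elsewhere. The region is empty for `Z_0` and equal to `A` for `Z_A`. -/
def boundaryPerm (N : ℕ) (R : Set Γ.OpenLeg) (x : Γ.OpenLeg) : Equiv.Perm (Fin N) :=
  if x ∈ R then finRotate N else 1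

/-- The contraction pattern: a link of `E` joins equal copies of its two legs; an open leg is
contracted through the fixed propagation of its boundary node. -/
def contraction (N : ℕ) (R : Set Γ.OpenLeg) (p : Point V N) : Point V N :=
  if h : Γ.glue p.1 = p.1 then (p.1, freeStrand (Γ.boundaryPerm N R ⟨p.1, h⟩) p.2)
  else (Γ.glue p.1, p.2)

lemma contraction_invol (N : ℕ) (R : Set Γ.OpenLeg) :
    Function.Involutive (Γ.contraction N R) := by
  rintro ⟨l, c⟩
  by_cases h : Γ.glue l = l
  · simp [contraction, h, freeStrand_invol _ c]
  · have h' : ¬ Γ.glue (Γ.glue l) = Γ.glue l := by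
      rw [Γ.glue_glue]; exact fun e => h e.symm
    simp [contraction, h, Γ.glue_glue, Ne.symm (a := Γ.glue l) (b := l) h]

/-- The diagram of the free theory with the local propagation `π x` at each vertex `x`. The copy
`k` of `x` has the gauge parameter `(x, k)`. -/
def freeDiagram {N : ℕ} (R : Set Γ.OpenLeg) (π : V → Equiv.Perm (Fin N)) :
    StrandedDiagram (Point V N) (V × Fin N) where
  contract := Γ.contraction N R
  strand p := (p.1, freeStrand (π p.1.1) p.2)
  contract_invol := Γ.contraction_invol N R
  strand_invol := by
    rintro ⟨l, c⟩
    simp [freeStrand_invol _ c]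
  gauge
    | (l, Sum.inl k) => FreeGroup.of (l.1, k)
    | (_, Sum.inr _) => 1

end Network

/-- The data of a diagram with a single local interaction process: permutations at all vertices,
the vertex of the interaction and the (ordered) pair of its interacting incoming copies. -/
structure Interaction (V : Type u) (N : ℕ) where
  perm : V → Equiv.Perm (Fin N)
  node : V
  fst : Fin N
  snd : Fin N
  fst_ne_snd : fst ≠ snd

instance {V : Type u} [Finite V] {N : ℕ} : Finite (Interaction V N) :=
  Finite.of_injective
    (β := (V → Equiv.Perm (Fin N)) × V × Fin N × Fin N)
    (fun x => (x.perm, x.node, x.fst, x.snd)) (by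
      rintro ⟨a, b, c, d, _⟩ ⟨a', b', c', d', _⟩ h
      simp only [Prod.mk.injEq] at h
      obtain ⟨rfl, rfl, rfl, rfl⟩ := h
      rfl)

instance {V : Type u} [Finite V] {N : ℕ} : Fintype (Interaction V N) := Fintype.ofFinite _

namespace Network

variable {V : Type u} (Γ : Network V)

/-- The diagram with a single local interaction process. The four interacting fields have
independent gauge parameters: `(x, i)` and `(x, j)` for the incoming ones, and two additional
ones for the outgoing ones. -/
def interactionDiagram {N : ℕ} (R : Set Γ.OpenLeg) (I : Interaction V N) :
    StrandedDiagram (Point V N) ((V × Fin N) ⊕ Fin 2) where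
  contract := Γ.contraction N R
  strand p :=
    (p.1, if p.1.1 = I.node then intStrand (I.perm p.1.1) I.fst I.snd p.1.2 p.2
      else freeStrand (I.perm p.1.1) p.2)
  contract_invol := Γ.contraction_invol N R
  strand_invol := by
    rintro ⟨l, c⟩
    by_cases h : l.1 = I.node
    · simp [h, intStrand_invol _ _ _ _ c]
    · simp [h, freeStrand_invol _ c]
  gauge
    | (l, Sum.inl k) => FreeGroup.of (Sum.inl (l.1, k))
    | (l, Sum.inr k) =>
        if l.1 = I.node ∧ k = I.perm l.1 I.fst then FreeGroup.of (Sum.inr 0)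
        else if l.1 = I.node ∧ k = I.perm l.1 I.snd then FreeGroup.of (Sum.inr 1)
        else 1

/-- The pattern with the domain wall `τ`: the cyclic permutation at the vertices that are
connected to the region `R` after omission of `τ`, the identity at the others. -/
def wallPattern (N : ℕ) (R : Set Γ.OpenLeg) (τ : Set Γ.Link) (x : V) : Equiv.Perm (Fin N) :=
  if ∃ a ∈ R, (Γ.graphOff τ).Reachable (Sum.inl x) (Sum.inr a) then finRotate N else 1

variable [Fintype V]

/-- The locally averaged expectation of `Z_R^(N)` up to linear order in the coupling: the sum of
the amplitudes of all free local diagrams, minus the coupling times the sum of the amplitudes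
of all diagrams with a single local interaction process. -/
def partitionFunction (N : ℕ) (R : Set Γ.OpenLeg) (coupling : ℝ)
    {G : Type*} [Group G] [MeasurableSpace G] (μ : Measure G) (δ : G → ℝ) : ℝ :=
  ∑ π : V → Equiv.Perm (Fin N), (Γ.freeDiagram R π).amplitude μ δ
    - coupling * ∑ I : Interaction V N, (Γ.interactionDiagram R I).amplitude μ δ

/-- The averaged Rényi entropy `(1 - N)⁻¹ ln (E[Z_A] / E[Z_0])` up to linear order. -/
def renyiEntropy (N : ℕ) (A : Set Γ.OpenLeg) (coupling : ℝ)
    {G : Type*} [Group G] [MeasurableSpace G] (μ : Measure G) (δ : G → ℝ) : ℝ :=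
  (1 / (1 - (N : ℝ))) * Real.log
    (Γ.partitionFunction N A coupling μ δ / Γ.partitionFunction N ∅ coupling μ δ)

/-- The degree `N (|E ∪ ∂Γ| - |V|) - (N - 1) |τ|` of the pattern with the domain wall `τ`. -/
def wallDegree (N : ℕ) (τ : Set Γ.Link) : ℝ :=
  (N : ℝ) * ((Nat.card Γ.Link : ℝ) - (Nat.card V : ℝ)) - ((N : ℝ) - 1) * (τ.ncard : ℝ)

end Network

/-! ### Delta functions -/

/-- The normalised Haar measure of a finite group. -/
def uniformMeasure (G : Type*) [MeasurableSpace G] : Measure G :=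
  ProbabilityTheory.uniformOn (Set.univ : Set G)

/-- The delta function of a finite group; `δ(e)` is the order `D` of the group. -/
def finiteDelta (G : Type*) [Group G] (g : G) : ℝ := if g = 1 then (Nat.card G : ℝ) else 0

/-- A regularisation `δ₀, δ₁, …` of the delta function of a compact metric group with normalised
Haar measure `μ`, by non-negative, central, inversion-symmetric functions of integral one that
are largest at the identity, whose values there tend to infinity, and which are comparable to
that value on a ball of comparable volume. Examples on a compact Lie group are the normalised
indicator functions of balls and the heat kernels. -/
structure IsDeltaRegularisation {G : Type*} [Group G] [MetricSpace G] [MeasurableSpace G]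
    (μ : Measure G) (δ : ℕ → G → ℝ) : Prop where
  measurable : ∀ n, Measurable (δ n)
  nonneg : ∀ n g, 0 ≤ δ n g
  le_one : ∀ n g, δ n g ≤ δ n 1
  central : ∀ n g k, δ n (k * g * k⁻¹) = δ n g
  symm : ∀ n g, δ n g⁻¹ = δ n g
  integral_eq_one : ∀ n, ∫ g, δ n g ∂μ = 1
  tendsto : Tendsto (fun n => δ n 1) atTop atTop
  comparable : ∃ c : ℝ, 0 < c ∧ ∀ n, ∃ r : ℝ, 0 < r ∧
    (∀ g ∈ Metric.closedBall (1 : G) r, c * δ n 1 ≤ δ n g) ∧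
    c ≤ δ n 1 * μ.real (Metric.closedBall (1 : G) r)

end GFT

end

noncomputable section

open scoped Classical

namespace GFT

/-! ### Faces of stranded diagrams -/

namespace StrandedDiagram

variable {P : Type*} {L : Type*} (𝒢 : StrandedDiagram P L)

/-! Every face runs along a single link of `Γ`. Its delta function is either used up by the
integration over a gauge parameter, or it is bounded by `δ(e)`. An upper bound for a degree is
therefore the number of faces that are left when as many as possible have been integrated away.

Upper bound: by max-flow min-cut, `|τ|` disjoint paths join the region `R` with the other open
links, where `τ` is the minimal cut. A forest with one link for each vertex off the paths connects
these vertices with the paths or the boundary. All faces on forest links can be eliminated, the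
deepest ones being integrated first. On a path, the cyclic permutation at one end and the identity
at the other connect all faces with each other, so all but one can be eliminated. Paths and forest
use `|V| + |τ|` links, and every other link carries at most `N` faces. What is left is `|τ| + N (|E
∪ ∂Γ| - |V| - |τ|)`, which is `wallDegree` (`exists_eliminable_card_le`,
`Propagation.amplitude_le`).

Strictness: a link whose two ends are paired differently carries fewer than `N` faces
(`card_faces_lt`). Uniqueness of the minimal cut lets the paths avoid any given link outside of `τ`.
So can the forest, because each nonempty vertex set has two leaving links outside of `τ`
(`exists_leaving_link_notMem`). If the avoided link is a mismatch, the bound drops by one. Every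
diagram except the wall pattern has a mismatch outside of `τ` (`exists_mismatch_free`,
`exists_mismatch_interaction`).

Lower bound: if all gauge parameters are close to the identity, so are all holonomies
(`le_amplitude`). For the wall pattern the number of faces (`card_faces_wall`) makes this match the
upper bound up to a constant. The situation `Z_0` is the case `R = ∅`, `τ = ∅`. -/

lemma step_injective : Function.Injective 𝒢.step :=
  𝒢.contract_invol.injective.comp 𝒢.strand_invol.injective

/-- The two involutions act as a dihedral group: `strand` conjugates `step` into its inverse, which
reverses the orientation of a face. -/
lemma iterate_step_strand (j : ℕ) (p : P) :
    𝒢.step^[j] (𝒢.strand (𝒢.step^[j] p)) = 𝒢.strand p := by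
  induction j generalizing p with
  | zero => rfl
  | succ j ih =>
    rw [Function.iterate_succ_apply' 𝒢.step j (𝒢.strand _), Function.iterate_succ_apply, ih]
    simp only [step, 𝒢.strand_invol _, 𝒢.contract_invol _]

/-- The two orientations of a face are disjoint if no strand and no contraction degenerates. -/
lemma strand_ne_iterate_step (hs : ∀ p, 𝒢.strand p ≠ p) (hc : ∀ p, 𝒢.contract p ≠ p)
    (i : ℕ) (p : P) : 𝒢.strand p ≠ 𝒢.step^[i] p := by
  intro h
  obtain ⟨j, rfl | rfl⟩ : ∃ j, i = j + j ∨ i = j + (j + 1) := by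
    rcases Nat.even_or_odd i with ⟨j, hj⟩ | ⟨j, hj⟩
    · exact ⟨j, Or.inl hj⟩
    · exact ⟨j, Or.inr (by omega)⟩
  · rw [← 𝒢.iterate_step_strand j p, Function.iterate_add_apply] at h
    exact hs _ (𝒢.step_injective.iterate j h)
  · rw [← 𝒢.iterate_step_strand j p, Function.iterate_add_apply] at h
    have := 𝒢.step_injective.iterate j h
    rw [Function.iterate_succ_apply'] at this
    exact hc _ this.symm

/-- The face through a strand end. -/
def face (p : P) : 𝒢.Face := Quotient.mk 𝒢.faceSetoid p

lemma face_out (f : 𝒢.Face) : 𝒢.face (Quotient.out (s := 𝒢.faceSetoid) f) = f :=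
  Quotient.out_eq (s := 𝒢.faceSetoid) f

lemma face_strand (p : P) : 𝒢.face (𝒢.strand p) = 𝒢.face p :=
  Quotient.sound (s := 𝒢.faceSetoid)
    (Relation.EqvGen.symm _ _ (Relation.EqvGen.rel _ _ (Or.inl rfl)))

lemma face_contract (p : P) : 𝒢.face (𝒢.contract p) = 𝒢.face p :=
  Quotient.sound (s := 𝒢.faceSetoid)
    (Relation.EqvGen.symm _ _ (Relation.EqvGen.rel _ _ (Or.inr rfl)))

/-- A function that is constant along strands and contractions is constant on faces. -/
lemma eq_of_face_eq {α : Type*} (φ : P → α) (hs : ∀ p, φ (𝒢.strand p) = φ p)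
    (hc : ∀ p, φ (𝒢.contract p) = φ p) {p q : P} (h : 𝒢.face p = 𝒢.face q) : φ p = φ q := by
  have h' : Relation.EqvGen (fun p p' => p' = 𝒢.strand p ∨ p' = 𝒢.contract p) p q :=
    Quotient.exact (s := 𝒢.faceSetoid) h
  clear h
  induction h' with
  | rel x y h => rcases h with rfl | rfl <;> simp [hs, hc]
  | refl => rfl
  | symm x y _ ih => exact ih.symm
  | trans x y z _ _ ih₁ ih₂ => exact ih₁.trans ih₂

/-- The `step`-orbit of `p` and its image under `strand` form a set that is closed under both
involutions, hence the whole face. -/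
lemma exists_iterate_of_face_eq [Finite P] {p q : P} (h : 𝒢.face q = 𝒢.face p) :
    ∃ i < Function.minimalPeriod 𝒢.step p,
      q = 𝒢.step^[i] p ∨ q = 𝒢.strand (𝒢.step^[i] p) := by
  have hpos : 0 < Function.minimalPeriod 𝒢.step p :=
    Function.minimalPeriod_pos_iff_mem_periodicPts.2 (𝒢.step_injective.mem_periodicPts p)
  have key : (∃ i, q = 𝒢.step^[i] p ∨ q = 𝒢.strand (𝒢.step^[i] p)) =
      (∃ i, p = 𝒢.step^[i] p ∨ p = 𝒢.strand (𝒢.step^[i] p)) := by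
    have hs : ∀ q, (∃ i, q = 𝒢.step^[i] p ∨ q = 𝒢.strand (𝒢.step^[i] p)) →
        (∃ i, 𝒢.strand q = 𝒢.step^[i] p ∨ 𝒢.strand q = 𝒢.strand (𝒢.step^[i] p)) := by
      rintro q ⟨i, rfl | rfl⟩
      · exact ⟨i, Or.inr rfl⟩
      · exact ⟨i, Or.inl (𝒢.strand_invol _)⟩
    have hc : ∀ q, (∃ i, q = 𝒢.step^[i] p ∨ q = 𝒢.strand (𝒢.step^[i] p)) →
        (∃ i, 𝒢.contract q = 𝒢.step^[i] p ∨ 𝒢.contract q = 𝒢.strand (𝒢.step^[i] p)) := by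
      rintro q ⟨i, rfl | rfl⟩
      -- Going around by one less than the period is the backward step, without negative iterates.
      · refine ⟨i + (Function.minimalPeriod 𝒢.step p - 1), Or.inr ?_⟩
        have : 𝒢.step^[i] p = 𝒢.step (𝒢.step^[i + (Function.minimalPeriod 𝒢.step p - 1)] p) := by
          rw [← Function.iterate_succ_apply' 𝒢.step]
          have e : (i + (Function.minimalPeriod 𝒢.step p - 1)).succ =
            i + Function.minimalPeriod 𝒢.step p := by omega
          rw [e, Function.iterate_add_minimalPeriod_eq]
        rw [this, step, 𝒢.contract_invol]
      · exact ⟨i + 1, Or.inl (by rw [Function.iterate_succ_apply']; rfl)⟩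
    refine 𝒢.eq_of_face_eq
      (fun q => ∃ i, q = 𝒢.step^[i] p ∨ q = 𝒢.strand (𝒢.step^[i] p)) ?_ ?_ h
    · intro q
      refine propext ⟨fun h => ?_, hs q⟩
      simpa only [𝒢.strand_invol q] using hs _ h
    · intro q
      refine propext ⟨fun h => ?_, hc q⟩
      simpa only [𝒢.contract_invol q] using hc _ h
  obtain ⟨i, hi⟩ := key.mpr ⟨0, Or.inl rfl⟩
  exact ⟨i % Function.minimalPeriod 𝒢.step p, Nat.mod_lt _ hpos, by
    simpa only [Function.iterate_mod_minimalPeriod_eq] using hi⟩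

/-! ### Dependence of a holonomy on one gauge parameter -/

section Holonomy

variable {G : Type*} [Group G] {label : P → Option L}

lemma lift_update_gauge (hlab : ∀ q, 𝒢.gauge q = (label q).elim 1 FreeGroup.of) (h : L → G)
    (l : L) (g : G) {q : P} (hq : label q ≠ some l) :
    FreeGroup.lift (Function.update h l g) (𝒢.gauge q) = FreeGroup.lift h (𝒢.gauge q) := by
  rw [hlab]
  cases hl : label q with
  | none => simp
  | some l' =>
    have : l' ≠ l := fun e => hq (by rw [hl, e])
    simp [this]

lemma holonomy_eq_prod (h : L → G) (f : 𝒢.Face) :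
    𝒢.holonomy h f = ((List.range (Function.minimalPeriod 𝒢.step
      (Quotient.out (s := 𝒢.faceSetoid) f))).map fun i => FreeGroup.lift h
        (𝒢.transport (𝒢.step^[i] (Quotient.out (s := 𝒢.faceSetoid) f)))).reverse.prod := by
  rw [holonomy, word, map_list_prod, List.map_reverse, List.map_map]
  rfl

lemma face_iterate_step (i : ℕ) (p : P) : 𝒢.face (𝒢.step^[i] p) = 𝒢.face p := by
  induction i with
  | zero => rfl
  | succ i ih => rw [Function.iterate_succ_apply', step, face_contract, face_strand, ih]

/-- The holonomy of a face does not depend on a gauge parameter that does not occur on it. -/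
lemma holonomy_update_of_forall_ne
    (hlab : ∀ q, 𝒢.gauge q = (label q).elim 1 FreeGroup.of) (f : 𝒢.Face) (l : L)
    (hl : ∀ q, 𝒢.face q = f → label q ≠ some l) (h : L → G) (g : G) :
    𝒢.holonomy (Function.update h l g) f = 𝒢.holonomy h f := by
  rw [holonomy_eq_prod, holonomy_eq_prod]
  congr 2
  refine List.map_congr_left fun i _ => ?_
  have h1 : 𝒢.face (𝒢.step^[i] (Quotient.out (s := 𝒢.faceSetoid) f)) = f := by
    rw [face_iterate_step, face_out]
  simp only [transport, map_mul, map_inv]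
  rw [𝒢.lift_update_gauge hlab h l g (hl _ h1),
    𝒢.lift_update_gauge hlab h l g (hl _ (by rw [face_strand, h1]))]

/-- The holonomy of a face is a translate of a gauge parameter that occurs exactly once on it. -/
lemma holonomy_update_of_unique [Finite P] (hs : ∀ p, 𝒢.strand p ≠ p)
    (hc : ∀ p, 𝒢.contract p ≠ p)
    (hlab : ∀ q, 𝒢.gauge q = (label q).elim 1 FreeGroup.of) (q₀ : P) (l : L)
    (hq₀ : label q₀ = some l)
    (hl : ∀ q, 𝒢.face q = 𝒢.face q₀ → label q = some l → q = q₀) (h : L → G) :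
    ∃ a b : G, (∀ g, 𝒢.holonomy (Function.update h l g) (𝒢.face q₀) = a * g * b) ∨
      (∀ g, 𝒢.holonomy (Function.update h l g) (𝒢.face q₀) = a * g⁻¹ * b) := by
  set p := Quotient.out (s := 𝒢.faceSetoid) (𝒢.face q₀) with hp
  have hpf : 𝒢.face p = 𝒢.face q₀ := 𝒢.face_out _
  set n := Function.minimalPeriod 𝒢.step p with hn
  obtain ⟨i, hin, hi⟩ := 𝒢.exists_iterate_of_face_eq (hpf.symm)
  have hfi : ∀ j, 𝒢.face (𝒢.step^[j] p) = 𝒢.face q₀ := fun j => by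
    rw [face_iterate_step, hpf]
  have hfs : ∀ j, 𝒢.face (𝒢.strand (𝒢.step^[j] p)) = 𝒢.face q₀ := fun j => by
    rw [face_strand, hfi]
  -- The two orientations of the face are disjoint, so `q₀` belongs to exactly one factor of the
  -- holonomy product.
  have cross : ∀ j k, 𝒢.step^[j] p ≠ 𝒢.strand (𝒢.step^[k] p) := by
    intro j k e
    have e2 := 𝒢.iterate_step_strand k p
    rw [← e, ← Function.iterate_add_apply] at e2
    exact 𝒢.strand_ne_iterate_step hs hc _ _ e2.symm
  have hne : ∀ j < n, j ≠ i → 𝒢.step^[j] p ≠ q₀ ∧ 𝒢.strand (𝒢.step^[j] p) ≠ q₀ := by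
    intro j hj hji
    have inj : 𝒢.step^[j] p ≠ 𝒢.step^[i] p := fun e =>
      hji (Function.iterate_injOn_Iio_minimalPeriod (f := 𝒢.step) (x := p) hj hin e)
    rcases hi with hi | hi
    · rw [hi]; exact ⟨inj, fun e => cross _ _ e.symm⟩
    · rw [hi]; exact ⟨fun e => cross _ _ e, fun e => inj (𝒢.strand_invol.injective e)⟩
  -- The product is split at this factor; the ones before and after it do not involve `l`.
  obtain ⟨l₁, l₂, hsplit⟩ := List.append_of_mem (List.mem_range.2 hin)
  have hnd : (l₁ ++ i :: l₂).Nodup := hsplit ▸ List.nodup_range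
  have hconst : ∀ g, ∀ j < n, j ≠ i →
      FreeGroup.lift (Function.update h l g) (𝒢.transport (𝒢.step^[j] p)) =
        FreeGroup.lift h (𝒢.transport (𝒢.step^[j] p)) := by
    intro g j hj hji
    simp only [transport, map_mul, map_inv]
    rw [𝒢.lift_update_gauge hlab h l g (fun e => (hne j hj hji).1 (hl _ (hfi j) e)),
      𝒢.lift_update_gauge hlab h l g (fun e => (hne j hj hji).2 (hl _ (hfs j) e))]
  have hmem : ∀ j, j ∈ l₁ ∨ j ∈ l₂ → j < n ∧ j ≠ i := by
    intro j hj
    refine ⟨List.mem_range.1 (hsplit ▸ by simp; tauto), ?_⟩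
    rintro rfl
    rw [List.nodup_append] at hnd
    rcases hj with hj | hj
    · exact hnd.2.2 j hj j (by simp) rfl
    · exact (List.nodup_cons.1 hnd.2.1).1 hj
  obtain ⟨a, b, hprod⟩ : ∃ a b : G, ∀ g, 𝒢.holonomy (Function.update h l g) (𝒢.face q₀) =
      a * FreeGroup.lift (Function.update h l g) (𝒢.transport (𝒢.step^[i] p)) * b := by
    refine ⟨(l₂.map fun j => FreeGroup.lift h (𝒢.transport (𝒢.step^[j] p))).reverse.prod,
      (l₁.map fun j => FreeGroup.lift h (𝒢.transport (𝒢.step^[j] p))).reverse.prod, fun g => ?_⟩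
    rw [holonomy_eq_prod, ← hp, ← hn, hsplit, List.map_append, List.map_cons,
      List.reverse_append, List.reverse_cons, List.prod_append, List.prod_append]
    rw [List.map_congr_left (fun j hj => hconst g j (hmem j (Or.inl hj)).1 (hmem j (Or.inl hj)).2),
      List.map_congr_left (fun j hj => hconst g j (hmem j (Or.inr hj)).1 (hmem j (Or.inr hj)).2)]
    simp
  have hgl : ∀ g, FreeGroup.lift (Function.update h l g) (𝒢.gauge q₀) = g := by
    intro g; rw [hlab, hq₀]; simp
  have hother : ∀ g, FreeGroup.lift (Function.update h l g) (𝒢.gauge (𝒢.strand q₀)) =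
      FreeGroup.lift h (𝒢.gauge (𝒢.strand q₀)) := fun g =>
    𝒢.lift_update_gauge hlab h l g (fun e => hs q₀ (hl _ (𝒢.face_strand _) e))
  -- The parameter enters as itself or inverted, according to whether the chosen orientation leaves
  -- or reaches `q₀` along its strand.
  rcases hi with hi | hi
  · refine ⟨a * (FreeGroup.lift h (𝒢.gauge (𝒢.strand q₀)))⁻¹, b, Or.inl fun g => ?_⟩
    rw [hprod, ← hi, transport, map_mul, map_inv, hgl, hother, ← mul_assoc]
  · refine ⟨a, FreeGroup.lift h (𝒢.gauge (𝒢.strand q₀)) * b, Or.inr fun g => ?_⟩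
    have : 𝒢.step^[i] p = 𝒢.strand q₀ := by rw [hi, 𝒢.strand_invol]
    rw [hprod, this, transport, 𝒢.strand_invol, map_mul, map_inv, hgl, hother]
    simp only [mul_assoc]

end Holonomy

end StrandedDiagram

/-! ### Bounds for amplitudes -/

/-- The properties of a regularised delta function that are used for upper bounds. -/
structure IsDeltaFunction {G : Type*} [Group G] [MeasurableSpace G] (μ : Measure G)
    (δ : G → ℝ) : Prop where
  measurable : Measurable δ
  nonneg : ∀ g, 0 ≤ δ g
  le_one : ∀ g, δ g ≤ δ 1
  central : ∀ g k, δ (k * g * k⁻¹) = δ g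
  symm : ∀ g, δ g⁻¹ = δ g
  integral_eq_one : ∫ g, δ g ∂μ = 1

namespace IsDeltaFunction

variable {G : Type*} [Group G] [MeasurableSpace G] {μ : Measure G} {δ : G → ℝ}

/-- The integral of a non-integrable function is `0` by convention, so the normalisation to `1`
forces integrability. -/
lemma integrable (hδ : IsDeltaFunction μ δ) : Integrable δ μ := by
  by_contra h
  have := hδ.integral_eq_one
  rw [integral_undef h] at this
  exact zero_ne_one this

lemma lintegral_eq_one (hδ : IsDeltaFunction μ δ) : ∫⁻ g, ENNReal.ofReal (δ g) ∂μ = 1 := by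
  rw [← ofReal_integral_eq_lintegral_ofReal hδ.integrable (ae_of_all _ hδ.nonneg),
    hδ.integral_eq_one, ENNReal.ofReal_one]

/-- Centrality moves `b` cyclically to the front, so invariance of `μ` on the left is enough. -/
lemma lintegral_translate [MeasurableMul₂ G] [μ.IsMulLeftInvariant] (hδ : IsDeltaFunction μ δ)
    (a b : G) : ∫⁻ g, ENNReal.ofReal (δ (a * g * b)) ∂μ = 1 := by
  have : ∀ g, δ (a * g * b) = δ (b * a * g) := by
    intro g
    rw [← hδ.central (a * g * b) b]
    congr 1
    group
  simp_rw [this]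
  rw [lintegral_mul_left_eq_self (fun g => ENNReal.ofReal (δ g)), hδ.lintegral_eq_one]

lemma lintegral_translate_inv [MeasurableMul₂ G] [μ.IsMulLeftInvariant]
    (hδ : IsDeltaFunction μ δ) (a b : G) :
    ∫⁻ g, ENNReal.ofReal (δ (a * g⁻¹ * b)) ∂μ = 1 := by
  have : ∀ g, δ (a * g⁻¹ * b) = δ (b⁻¹ * g * a⁻¹) := by
    intro g
    rw [← hδ.symm]
    congr 1
    group
  simp_rw [this]
  exact hδ.lintegral_translate _ _

end IsDeltaFunction

/-- Fubini in one coordinate. The inner integral no longer depends on `h i`, and the outer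
integration over it gives a factor `1`. -/
lemma lintegral_pi_update {ι : Type*} [Fintype ι] {G : Type*} [MeasurableSpace G]
    (μ : Measure G) [IsProbabilityMeasure μ] (i : ι) {F : (ι → G) → ENNReal} (hF : Measurable F) :
    ∫⁻ h, F h ∂(Measure.pi fun _ => μ) =
      ∫⁻ h, ∫⁻ g, F (Function.update h i g) ∂μ ∂(Measure.pi fun _ => μ) := by
  have hG : Nonempty G := μ.nonempty_of_neZero
  -- A marginal over all coordinates does not depend on the base point.
  have x₀ : ι → G := fun _ => Classical.arbitrary G
  have hF' : Measurable fun h => ∫⁻ g, F (Function.update h i g) ∂μ := by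
    have := hF.lmarginal (fun _ : ι => μ) (s := {i})
    rwa [lmarginal_singleton] at this
  have hi : i ∉ Finset.univ.erase i := by simp
  have hu : (Finset.univ : Finset ι) = insert i (Finset.univ.erase i) := by simp
  rw [lintegral_eq_lmarginal_univ x₀, lintegral_eq_lmarginal_univ x₀, hu,
    lmarginal_insert' _ hF hi, lmarginal_insert' _ hF' hi]
  congr 1
  ext x
  simp

/-! ### Integrating faces away -/

namespace StrandedDiagram

variable {P : Type*} {L : Type*} (𝒢 : StrandedDiagram P L)
variable {G : Type*} [Group G] [MeasurableSpace G]

lemma measurable_holonomy [MeasurableMul₂ G] [MeasurableInv G] (f : 𝒢.Face) :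
    Measurable fun h : L → G => 𝒢.holonomy h f := by
  unfold holonomy
  induction 𝒢.word (Quotient.out (s := 𝒢.faceSetoid) f) using FreeGroup.induction_on with
  | C1 => simp
  | of x => simpa using measurable_pi_apply x
  | inv_of x h => simp only [map_inv]; exact h.inv
  | mul x y hx hy => simp only [map_mul]; exact hx.mul hy

/-- A family `I` of faces, with gauge parameters that occur exactly once on their face, and on
other faces of the family only on those of smaller height. -/
structure Eliminable (I : Finset 𝒢.Face) (pt : 𝒢.Face → P) (label : P → Option L)
    (ht : 𝒢.Face → ℕ) : Prop where
  face_pt : ∀ f ∈ I, 𝒢.face (pt f) = f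
  label_ne : ∀ f ∈ I, label (pt f) ≠ none
  unique : ∀ f ∈ I, ∀ q, 𝒢.face q = f → label q = label (pt f) → q = pt f
  ht_lt : ∀ f ∈ I, ∀ q, 𝒢.face q ∈ I → label q = label (pt f) → 𝒢.face q ≠ f →
    ht (𝒢.face q) < ht f

-- The parameter of a face of least height occurs on no other face of the family, since such a face
-- would have to be lower. Its integral meets only one delta function and gives `1`; induction
-- removes the face.
variable {𝒢} in
lemma lintegral_prod_le_one [Finite P] [Fintype L] [MeasurableMul₂ G] [MeasurableInv G]
    {μ : Measure G}
    [IsProbabilityMeasure μ] [μ.IsMulLeftInvariant] {δ : G → ℝ} (hδ : IsDeltaFunction μ δ)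
    (hs : ∀ p, 𝒢.strand p ≠ p) (hc : ∀ p, 𝒢.contract p ≠ p) {label : P → Option L}
    (hlab : ∀ q, 𝒢.gauge q = (label q).elim 1 FreeGroup.of)
    {pt : 𝒢.Face → P} {ht : 𝒢.Face → ℕ} (I : Finset 𝒢.Face)
    (hI : 𝒢.Eliminable I pt label ht) :
    ∫⁻ h : L → G, ∏ f ∈ I, ENNReal.ofReal (δ (𝒢.holonomy h f)) ∂(Measure.pi fun _ => μ) ≤ 1 := by
  induction hn : I.card generalizing I with
  | zero =>
    rw [Finset.card_eq_zero] at hn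
    subst hn
    simp
  | succ n ih =>
    have hne : I.Nonempty := Finset.card_pos.1 (by omega)
    obtain ⟨f, hf, hmin⟩ := Finset.exists_min_image I ht hne
    obtain ⟨l, hl⟩ := Option.ne_none_iff_exists'.1 (hI.label_ne f hf)
    have hmeas : ∀ f : 𝒢.Face, Measurable fun h : L → G =>
        ENNReal.ofReal (δ (𝒢.holonomy h f)) := fun f =>
      (hδ.measurable.comp (𝒢.measurable_holonomy f)).ennreal_ofReal
    rw [lintegral_pi_update μ l (Finset.measurable_prod _ fun f _ => hmeas f)]
    have hrest : ∀ (h : L → G) (g : G), ∏ f' ∈ I.erase f,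
        ENNReal.ofReal (δ (𝒢.holonomy (Function.update h l g) f')) =
        ∏ f' ∈ I.erase f, ENNReal.ofReal (δ (𝒢.holonomy h f')) := by
      intro h g
      refine Finset.prod_congr rfl fun f' hf' => ?_
      rw [Finset.mem_erase] at hf'
      rw [𝒢.holonomy_update_of_forall_ne hlab]
      intro q hq hql
      have := hI.ht_lt f hf q (hq ▸ hf'.2) (by rw [hql, hl]) (hq ▸ hf'.1)
      rw [hq] at this
      exact absurd (hmin f' hf'.2) (by omega)
    have hone : ∀ h : L → G, ∫⁻ g, ∏ f' ∈ I,
        ENNReal.ofReal (δ (𝒢.holonomy (Function.update h l g) f')) ∂μ =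
        ∏ f' ∈ I.erase f, ENNReal.ofReal (δ (𝒢.holonomy h f')) := by
      intro h
      simp_rw [← Finset.mul_prod_erase I _ hf, hrest]
      rw [lintegral_mul_const]
      · suffices hfac : ∫⁻ g, ENNReal.ofReal (δ (𝒢.holonomy (Function.update h l g) f)) ∂μ = 1 by
          rw [hfac, one_mul]
        have hpt := hI.face_pt f hf
        obtain ⟨a, b, hab | hab⟩ := 𝒢.holonomy_update_of_unique hs hc hlab (pt f) l hl
          (fun q hq hql => hI.unique f hf q (hq.trans hpt) (hql.trans hl.symm)) h
        · rw [hpt] at hab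
          simp_rw [hab]
          exact hδ.lintegral_translate a b
        · rw [hpt] at hab
          simp_rw [hab]
          exact hδ.lintegral_translate_inv a b
      · exact (hmeas f).comp (measurable_update h)
    simp_rw [hone]
    refine ih (I.erase f) ⟨fun f' h => hI.face_pt f' (Finset.mem_of_mem_erase h),
      fun f' h => hI.label_ne f' (Finset.mem_of_mem_erase h),
      fun f' h => hI.unique f' (Finset.mem_of_mem_erase h),
      fun f' h q hq => hI.ht_lt f' (Finset.mem_of_mem_erase h) q (Finset.mem_of_mem_erase hq)⟩ ?_
    rw [Finset.card_erase_of_mem hf, hn]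
    rfl

lemma amplitude_eq_toReal [Finite P] [Fintype L] [MeasurableMul₂ G] [MeasurableInv G]
    {μ : Measure G} {δ : G → ℝ} (hδ : IsDeltaFunction μ δ) :
    𝒢.amplitude μ δ = (∫⁻ h : L → G, ∏ f : 𝒢.Face, ENNReal.ofReal (δ (𝒢.holonomy h f))
      ∂(Measure.pi fun _ => μ)).toReal := by
  rw [amplitude, integral_eq_lintegral_of_nonneg_ae
    (ae_of_all _ fun h => Finset.prod_nonneg fun f _ => hδ.nonneg _)]
  · congr 2
    ext h
    rw [ENNReal.ofReal_prod_of_nonneg fun f _ => hδ.nonneg _]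
  · exact (Finset.measurable_prod _ fun f _ =>
      hδ.measurable.comp (𝒢.measurable_holonomy f)).aestronglyMeasurable

-- Faces outside of `I` are bounded by the maximum `δ 1`, and those in `I` integrate to at most `1`.
variable {𝒢} in
lemma amplitude_le_pow [Finite P] [Fintype L] [MeasurableMul₂ G] [MeasurableInv G]
    {μ : Measure G}
    [IsProbabilityMeasure μ] [μ.IsMulLeftInvariant] {δ : G → ℝ} (hδ : IsDeltaFunction μ δ)
    (hs : ∀ p, 𝒢.strand p ≠ p) (hc : ∀ p, 𝒢.contract p ≠ p) {label : P → Option L}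
    (hlab : ∀ q, 𝒢.gauge q = (label q).elim 1 FreeGroup.of)
    {pt : 𝒢.Face → P} {ht : 𝒢.Face → ℕ} (I : Finset 𝒢.Face)
    (hI : 𝒢.Eliminable I pt label ht) :
    𝒢.amplitude μ δ ≤ δ 1 ^ (Iᶜ.card) := by
  rw [𝒢.amplitude_eq_toReal hδ]
  refine ENNReal.toReal_le_of_le_ofReal (pow_nonneg (hδ.nonneg 1) _) ?_
  calc ∫⁻ h : L → G, ∏ f : 𝒢.Face, ENNReal.ofReal (δ (𝒢.holonomy h f)) ∂(Measure.pi fun _ => μ)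
      ≤ ∫⁻ h : L → G, ENNReal.ofReal (δ 1) ^ (Iᶜ.card) *
          ∏ f ∈ I, ENNReal.ofReal (δ (𝒢.holonomy h f)) ∂(Measure.pi fun _ => μ) := by
        refine lintegral_mono fun h => ?_
        rw [← Finset.prod_compl_mul_prod I]
        refine mul_le_mul_left ?_ _
        exact Finset.prod_le_pow_card _ _ _ fun f _ => ENNReal.ofReal_le_ofReal (hδ.le_one _)
    _ = ENNReal.ofReal (δ 1) ^ (Iᶜ.card) *
          ∫⁻ h : L → G, ∏ f ∈ I, ENNReal.ofReal (δ (𝒢.holonomy h f)) ∂(Measure.pi fun _ => μ) :=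
        lintegral_const_mul' _ _ (ENNReal.pow_ne_top ENNReal.ofReal_ne_top)
    _ ≤ ENNReal.ofReal (δ 1) ^ (Iᶜ.card) * 1 := by
        gcongr
        exact lintegral_prod_le_one hδ hs hc hlab I hI
    _ = ENNReal.ofReal (δ 1 ^ (Iᶜ.card)) := by
        rw [mul_one, ENNReal.ofReal_pow (hδ.nonneg 1)]

/-- Only the part of the integral where all gauge parameters are in `B` is kept. -/
lemma le_amplitude [Finite P] [Fintype L] [MeasurableMul₂ G] [MeasurableInv G]
    {μ : Measure G} [IsProbabilityMeasure μ] {δ : G → ℝ} (hδ : IsDeltaFunction μ δ)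
    {B : Set G} (hB : MeasurableSet B) {b : ℝ} (hb : 0 ≤ b)
    (hhol : ∀ h : L → G, (∀ l, h l ∈ B) → ∀ f, b ≤ δ (𝒢.holonomy h f)) :
    b ^ (Nat.card 𝒢.Face) * μ.real B ^ (Nat.card L) ≤ 𝒢.amplitude μ δ := by
  have hpos : ∀ h : L → G, 0 ≤ ∏ f : 𝒢.Face, δ (𝒢.holonomy h f) := fun h =>
    Finset.prod_nonneg fun f _ => hδ.nonneg _
  have hintegr : Integrable (fun h : L → G => ∏ f : 𝒢.Face, δ (𝒢.holonomy h f))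
      (Measure.pi fun _ => μ) := by
    refine Integrable.of_bound (C := δ 1 ^ (Finset.univ : Finset 𝒢.Face).card)
      (Finset.measurable_prod _ fun f _ =>
      hδ.measurable.comp (𝒢.measurable_holonomy f)).aestronglyMeasurable (ae_of_all _ fun h => ?_)
    rw [Real.norm_of_nonneg (hpos h)]
    exact (Finset.prod_le_prod (fun f _ => hδ.nonneg _) fun f _ => hδ.le_one _).trans_eq
      (by simp)
  have hBm : MeasurableSet (Set.univ.pi fun _ : L => B) :=
    MeasurableSet.pi Set.countable_univ fun _ _ => hB
  calc b ^ (Nat.card 𝒢.Face) * μ.real B ^ (Nat.card L)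
      = ∫ h : L → G, (Set.univ.pi fun _ : L => B).indicator
          (fun _ => b ^ (Nat.card 𝒢.Face)) h ∂(Measure.pi fun _ => μ) := by
        rw [integral_indicator_const _ hBm, smul_eq_mul, mul_comm, measureReal_def,
          measureReal_def, Measure.pi_pi, Finset.prod_const, ENNReal.toReal_pow,
          Nat.card_eq_fintype_card, Finset.card_univ]
    _ ≤ 𝒢.amplitude μ δ := by
        refine integral_mono ((integrable_const _).indicator hBm) hintegr fun h => ?_
        by_cases hh : h ∈ Set.univ.pi fun _ : L => B
        · rw [Set.indicator_of_mem hh, Nat.card_eq_fintype_card]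
          exact (by simp : b ^ (Fintype.card 𝒢.Face) = ∏ f : 𝒢.Face, b).trans_le
            (Finset.prod_le_prod (fun _ _ => hb)
              fun f _ => hhol h (fun l => hh l (Set.mem_univ l)) f)
        · rw [Set.indicator_of_notMem hh]
          exact hpos h

end StrandedDiagram

/-! ### Cuts of networks -/

namespace Network

variable {V : Type*} (Γ : Network V)

instance [Finite V] : Finite Γ.Link :=
  inferInstanceAs (Finite {e : Sym2 (V × Fin 3) // ∃ l, e = s(l, Γ.glue l)})

instance [Finite V] : Fintype Γ.Link := Fintype.ofFinite _

lemma link_eq_iff {l l' : V × Fin 3} : Γ.link l = Γ.link l' ↔ l = l' ∨ l = Γ.glue l' := by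
  have hval : Γ.link l = Γ.link l' ↔ s(l, Γ.glue l) = s(l', Γ.glue l') :=
    ⟨fun h => congrArg Subtype.val h, fun h => Subtype.ext h⟩
  rw [hval, Sym2.eq_iff]
  constructor
  · rintro (⟨h, _⟩ | ⟨h, _⟩)
    · exact Or.inl h
    · exact Or.inr h
  · rintro (rfl | rfl)
    · exact Or.inl ⟨rfl, rfl⟩
    · exact Or.inr ⟨rfl, Γ.glue_glue _⟩

lemma link_glue (l : V × Fin 3) : Γ.link (Γ.glue l) = Γ.link l :=
  Γ.link_eq_iff.2 (Or.inr rfl)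

lemma exists_link (e : Γ.Link) : ∃ l, e = Γ.link l := by
  obtain ⟨_, l, rfl⟩ := e
  exact ⟨l, rfl⟩

/-- The open link of a leg that is not glued. -/
def openLeg (l : V × Fin 3) (h : Γ.glue l = l) : Γ.OpenLeg := ⟨l, h⟩

lemma farEnd_of_open {l : V × Fin 3} (h : Γ.glue l = l) :
    Γ.farEnd l = Sum.inr (Γ.openLeg l h) :=
  dif_pos h

lemma farEnd_of_ne {l : V × Fin 3} (h : Γ.glue l ≠ l) : Γ.farEnd l = Sum.inl (Γ.glue l).1 :=
  dif_neg h

lemma glue_glue_ne {l : V × Fin 3} (h : Γ.glue l ≠ l) : Γ.glue (Γ.glue l) ≠ Γ.glue l := by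
  rw [Γ.glue_glue]; exact h.symm

lemma farEnd_glue {l : V × Fin 3} (h : Γ.glue l ≠ l) : Γ.farEnd (Γ.glue l) = Sum.inl l.1 := by
  rw [Γ.farEnd_of_ne (Γ.glue_glue_ne h), Γ.glue_glue]

/-- The set of nodes that consists of the vertices in `X` and the boundary nodes in `R`. -/
def region (X : Set V) (R : Set Γ.OpenLeg) : Set Γ.Node := Sum.elim X R

@[simp] lemma inl_mem_region {X : Set V} {R : Set Γ.OpenLeg} {x : V} :
    (Sum.inl x : Γ.Node) ∈ Γ.region X R ↔ x ∈ X := Iff.rfl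

@[simp] lemma inr_mem_region {X : Set V} {R : Set Γ.OpenLeg} {w : Γ.OpenLeg} :
    (Sum.inr w : Γ.Node) ∈ Γ.region X R ↔ w ∈ R := Iff.rfl

/-- The links between `Γ.region X R` and its complement. -/
def cut (X : Set V) (R : Set Γ.OpenLeg) : Set Γ.Link :=
  {e | ∃ l, e = Γ.link l ∧ ¬ (l.1 ∈ X ↔ Γ.farEnd l ∈ Γ.region X R)}

/-- The defining condition is symmetric in the two ends of a glued link, so it can be tested on
either leg. -/
lemma link_mem_cut {X : Set V} {R : Set Γ.OpenLeg} {l : V × Fin 3} :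
    Γ.link l ∈ Γ.cut X R ↔ ¬ (l.1 ∈ X ↔ Γ.farEnd l ∈ Γ.region X R) := by
  constructor
  · rintro ⟨l', h, hl'⟩
    rcases Γ.link_eq_iff.1 h with rfl | rfl
    · exact hl'
    · by_cases ho : Γ.glue l' = l'
      · rwa [ho]
      · rw [Γ.farEnd_glue ho]
        rw [Γ.farEnd_of_ne ho] at hl'
        simp only [inl_mem_region] at *
        tauto
  · exact fun h => ⟨l, rfl, h⟩

lemma exists_leg_of_mem_cut {S : Set V} {e : Γ.Link} (he : e ∈ Γ.cut S ∅) :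
    ∃ l, e = Γ.link l ∧ l.1 ∈ S ∧ Γ.farEnd l ∉ Γ.region S ∅ := by
  obtain ⟨l, rfl⟩ := Γ.exists_link e
  rw [link_mem_cut] at he
  by_cases hl : l.1 ∈ S
  · exact ⟨l, rfl, hl, by tauto⟩
  · by_cases ho : Γ.glue l = l
    · rw [Γ.farEnd_of_open ho] at he
      simp [hl] at he
    · refine ⟨Γ.glue l, (Γ.link_glue l).symm, ?_, ?_⟩
      · rw [Γ.farEnd_of_ne ho] at he
        simp only [inl_mem_region] at he
        tauto
      · rw [Γ.farEnd_glue ho]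
        exact hl

/-- The coboundary of a node set is additive modulo two. Flipping the vertices of `S` to the other
side thus changes a cut by the links that leave `S`. -/
lemma cut_symmDiff (X S : Set V) (R : Set Γ.OpenLeg) :
    Γ.cut (symmDiff X S) R = symmDiff (Γ.cut X R) (Γ.cut S ∅) := by
  ext e
  obtain ⟨l, rfl⟩ := Γ.exists_link e
  rw [Set.mem_symmDiff, link_mem_cut, link_mem_cut, link_mem_cut, Set.mem_symmDiff]
  by_cases ho : Γ.glue l = l
  · rw [Γ.farEnd_of_open ho]
    simp only [inr_mem_region, Set.mem_empty_iff_false]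
    tauto
  · rw [Γ.farEnd_of_ne ho]
    simp only [inl_mem_region, Set.mem_symmDiff]
    tauto

lemma mem_iff_of_reachable {σ : Set Γ.Link} {T : Set Γ.Node}
    (hT : ∀ l, Γ.link l ∉ σ → (Sum.inl l.1 ∈ T ↔ Γ.farEnd l ∈ T)) {x y : Γ.Node}
    (h : (Γ.graphOff σ).Reachable x y) : x ∈ T ↔ y ∈ T := by
  obtain ⟨w⟩ := h
  induction w with
  | nil => rfl
  | cons hadj _ ih =>
    rw [← ih]
    rw [graphOff, SimpleGraph.fromRel_adj] at hadj
    obtain ⟨_, ⟨e, he, l, rfl, h⟩ | ⟨e, he, l, rfl, h⟩⟩ := hadj <;>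
    rcases h with ⟨rfl, rfl⟩ | ⟨rfl, rfl⟩ <;> [exact hT l he; exact (hT l he).symm;
      exact (hT l he).symm; exact hT l he]

lemma reachable_farEnd {σ : Set Γ.Link} {l : V × Fin 3} (hl : Γ.link l ∉ σ) :
    (Γ.graphOff σ).Reachable (Sum.inl l.1) (Γ.farEnd l) := by
  by_cases h : (Sum.inl l.1 : Γ.Node) = Γ.farEnd l
  · rw [← h]
  · refine SimpleGraph.Adj.reachable ?_
    rw [graphOff, SimpleGraph.fromRel_adj]
    exact ⟨h, Or.inl ⟨_, hl, l, rfl, Or.inl ⟨rfl, rfl⟩⟩⟩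

lemma separates_cut (X : Set V) (R : Set Γ.OpenLeg) : Γ.Separates R (Γ.cut X R) := by
  intro a ha b hb h
  have := Γ.mem_iff_of_reachable (T := Γ.region X R)
    (fun l hl => not_not.1 (fun h' => hl (Γ.link_mem_cut.2 h'))) h
  exact hb (this.1 ha)

/-- The vertices that are connected to `R` after omission of `τ`. -/
def wallSide (R : Set Γ.OpenLeg) (τ : Set Γ.Link) : Set V :=
  {x | ∃ a ∈ R, (Γ.graphOff τ).Reachable (Sum.inl x) (Sum.inr a)}

variable {Γ} {R : Set Γ.OpenLeg} {τ : Set Γ.Link}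

/-- The ends of a link outside of `τ` are both connected to `R` or both not. Separation ensures that
`R` contains all boundary nodes that are connected to it. -/
lemma Separates.cut_subset (h : Γ.Separates R τ) : Γ.cut (Γ.wallSide R τ) R ⊆ τ := by
  intro e he
  obtain ⟨l, rfl⟩ := Γ.exists_link e
  by_contra hl
  rw [link_mem_cut] at he
  apply he
  have hnode : ∀ n : Γ.Node, n ∈ Γ.region (Γ.wallSide R τ) R ↔
      ∃ a ∈ R, (Γ.graphOff τ).Reachable n (Sum.inr a) := by
    rintro (x | w)
    · rfl
    · rw [inr_mem_region]
      refine ⟨fun hw => ⟨w, hw, SimpleGraph.Reachable.refl _⟩, ?_⟩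
      rintro ⟨a, ha, hr⟩
      by_contra hw
      exact h a ha w hw hr.symm
  have hr := Γ.reachable_farEnd hl
  rw [hnode]
  exact ⟨fun ⟨a, ha, h'⟩ => ⟨a, ha, hr.symm.trans h'⟩, fun ⟨a, ha, h'⟩ => ⟨a, ha, hr.trans h'⟩⟩

lemma IsMinCut.cut_eq [Finite V] (h : Γ.IsMinCut R τ) : Γ.cut (Γ.wallSide R τ) R = τ :=
  Set.eq_of_subset_of_ncard_le h.1.cut_subset (h.2 _ (Γ.separates_cut _ _)) (Set.toFinite _)

/-- A set of vertices with at most one leaving link is a region of a coarse-graining to a tree. -/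
lemma exists_leaving_link [Finite V] (hbdry : Nonempty Γ.OpenLeg) (htree : ¬ Γ.CoarseGrainable)
    {S : Set V} (hS : S.Nonempty) (e : Γ.Link) : ∃ e' ∈ Γ.cut S ∅, e' ≠ e := by
  by_contra hcon
  push Not at hcon
  apply htree
  -- The partition has two regions, `S` and everything else, with at most the one link `e` between
  -- them.
  let φ : Γ.Node → Prop := fun n => n ∈ Γ.region S ∅
  let P : Setoid Γ.Node := Setoid.ker φ
  have hmk : ∀ x y : Γ.Node, (Quotient.mk P x = Quotient.mk P y) ↔ φ x = φ y := fun x y =>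
    Quotient.eq (r := P)
  refine ⟨P, fun w w' => (hmk _ _).2 ?_, ?_, ?_, ?_⟩
  · simp [φ]
  · intro m
    obtain ⟨x, hx⟩ := hS
    obtain ⟨w⟩ := hbdry
    by_cases hm : Quotient.mk P (Sum.inr w) = m
    · refine ⟨Sum.inl x, fun h => ?_⟩
      have := (hmk _ _).1 (h.trans hm.symm)
      simp [φ, hx] at this
    · exact ⟨_, hm⟩
  · intro m m' hne
    refine (Set.ncard_le_ncard (t := {e}) ?_ (Set.toFinite _)).trans (by simp)
    rintro e' ⟨x, y, ⟨l, rfl, hj⟩, rfl, rfl⟩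
    refine hcon _ (Γ.link_mem_cut.2 fun hiff => hne ((hmk _ _).2 (propext ?_)))
    rcases hj with ⟨rfl, rfl⟩ | ⟨rfl, rfl⟩
    · exact hiff
    · exact hiff.symm
  -- A cycle visits three distinct regions, but there are at most two.
  · have hcard : ∀ a b c : Quotient P, a = b ∨ b = c ∨ a = c := by
      rintro ⟨a⟩ ⟨b⟩ ⟨c⟩
      have h3 : φ a = φ b ∨ φ b = φ c ∨ φ a = φ c := by
        by_cases ha : φ a <;> by_cases hb : φ b <;> by_cases hc : φ c <;> simp [ha, hb, hc]
      exact h3.imp (hmk _ _).2 (Or.imp (hmk _ _).2 (hmk _ _).2)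
    intro v c hc
    have hlen := hc.three_le_length
    have hnd := hc.support_nodup
    have hl : c.support.tail.length = c.length := by simp
    generalize c.support.tail = t at hnd hl
    match t, hl with
    | [], hl => simp at hl; omega
    | [_], hl => simp at hl; omega
    | [_, _], hl => simp at hl; omega
    | a :: b :: d :: _, _ =>
      simp only [List.nodup_cons, List.mem_cons, not_or] at hnd
      rcases hcard a b d with h | h | h
      · exact hnd.1.1 h
      · exact hnd.2.1.1 h
      · exact hnd.1.2.1 h

/-- If the minimal cut is unique, every set of vertices has two leaving links outside of it. -/
lemma exists_leaving_link_notMem [Finite V] (hbdry : Nonempty Γ.OpenLeg)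
    (htree : ¬ Γ.CoarseGrainable) (hτ : Γ.IsMinCut R τ)
    (huniq : ∀ τ', Γ.IsMinCut R τ' → τ' = τ) {S : Set V} (hS : S.Nonempty) (e : Γ.Link) :
    ∃ l, l.1 ∈ S ∧ Γ.farEnd l ∉ Γ.region S ∅ ∧ Γ.link l ∉ τ ∧ Γ.link l ≠ e := by
  by_contra hcon
  push Not at hcon
  have hsub : Γ.cut S ∅ \ τ ⊆ {e} := by
    rintro e' ⟨he', hn⟩
    obtain ⟨l, rfl, h1, h2⟩ := Γ.exists_leg_of_mem_cut he'
    exact hcon l h1 h2 hn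
  by_cases hinter : (τ ∩ Γ.cut S ∅).Nonempty
  -- Flipping `S` trades at least one link of `τ` for at most one new link. This gives another
  -- minimal cut, against uniqueness.
  · have hsep : Γ.Separates R (symmDiff τ (Γ.cut S ∅)) := by
      have := Γ.separates_cut (symmDiff (Γ.wallSide R τ) S) R
      rwa [cut_symmDiff, hτ.cut_eq] at this
    have hle : (symmDiff τ (Γ.cut S ∅)).ncard ≤ τ.ncard := by
      have h1 : (symmDiff τ (Γ.cut S ∅)).ncard ≤
          (τ \ Γ.cut S ∅).ncard + (Γ.cut S ∅ \ τ).ncard := by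
        rw [Set.symmDiff_def]; exact Set.ncard_union_le _ _
      have h2 : (Γ.cut S ∅ \ τ).ncard ≤ 1 :=
        (Set.ncard_le_ncard hsub (Set.toFinite _)).trans (by simp)
      have h3 : 0 < (τ ∩ Γ.cut S ∅).ncard := (Set.ncard_pos (Set.toFinite _)).2 hinter
      have h4 := Set.ncard_inter_add_ncard_sdiff_eq_ncard τ (Γ.cut S ∅) (Set.toFinite _)
      omega
    have := huniq _ ⟨hsep, fun τ' h' => hle.trans (hτ.2 τ' h')⟩
    obtain ⟨e', he', he''⟩ := hinter
    rw [← this, Set.mem_symmDiff] at he'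
    have h5 : e' ∈ τ := by
      by_contra h; rcases he' with h' | h'
      · exact h h'.1
      · rw [← this] at h
        exact h (Set.mem_symmDiff.2 (Or.inr h'))
    tauto
  -- No link of `τ` leaves `S` here, so the absence of a coarse-graining to a tree suffices.
  · obtain ⟨e', he', hne⟩ := exists_leaving_link hbdry htree hS e
    have hnot : e' ∉ τ := fun h => hinter ⟨e', h, he'⟩
    exact hne (hsub ⟨he', hnot⟩)

/-- A network that is not coarse-grainable has no self-loops. -/
lemma glue_fst_ne [Finite V] (hbdry : Nonempty Γ.OpenLeg) (htree : ¬ Γ.CoarseGrainable)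
    {l : V × Fin 3} (hl : Γ.glue l ≠ l) : (Γ.glue l).1 ≠ l.1 := by
  intro heq
  obtain ⟨x, a⟩ := l
  obtain ⟨b, hb⟩ : ∃ b, Γ.glue (x, a) = (x, b) := ⟨(Γ.glue (x, a)).2, Prod.ext heq rfl⟩
  have hab : a ≠ b := fun h => hl (by rw [hb, h])
  -- A self-loop uses up two legs, and only the link of the third leg could leave the vertex.
  have hthird : ∀ a b : Fin 3, a ≠ b → ∃ c : Fin 3, ∀ d, d = a ∨ d = b ∨ d = c := by decide
  obtain ⟨c, hc⟩ := hthird a b hab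
  obtain ⟨e', he', hne⟩ := exists_leaving_link hbdry htree (Set.singleton_nonempty x)
    (Γ.link (x, c))
  obtain ⟨⟨y, d⟩, rfl, h1, h2⟩ := Γ.exists_leg_of_mem_cut he'
  obtain rfl : y = x := h1
  have hb' : Γ.glue (y, b) = (y, a) := by rw [← hb, Γ.glue_glue]
  rcases hc d with rfl | rfl | rfl
  · rw [Γ.farEnd_of_ne (by rw [hb]; simpa using hab.symm), hb] at h2
    simp at h2
  · rw [Γ.farEnd_of_ne (by rw [hb']; simpa using hab), hb'] at h2
    simp at h2
  · exact hne rfl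

end Network

/-! ### Flows and disjoint paths -/

/-- A depth function for a relation with respect to a set of base points. -/
lemma exists_depth {α : Type*} (r : α → α → Prop) (B : Set α) :
    ∃ d : α → ℕ, ∀ x, x ∉ B → (∃ b ∈ B, Relation.ReflTransGen r x b) →
      ∃ y, r x y ∧ d y < d x ∧ ∃ b ∈ B, Relation.ReflTransGen r y b := by
  -- `T n` holds the points that reach `B` in exactly `n` steps. The depth is the least such `n`;
  -- the default `0` at points that do not reach `B` plays no role.
  let T : ℕ → Set α := fun n => Nat.rec B (fun _ T => {x | ∃ y ∈ T, r x y}) n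
  have hT : ∀ x, (∃ b ∈ B, Relation.ReflTransGen r x b) ↔ ∃ n, x ∈ T n := by
    intro x
    constructor
    · rintro ⟨b, hb, h⟩
      induction h using Relation.ReflTransGen.head_induction_on with
      | refl => exact ⟨0, hb⟩
      | head h' _ ih =>
        obtain ⟨n, hn⟩ := ih
        exact ⟨n + 1, _, hn, h'⟩
    · rintro ⟨n, hn⟩
      induction n generalizing x with
      | zero => exact ⟨x, hn, Relation.ReflTransGen.refl⟩
      | succ n ih =>
        obtain ⟨y, hy, hxy⟩ := hn
        obtain ⟨b, hb, h⟩ := ih y hy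
        exact ⟨b, hb, h.head hxy⟩
  refine ⟨fun x => sInf {n | x ∈ T n}, fun x hx hreach => ?_⟩
  have hne : {n | x ∈ T n}.Nonempty := (hT x).1 hreach
  have hmem : x ∈ T (sInf {n | x ∈ T n}) := Nat.sInf_mem hne
  beta_reduce
  generalize sInf {n | x ∈ T n} = m at hmem ⊢
  cases m with
  | zero => exact absurd hmem hx
  | succ m =>
    obtain ⟨y, hy, hxy⟩ := hmem
    exact ⟨y, hxy, Nat.lt_succ_of_le (Nat.sInf_le hy), (hT y).2 ⟨m, hy⟩⟩

/-! ### Unit-capacity flows, their conservation and augmentation -/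

namespace Network

variable {V : Type*} (Γ : Network V)

/-- The legs of the open links in `R`. -/
def openIn (R : Set Γ.OpenLeg) : Set (V × Fin 3) := {l | ∃ h : Γ.glue l = l, Γ.openLeg l h ∈ R}

variable {Γ} {R : Set Γ.OpenLeg}

lemma glue_eq_of_openIn {l : V × Fin 3} (h : l ∈ Γ.openIn R) : Γ.glue l = l := h.1

lemma openIn_compl {l : V × Fin 3} : l ∈ Γ.openIn Rᶜ ↔ Γ.glue l = l ∧ l ∉ Γ.openIn R :=
  ⟨fun ⟨h, h'⟩ => ⟨h, fun ⟨_, h''⟩ => h' h''⟩, fun ⟨h, h'⟩ => ⟨h, fun h'' => h' ⟨h, h''⟩⟩⟩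

variable (Γ R) in
/-- A unit-capacity flow that avoids the link `e₀`, enters through `R` and leaves through the other
open links, without the conservation law. `f l` is the flow out of the vertex `l.1`. -/
structure PreFlow (e₀ : Γ.Link) (f : V × Fin 3 → ℤ) : Prop where
  neg_one_le : ∀ l, -1 ≤ f l
  le_one : ∀ l, f l ≤ 1
  anti : ∀ l, Γ.glue l ≠ l → f (Γ.glue l) = - f l
  source : ∀ l ∈ Γ.openIn R, f l ≤ 0
  sink : ∀ l ∈ Γ.openIn Rᶜ, 0 ≤ f l
  avoid : ∀ l, Γ.link l = e₀ → f l = 0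

section Sums

variable [Fintype V] {f : V × Fin 3 → ℤ}

lemma sum_glued_eq_zero (hf : ∀ l, Γ.glue l ≠ l → f (Γ.glue l) = - f l)
    {C : Set (V × Fin 3)} (hC : ∀ l ∈ C, Γ.glue l ∈ C) :
    ∑ l, (if l ∈ C ∧ Γ.glue l ≠ l then f l else 0) = 0 := by
  refine Finset.sum_involution (fun l _ => Γ.glue l) ?_ ?_ (fun _ _ => Finset.mem_univ _)
    (fun l _ => Γ.glue_glue l)
  · intro l _
    by_cases h : l ∈ C ∧ Γ.glue l ≠ l
    · rw [if_pos h, if_pos ⟨hC l h.1, Γ.glue_glue_ne h.2⟩, hf l h.2]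
      ring
    · rw [if_neg h, if_neg, zero_add]
      rintro ⟨h1, h2⟩
      refine h ⟨?_, fun h3 => h2 (by rw [h3, h3])⟩
      have := hC _ h1
      rwa [Γ.glue_glue] at this
  · intro l _ h h'
    simp [h'] at h

lemma sum_vertices_eq_zero (hf : ∀ x, ∑ a, f (x, a) = 0) {C : Set (V × Fin 3)}
    (hC : ∀ l ∈ C, ∀ l', f l' ≠ 0 → l'.1 = l.1 → l' ∈ C) :
    ∑ l, (if l ∈ C then f l else 0) = 0 := by
  rw [Fintype.sum_prod_type]
  refine Finset.sum_eq_zero fun x _ => ?_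
  by_cases h : ∃ a, (x, a) ∈ C
  · obtain ⟨a, ha⟩ := h
    refine (Finset.sum_congr rfl fun b _ => ?_).trans (hf x)
    by_cases hb : f (x, b) = 0
    · simp [hb]
    · rw [if_pos (hC _ ha (x, b) hb rfl)]
  · push Not at h
    simp [h]

/-- Summed over a union of components of the support, the flow vanishes vertex by vertex, and its
glued part cancels in pairs. The part through the open legs must then vanish as well. -/
lemma sum_open_eq_zero (hf : ∀ l, Γ.glue l ≠ l → f (Γ.glue l) = - f l)
    (hf' : ∀ x, ∑ a, f (x, a) = 0) {C : Set (V × Fin 3)} (hC : ∀ l ∈ C, Γ.glue l ∈ C)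
    (hC' : ∀ l ∈ C, ∀ l', f l' ≠ 0 → l'.1 = l.1 → l' ∈ C) :
    ∑ l, (if l ∈ C ∧ l ∈ Γ.openIn R then f l else 0) +
      ∑ l, (if l ∈ C ∧ l ∈ Γ.openIn Rᶜ then f l else 0) = 0 := by
  have h1 := sum_glued_eq_zero hf hC
  have h2 := sum_vertices_eq_zero hf' hC'
  suffices h3 : ∑ l, (if l ∈ C ∧ l ∈ Γ.openIn R then f l else 0) +
      ∑ l, (if l ∈ C ∧ l ∈ Γ.openIn Rᶜ then f l else 0) = ∑ l, (if l ∈ C then f l else 0) -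
      ∑ l, (if l ∈ C ∧ Γ.glue l ≠ l then f l else 0) by rw [h3, h1, h2, sub_zero]
  rw [← Finset.sum_sub_distrib, ← Finset.sum_add_distrib]
  refine Finset.sum_congr rfl fun l _ => ?_
  rw [openIn_compl]
  by_cases hl : l ∈ C <;> by_cases ho : Γ.glue l = l <;> by_cases hR : l ∈ Γ.openIn R <;>
    simp [hl, ho, hR]
  exact absurd (glue_eq_of_openIn hR) ho

end Sums

lemma sum_fin_ite_eq (z : V) (l : V × Fin 3) :
    ∑ a : Fin 3, (if (z, a) = l then (1 : ℤ) else 0) = if z = l.1 then 1 else 0 := by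
  obtain ⟨x, b⟩ := l
  by_cases h : z = x
  · subst h; simp
  · simp [h]

/-- Pushing a unit of excess along the levels of the residual graph to a sink. -/
lemma PreFlow.exists_push {e₀ : Γ.Link} {f : V × Fin 3 → ℤ} {d : V → ℕ} {B Y : Set V}
    (hB : ∀ x ∈ B, ∃ a, (x, a) ∈ Γ.openIn Rᶜ ∧ Γ.link (x, a) ≠ e₀ ∧ f (x, a) ≤ 0)
    (hY : ∀ x ∈ Y, x ∉ B → ∃ a, Γ.link (x, a) ≠ e₀ ∧ Γ.glue (x, a) ≠ (x, a) ∧ f (x, a) ≤ 0 ∧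
      (Γ.glue (x, a)).1 ∈ Y ∧ d (Γ.glue (x, a)).1 < d x) (n : ℕ) :
    ∀ x ∈ Y, d x = n → ∀ f', Γ.PreFlow R e₀ f' →
      (∀ z, ∑ a, f' (z, a) = if z = x then -1 else 0) →
      (∀ l ∈ Γ.openIn Rᶜ, f' l = f l) →
      (∀ l, Γ.glue l ≠ l → d l.1 ≤ n → d (Γ.glue l).1 < n → f' l = f l) →
      ∃ g, Γ.PreFlow R e₀ g ∧ (∀ z, ∑ a, g (z, a) = 0) ∧ ∀ l ∈ Γ.openIn R, g l = f' l := by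
  -- The unit only moves to lower levels, so on the links that it can still use `f'` agrees with
  -- `f`, and the residual capacities in `hB` and `hY` are still available.
  induction n using Nat.strong_induction_on with
  | _ n ih =>
    intro x hxY hdx f' hf' hdiv hout hlev
    by_cases hxB : x ∈ B
    · obtain ⟨a, ha, hae, hfa⟩ := hB x hxB
      have hval : f' (x, a) ≤ 0 := by rw [hout _ ha]; exact hfa
      refine ⟨fun l => f' l + if l = (x, a) then 1 else 0, ⟨?_, ?_, ?_, ?_, ?_, ?_⟩, ?_, ?_⟩
      · intro l
        have := hf'.neg_one_le l
        split_ifs <;> omega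
      · intro l
        have := hf'.le_one l
        split_ifs with h
        · subst h; omega
        · omega
      · intro l hl
        have h1 : l ≠ (x, a) := by rintro rfl; exact hl (glue_eq_of_openIn ha)
        have h2 : Γ.glue l ≠ (x, a) := by
          intro h
          apply Γ.glue_glue_ne hl
          rw [h, (glue_eq_of_openIn ha)]
        simp [h1, h2, hf'.anti l hl]
      · intro l hl
        have h1 : l ≠ (x, a) := by rintro rfl; exact (openIn_compl.1 ha).2 hl
        simpa [h1] using hf'.source l hl
      · intro l hl
        have := hf'.sink l hl
        split_ifs <;> omega
      · intro l hl
        have h1 : l ≠ (x, a) := by rintro rfl; exact hae hl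
        simpa [h1] using hf'.avoid l hl
      · intro z
        rw [Finset.sum_add_distrib, hdiv, sum_fin_ite_eq]
        split_ifs <;> simp
      · intro l hl
        have h1 : l ≠ (x, a) := by rintro rfl; exact (openIn_compl.1 ha).2 hl
        simp [h1]
    · obtain ⟨a, hae, hao, hfa, hyY, hdy⟩ := hY x hxY hxB
      have hd : d (Γ.glue (x, a)).1 < n := hdx ▸ hdy
      have hval : f' (x, a) ≤ 0 := by rw [hlev (x, a) hao hdx.le hd]; exact hfa
      set l₀ : V × Fin 3 := (x, a)
      have hneg : f' (Γ.glue l₀) = - f' l₀ := hf'.anti l₀ hao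
      have hopen : ∀ l, Γ.glue l = l → l ≠ l₀ ∧ l ≠ Γ.glue l₀ := by
        refine fun l hl => ⟨?_, ?_⟩
        · rintro rfl; exact hao hl
        · rintro rfl; exact Γ.glue_glue_ne hao hl
      have hfst : l₀.1 = x := rfl
      have hxy : (Γ.glue l₀).1 ≠ x := fun h => by rw [h] at hdy; omega
      -- One more unit leaves `x` through `l₀`, which shifts the excess to the vertex at the other
      -- end.
      have key := ih (d (Γ.glue l₀).1) hd (Γ.glue l₀).1 hyY rfl
        (fun l => f' l + ((if l = l₀ then 1 else 0) - if l = Γ.glue l₀ then 1 else 0))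
        ⟨?_, ?_, ?_, ?_, ?_, ?_⟩ ?_ ?_ ?_
      · obtain ⟨g, hg, hg', hg''⟩ := key
        refine ⟨g, hg, hg', fun l hl => ?_⟩
        rw [hg'' l hl]
        simp [hopen l (glue_eq_of_openIn hl)]
      · intro l
        have h1 := hf'.neg_one_le l
        have h2 := hf'.neg_one_le l₀
        split_ifs with h3 h4 h4
        · omega
        · omega
        · subst h4; omega
        · omega
      · intro l
        have h1 := hf'.le_one l
        split_ifs with h3 h4 h4
        · omega
        · subst h3; omega
        · omega
        · omega
      · intro l hl
        have e1 : (Γ.glue l = l₀) ↔ l = Γ.glue l₀ :=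
          ⟨fun h => by rw [← h, Γ.glue_glue], fun h => by rw [h, Γ.glue_glue]⟩
        have e2 : (Γ.glue l = Γ.glue l₀) ↔ l = l₀ :=
          ⟨fun h => by rw [← Γ.glue_glue l, h, Γ.glue_glue], fun h => by rw [h]⟩
        simp only [e1, e2, hf'.anti l hl]
        ring
      · intro l hl
        simpa [hopen l (glue_eq_of_openIn hl)] using hf'.source l hl
      · intro l hl
        simpa [hopen l (glue_eq_of_openIn hl)] using hf'.sink l hl
      · intro l hl
        have h1 : l ≠ l₀ := by rintro rfl; exact hae hl
        have h2 : l ≠ Γ.glue l₀ := by rintro rfl; exact hae (by rw [← hl, Γ.link_glue])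
        simpa [h1, h2] using hf'.avoid l hl
      · intro z
        rw [Finset.sum_add_distrib, Finset.sum_sub_distrib, hdiv, sum_fin_ite_eq, sum_fin_ite_eq,
          hfst]
        by_cases h1 : z = x
        · rw [if_pos h1, if_pos h1, if_neg (h1 ▸ hxy.symm), if_neg (h1 ▸ hxy.symm)]
          rfl
        · rw [if_neg h1, if_neg h1]
          split_ifs <;> rfl
      · intro l hl
        simpa [hopen l (glue_eq_of_openIn hl)] using hout l hl
      · intro l hl h1 h2
        have h3 : l ≠ l₀ := by rintro rfl; rw [hfst] at h1; omega
        have h4 : l ≠ Γ.glue l₀ := by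
          rintro rfl
          rw [Γ.glue_glue, hfst] at h2
          omega
        simp only [h3, h4, if_false, sub_zero, add_zero]
        exact hlev l hl (by omega) (by omega)

end Network

/-! ### Max-flow min-cut, disjoint paths and the forest -/

namespace Network

variable {V : Type*} {Γ : Network V} {R : Set Γ.OpenLeg}

lemma PreFlow.sum_openIn [Fintype V] {e₀ : Γ.Link} {f : V × Fin 3 → ℤ} (hf : Γ.PreFlow R e₀ f)
    (hdiv : ∀ x, ∑ a, f (x, a) = 0) :
    ∑ l, (if l ∈ Γ.openIn R then f l else 0) + ∑ l, (if l ∈ Γ.openIn Rᶜ then f l else 0) = 0 := by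
  have := sum_open_eq_zero (R := R) hf.anti hdiv (C := Set.univ) (fun _ _ => Set.mem_univ _)
    (fun _ _ _ _ _ => Set.mem_univ _)
  simpa only [Set.mem_univ, true_and] using this

/-- The augmentation step of the max-flow min-cut theorem. -/
lemma PreFlow.exists_augment [Fintype V] {e₀ : Γ.Link} {n : ℕ}
    (hk : ∀ X : Set V, n < (Γ.cut X R \ {e₀}).ncard) {f : V × Fin 3 → ℤ}
    (hf : Γ.PreFlow R e₀ f) (hdiv : ∀ x, ∑ a, f (x, a) = 0)
    (hval : ∑ l, (if l ∈ Γ.openIn Rᶜ then f l else 0) = n) :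
    ∃ g, Γ.PreFlow R e₀ g ∧ (∀ x, ∑ a, g (x, a) = 0) ∧
      ∑ l, (if l ∈ Γ.openIn Rᶜ then g l else 0) = (n + 1 : ℕ) := by
  -- The residual graph: an outward flow that is not positive can be raised by one unit. `B`
  -- contains the vertices with an unsaturated exit, `Y` those from which such an exit can be
  -- reached.
  let r : V → V → Prop := fun x y => ∃ a, Γ.link (x, a) ≠ e₀ ∧ Γ.glue (x, a) ≠ (x, a) ∧
    f (x, a) ≤ 0 ∧ (Γ.glue (x, a)).1 = y
  let B : Set V := {x | ∃ a, (x, a) ∈ Γ.openIn Rᶜ ∧ Γ.link (x, a) ≠ e₀ ∧ f (x, a) ≤ 0}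
  obtain ⟨Y, hYdef⟩ : ∃ Y : Set V, ∀ x, x ∈ Y ↔ ∃ b ∈ B, Relation.ReflTransGen r x b :=
    ⟨{x | ∃ b ∈ B, Relation.ReflTransGen r x b}, fun _ => Iff.rfl⟩
  obtain ⟨d, hd⟩ := exists_depth r B
  by_cases hsrc : ∃ l ∈ Γ.openIn R, Γ.link l ≠ e₀ ∧ f l = 0 ∧ l.1 ∈ Y
  · obtain ⟨l, hl, hle, hl0, hlY⟩ := hsrc
    obtain ⟨g, hg, hgdiv, hgR⟩ := PreFlow.exists_push (R := R) (e₀ := e₀) (f := f) (d := d)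
      (B := B) (Y := Y) (fun x hx => hx) (by
        intro x hx hxB
        obtain ⟨y, ⟨a, h1, h2, h3, rfl⟩, hdy, hy⟩ := hd x hxB ((hYdef x).1 hx)
        exact ⟨a, h1, h2, h3, (hYdef _).2 hy, hdy⟩) (d l.1) l.1 hlY rfl
      (fun l' => f l' - if l' = l then 1 else 0) (by
        have hopen : ∀ l', Γ.glue l' ≠ l' → l' ≠ l ∧ Γ.glue l' ≠ l := by
          refine fun l' h => ⟨?_, ?_⟩
          · rintro rfl; exact h (glue_eq_of_openIn hl)
          · intro h'
            apply Γ.glue_glue_ne h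
            rw [h', glue_eq_of_openIn hl]
        refine ⟨?_, ?_, ?_, ?_, ?_, ?_⟩
        · intro l'
          have := hf.neg_one_le l'
          split_ifs with h
          · rw [h, hl0]; norm_num
          · omega
        · intro l'
          have := hf.le_one l'
          split_ifs <;> omega
        · intro l' h
          simp [hopen l' h, hf.anti l' h]
        · intro l' h
          have := hf.source l' h
          split_ifs <;> omega
        · intro l' h
          have h1 : l' ≠ l := by rintro rfl; exact (openIn_compl.1 h).2 hl
          simpa [h1] using hf.sink l' h
        · intro l' h
          have h1 : l' ≠ l := by rintro rfl; exact hle h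
          simpa [h1] using hf.avoid l' h) (by
        intro z
        rw [Finset.sum_sub_distrib, hdiv, sum_fin_ite_eq]
        split_ifs <;> rfl) (by
        intro l' h
        have h1 : l' ≠ l := by rintro rfl; exact (openIn_compl.1 h).2 hl
        simp [h1]) (by
        intro l' h _ _
        have h1 : l' ≠ l := by rintro rfl; exact h (glue_eq_of_openIn hl)
        simp [h1])
    refine ⟨g, hg, hgdiv, ?_⟩
    have h1 := hf.sum_openIn hdiv
    have h2 := hg.sum_openIn hgdiv
    have h3 : ∑ l', (if l' ∈ Γ.openIn R then g l' else 0) =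
        ∑ l', (if l' ∈ Γ.openIn R then f l' else 0) - 1 := by
      have : ∀ l', (if l' ∈ Γ.openIn R then g l' else 0) =
          (if l' ∈ Γ.openIn R then f l' else 0) - if l' = l then 1 else 0 := by
        intro l'
        by_cases h : l' ∈ Γ.openIn R
        · simp [h, hgR l' h]
        · have : l' ≠ l := by rintro rfl; exact h hl
          simp [h, this]
      rw [Finset.sum_congr rfl fun l' _ => this l', Finset.sum_sub_distrib]
      simp
    push_cast
    linarith
  -- Without an augmenting path, every available link from the side of `R` to the side of `Y` is
  -- saturated. The cut of `Yᶜ` then has at most `n` links besides `e₀`.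
  · exfalso
    push Not at hsrc
    have hcross : ∀ l, Γ.glue l ≠ l → Γ.link l ≠ e₀ → l.1 ∈ Y → (Γ.glue l).1 ∉ Y → f l = -1 := by
      intro l h1 h2 h3 h4
      have h5 : ¬ f (Γ.glue l) ≤ 0 := by
        intro h
        obtain ⟨b, hb, hr⟩ := (hYdef _).1 h3
        refine h4 ((hYdef _).2 ⟨b, hb, hr.head ⟨(Γ.glue l).2, ?_, ?_, h, ?_⟩⟩)
        · rwa [Prod.mk.eta, Γ.link_glue]
        · exact Γ.glue_glue_ne h1
        · rw [Prod.mk.eta, Γ.glue_glue]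
      have h6 := hf.anti l h1
      have h7 := hf.neg_one_le l
      omega
    have hin : ∀ l ∈ Γ.openIn R, Γ.link l ≠ e₀ → l.1 ∈ Y → f l = -1 := by
      intro l h1 h2 h3
      have h4 := hf.source l h1
      have h5 := hf.neg_one_le l
      have h6 : f l ≠ 0 := fun h => hsrc l h1 h2 h h3
      omega
    have hout : ∀ l ∈ Γ.openIn Rᶜ, Γ.link l ≠ e₀ → l.1 ∉ Y → f l = 1 := by
      intro l h1 h2 h3
      have h4 : ¬ f l ≤ 0 := fun h =>
        h3 ((hYdef _).2 ⟨l.1, ⟨l.2, h1, h2, h⟩, Relation.ReflTransGen.refl⟩)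
      have h5 := hf.le_one l
      omega
    let Q : Finset (V × Fin 3) := Finset.univ.filter fun l => Γ.link l ≠ e₀ ∧
      ((Γ.glue l ≠ l ∧ l.1 ∈ Y ∧ (Γ.glue l).1 ∉ Y) ∨ (l ∈ Γ.openIn R ∧ l.1 ∈ Y) ∨
        (l ∈ Γ.openIn Rᶜ ∧ l.1 ∉ Y))
    have hQ : (Q.card : ℤ) = n := by
      obtain ⟨C, hC⟩ : ∃ C : Set (V × Fin 3), ∀ l, l ∈ C ↔ l.1 ∈ Y :=
        ⟨{l | l.1 ∈ Y}, fun _ => Iff.rfl⟩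
      obtain ⟨C', hC'⟩ : ∃ C : Set (V × Fin 3), ∀ l, l ∈ C ↔ l.1 ∈ Y ∧ (Γ.glue l).1 ∈ Y :=
        ⟨{l | l.1 ∈ Y ∧ (Γ.glue l).1 ∈ Y}, fun _ => Iff.rfl⟩
      have h1 : ∑ l, (if l ∈ C then f l else 0) = 0 :=
        sum_vertices_eq_zero hdiv (fun l hl l' _ h => by rw [hC] at hl ⊢; rwa [h])
      have h2 : ∑ l, (if l ∈ C' ∧ Γ.glue l ≠ l then f l else 0) = 0 :=
        sum_glued_eq_zero hf.anti (fun l hl => by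
          rw [hC'] at hl ⊢; rw [Γ.glue_glue]; exact hl.symm)
      -- The flow value minus the divergence of `Y` plus the flow inside `Y` is the flow across the
      -- cut; leg by leg, it counts the saturated legs in `Q`.
      have h3 : (Q.card : ℤ) = ∑ l, (if l ∈ Γ.openIn Rᶜ then f l else 0) -
          ∑ l, (if l ∈ C then f l else 0) +
          ∑ l, (if l ∈ C' ∧ Γ.glue l ≠ l then f l else 0) := by
        rw [← Finset.sum_sub_distrib, ← Finset.sum_add_distrib, Finset.card_filter]
        push_cast
        refine Finset.sum_congr rfl fun l _ => ?_
        by_cases he : Γ.link l = e₀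
        · simp [hC, hC', he, hf.avoid l he]
        by_cases hY : l.1 ∈ Y <;> by_cases ho : Γ.glue l = l
        · by_cases hR : l ∈ Γ.openIn R
          · have : l ∉ Γ.openIn Rᶜ := fun h => (openIn_compl.1 h).2 hR
            simp [hC, hC', he, hY, ho, hR, this, hin l hR he hY]
          · have : l ∈ Γ.openIn Rᶜ := openIn_compl.2 ⟨ho, hR⟩
            simp [hC, hC', hY, ho, hR, this]
        · have hR : l ∉ Γ.openIn R := fun h => ho (glue_eq_of_openIn h)
          have hR' : l ∉ Γ.openIn Rᶜ := fun h => ho (glue_eq_of_openIn h)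
          by_cases hg : (Γ.glue l).1 ∈ Y
          · simp [hC, hC', hY, ho, hR, hR', hg]
          · simp [hC, hC', he, hY, ho, hR, hR', hg, hcross l ho he hY hg]
        · by_cases hR : l ∈ Γ.openIn R
          · have : l ∉ Γ.openIn Rᶜ := fun h => (openIn_compl.1 h).2 hR
            simp [hC, hC', hY, ho, hR, this]
          · have : l ∈ Γ.openIn Rᶜ := openIn_compl.2 ⟨ho, hR⟩
            simp [hC, hC', he, hY, ho, hR, this, hout l this he hY]
        · have hR : l ∉ Γ.openIn R := fun h => ho (glue_eq_of_openIn h)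
          have hR' : l ∉ Γ.openIn Rᶜ := fun h => ho (glue_eq_of_openIn h)
          simp [hC, hC', hY, ho, hR, hR']
      rw [h3, h1, h2, hval]
      ring
    have hsub : Γ.cut Yᶜ R \ {e₀} ⊆ Γ.link '' (Q : Set (V × Fin 3)) := by
      rintro e ⟨he, hne⟩
      obtain ⟨l, rfl⟩ := Γ.exists_link e
      rw [link_mem_cut] at he
      rw [Set.mem_singleton_iff] at hne
      by_cases ho : Γ.glue l = l
      · refine ⟨l, ?_, rfl⟩
        rw [Γ.farEnd_of_open ho, inr_mem_region] at he
        simp only [Q, Finset.coe_filter, Finset.mem_univ, true_and, Set.mem_ofPred_eq]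
        refine ⟨hne, Or.inr ?_⟩
        have h1 : l ∈ Γ.openIn R ↔ Γ.openLeg l ho ∈ R := ⟨fun h => h.2, fun h => ⟨ho, h⟩⟩
        rw [openIn_compl, h1]
        rw [Set.mem_compl_iff] at he
        tauto
      · rw [Γ.farEnd_of_ne ho, inl_mem_region, Set.mem_compl_iff, Set.mem_compl_iff] at he
        by_cases hY : l.1 ∈ Y
        · refine ⟨l, ?_, rfl⟩
          simp only [Q, Finset.coe_filter, Finset.mem_univ, true_and, Set.mem_ofPred_eq]
          exact ⟨hne, Or.inl ⟨ho, hY, by tauto⟩⟩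
        · refine ⟨Γ.glue l, ?_, Γ.link_glue l⟩
          simp only [Q, Finset.coe_filter, Finset.mem_univ, true_and, Set.mem_ofPred_eq]
          rw [Γ.link_glue, Γ.glue_glue]
          exact ⟨hne, Or.inl ⟨Ne.symm ho, by tauto, hY⟩⟩
    have h1 := hk Yᶜ
    have h2 := Set.ncard_le_ncard hsub (Set.toFinite _)
    have h3 := Set.ncard_image_le (f := Γ.link) (Finset.finite_toSet Q)
    rw [Set.ncard_coe_finset] at h3
    omega

lemma exists_flow [Fintype V] (e₀ : Γ.Link) (n : ℕ)
    (hk : ∀ X : Set V, n ≤ (Γ.cut X R \ {e₀}).ncard) :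
    ∃ f, Γ.PreFlow R e₀ f ∧ (∀ x, ∑ a, f (x, a) = 0) ∧
      ∑ l, (if l ∈ Γ.openIn Rᶜ then f l else 0) = (n : ℤ) := by
  induction n with
  | zero => exact ⟨fun _ => 0, by constructor <;> simp, by simp, by simp⟩
  | succ n ih =>
    obtain ⟨f, hf, hdiv, hval⟩ := ih fun X => (Nat.le_succ n).trans (hk X)
    exact hf.exists_augment hk hdiv hval

variable (Γ) in
/-- Two legs of `H` that are glued or belong to the same vertex. -/
def Near (H : Set (V × Fin 3)) (l l' : V × Fin 3) : Prop :=
  l ∈ H ∧ l' ∈ H ∧ (l' = Γ.glue l ∨ l.1 = l'.1)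

variable (Γ R) in
/-- The legs of `k` disjoint paths that join the open links in `R` with the others and avoid the
link `e₀`. -/
structure PathSystem (e₀ : Γ.Link) (k : ℕ) (H : Set (V × Fin 3)) : Prop where
  glue_mem : ∀ l ∈ H, Γ.glue l ∈ H
  avoid : ∀ l ∈ H, Γ.link l ≠ e₀
  two : ∀ x a, (x, a) ∈ H → {b | (x, b) ∈ H}.ncard = 2
  card_in : {l | l ∈ H ∧ l ∈ Γ.openIn R}.ncard = k
  card_out : {l | l ∈ H ∧ l ∈ Γ.openIn Rᶜ}.ncard = k
  conn_in : ∀ l ∈ H, ∃ l₀ ∈ H, l₀ ∈ Γ.openIn R ∧ Relation.ReflTransGen (Γ.Near H) l₀ l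
  conn_out : ∀ l₀ ∈ H, l₀ ∈ Γ.openIn R →
    ∃ l₁ ∈ H, l₁ ∈ Γ.openIn Rᶜ ∧ Relation.ReflTransGen (Γ.Near H) l₀ l₁

/-- The support of an integral unit flow on a three-valent network is already a union of disjoint
paths and cycles. The components that meet `R` are the required paths. -/
lemma exists_pathSystem [Fintype V] (e₀ : Γ.Link) (k : ℕ)
    (hk : ∀ X : Set V, k ≤ (Γ.cut X R \ {e₀}).ncard) : ∃ H, Γ.PathSystem R e₀ k H := by
  obtain ⟨f, hf, hdiv, hval⟩ := exists_flow e₀ k hk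
  let H₀ : Set (V × Fin 3) := {l | f l ≠ 0}
  have hglue : ∀ l ∈ H₀, Γ.glue l ∈ H₀ := by
    intro l hl
    by_cases ho : Γ.glue l = l
    · rwa [ho]
    · simpa [H₀, hf.anti l ho] using hl
  let comp : V × Fin 3 → Set (V × Fin 3) := fun l₀ => {l | Relation.ReflTransGen (Γ.Near H₀) l₀ l}
  have hcomp : ∀ l₀ ∈ H₀, ∀ l ∈ comp l₀, l ∈ H₀ := by
    intro l₀ h₀ l hl
    rcases Relation.ReflTransGen.cases_tail hl with rfl | ⟨_, _, h⟩
    · exact h₀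
    · exact h.2.1
  have hcglue : ∀ l₀ ∈ H₀, ∀ l ∈ comp l₀, Γ.glue l ∈ comp l₀ := fun l₀ h₀ l hl =>
    Relation.ReflTransGen.tail hl ⟨hcomp l₀ h₀ l hl, hglue l (hcomp l₀ h₀ l hl), Or.inl rfl⟩
  have hcvert : ∀ l₀ ∈ H₀, ∀ l ∈ comp l₀, ∀ l', f l' ≠ 0 → l'.1 = l.1 → l' ∈ comp l₀ :=
    fun l₀ h₀ l hl l' hl' h => Relation.ReflTransGen.tail hl
      ⟨hcomp l₀ h₀ l hl, hl', Or.inr h.symm⟩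
  -- Keeping only the components that start in `R` discards the cycles.
  obtain ⟨H, hHdef⟩ : ∃ H : Set (V × Fin 3),
      ∀ l, l ∈ H ↔ ∃ l₀ ∈ H₀, l₀ ∈ Γ.openIn R ∧ l ∈ comp l₀ :=
    ⟨{l | ∃ l₀ ∈ H₀, l₀ ∈ Γ.openIn R ∧ l ∈ comp l₀}, fun _ => Iff.rfl⟩
  have hH : ∀ l ∈ H, f l ≠ 0 := by
    intro l hl
    obtain ⟨l₀, h₀, _, h⟩ := (hHdef l).1 hl
    exact hcomp l₀ h₀ l h
  have hHglue : ∀ l ∈ H, Γ.glue l ∈ H := by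
    intro l hl
    obtain ⟨l₀, h₀, h₁, h⟩ := (hHdef l).1 hl
    exact (hHdef _).2 ⟨l₀, h₀, h₁, hcglue l₀ h₀ l h⟩
  have hHvert : ∀ l ∈ H, ∀ l', f l' ≠ 0 → l'.1 = l.1 → l' ∈ H := by
    intro l hl l' h2 h3
    obtain ⟨l₀, h₀, h₁, h⟩ := (hHdef l).1 hl
    exact (hHdef _).2 ⟨l₀, h₀, h₁, hcvert l₀ h₀ l h l' h2 h3⟩
  have hHin : ∀ l ∈ Γ.openIn R, (l ∈ H ↔ f l ≠ 0) := fun l hl =>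
    ⟨hH l, fun h => (hHdef l).2 ⟨l, h, hl, Relation.ReflTransGen.refl⟩⟩
  have hNear : ∀ l₀ ∈ H, ∀ l, Relation.ReflTransGen (Γ.Near H₀) l₀ l →
      l ∈ H ∧ Relation.ReflTransGen (Γ.Near H) l₀ l := by
    intro l₀ h₀ l h
    induction h with
    | refl => exact ⟨h₀, Relation.ReflTransGen.refl⟩
    | @tail b c _ hbc ih =>
      obtain ⟨ihb, ihr⟩ := ih
      have : c ∈ H := by
        rcases hbc.2.2 with h | h
        · exact h ▸ hHglue _ ihb
        · exact hHvert _ ihb _ hbc.2.1 h.symm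
      exact ⟨this, ihr.tail ⟨ihb, this, hbc.2.2⟩⟩
  have hsumR : ∑ l, (if l ∈ H ∧ l ∈ Γ.openIn R then f l else 0) = -k := by
    have h1 := hf.sum_openIn hdiv
    rw [hval] at h1
    have h2 : ∑ l, (if l ∈ H ∧ l ∈ Γ.openIn R then f l else 0) =
        ∑ l, (if l ∈ Γ.openIn R then f l else 0) := by
      refine Finset.sum_congr rfl fun l _ => ?_
      by_cases h : l ∈ Γ.openIn R
      · by_cases h' : f l = 0
        · simp [h']
        · simp [h, (hHin l h).2 h']
      · simp [h]
    rw [h2]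
    linarith
  have hsumRc : ∑ l, (if l ∈ H ∧ l ∈ Γ.openIn Rᶜ then f l else 0) = k := by
    have := sum_open_eq_zero (R := R) hf.anti hdiv hHglue hHvert
    rw [hsumR] at this
    linarith
  have hncard : ∀ T : Set (V × Fin 3), (T.ncard : ℤ) = ∑ l, if l ∈ T then 1 else 0 := by
    intro T
    rw [Set.ncard_eq_toFinset_card', Finset.sum_boole]
    congr 2
    ext l
    simp
  refine ⟨H, hHglue, fun l hl h => hH l hl (hf.avoid l h), ?_, ?_, ?_, ?_, ?_⟩
  -- Three numbers in `{-1, 0, 1}` with sum zero that are not all zero include exactly two nonzero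
  -- ones.
  · intro x a ha
    have h1 : {b | (x, b) ∈ H} = {b | f (x, b) ≠ 0} := by
      ext b
      exact ⟨fun h => hH _ h, fun h => hHvert _ ha (x, b) h rfl⟩
    have h2 := hdiv x
    have h3 : f (x, a) ≠ 0 := hH _ ha
    rw [h1, Set.ncard_eq_toFinset_card', Set.toFinset_ofPred, Finset.card_filter,
      Fin.sum_univ_three]
    rw [Fin.sum_univ_three] at h2
    have b0 := hf.neg_one_le (x, 0)
    have b1 := hf.neg_one_le (x, 1)
    have b2 := hf.neg_one_le (x, 2)
    have c0 := hf.le_one (x, 0)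
    have c1 := hf.le_one (x, 1)
    have c2 := hf.le_one (x, 2)
    have h4 : f (x, 0) ≠ 0 ∨ f (x, 1) ≠ 0 ∨ f (x, 2) ≠ 0 := by
      fin_cases a
      · exact Or.inl h3
      · exact Or.inr (Or.inl h3)
      · exact Or.inr (Or.inr h3)
    split_ifs <;> omega
  · have : ((({l | l ∈ H ∧ l ∈ Γ.openIn R} : Set (V × Fin 3)).ncard : ℤ)) = k := by
      rw [hncard, ← neg_neg (k : ℤ), ← hsumR, ← Finset.sum_neg_distrib]
      refine Finset.sum_congr rfl fun l _ => ?_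
      by_cases h : l ∈ H ∧ l ∈ Γ.openIn R
      · have h1 := hf.source l h.2
        have h2 := hf.neg_one_le l
        have h3 := hH l h.1
        rw [if_pos h, if_pos (show l ∈ {l | l ∈ H ∧ l ∈ Γ.openIn R} from h)]
        omega
      · rw [if_neg h, if_neg (show l ∉ {l | l ∈ H ∧ l ∈ Γ.openIn R} from h), neg_zero]
    exact_mod_cast this
  · have : ((({l | l ∈ H ∧ l ∈ Γ.openIn Rᶜ} : Set (V × Fin 3)).ncard : ℤ)) = k := by
      rw [hncard, ← hsumRc]
      refine Finset.sum_congr rfl fun l _ => ?_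
      by_cases h : l ∈ H ∧ l ∈ Γ.openIn Rᶜ
      · have h1 := hf.sink l h.2
        have h2 := hf.le_one l
        have h3 := hH l h.1
        rw [if_pos h, if_pos (show l ∈ {l | l ∈ H ∧ l ∈ Γ.openIn Rᶜ} from h)]
        omega
      · rw [if_neg h, if_neg (show l ∉ {l | l ∈ H ∧ l ∈ Γ.openIn Rᶜ} from h)]
    exact_mod_cast this
  · intro l hl
    obtain ⟨l₀, h₀, h₁, h⟩ := (hHdef l).1 hl
    have : l₀ ∈ H := (hHin l₀ h₁).2 h₀
    exact ⟨l₀, this, h₁, (hNear l₀ this l h).2⟩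
  -- Flow enters the component at `l₀`, so by conservation on the component it has to leave through
  -- an open leg outside of `R`.
  · intro l₀ h₀ h₁
    have hf₀ := hH l₀ h₀
    have hsum := sum_open_eq_zero (R := R) hf.anti hdiv (hcglue l₀ hf₀) (hcvert l₀ hf₀)
    by_contra hcon
    push Not at hcon
    have hz : ∑ l, (if l ∈ comp l₀ ∧ l ∈ Γ.openIn Rᶜ then f l else 0) = 0 := by
      refine Finset.sum_eq_zero fun l _ => if_neg ?_
      rintro ⟨h2, h3⟩
      exact hcon l (hNear l₀ h₀ l h2).1 h3 (hNear l₀ h₀ l h2).2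
    rw [hz, add_zero] at hsum
    have hneg : ∑ l, (if l ∈ comp l₀ ∧ l ∈ Γ.openIn R then f l else 0) < 0 := by
      refine Finset.sum_neg' ?_ ⟨l₀, Finset.mem_univ _, ?_⟩
      · intro l _
        split_ifs with h
        · exact hf.source l h.2
        · rfl
      · rw [if_pos ⟨Relation.ReflTransGen.refl, h₁⟩]
        exact lt_of_le_of_ne (hf.source l₀ h₁) hf₀
    exact absurd hsum hneg.ne

/-- A forest of links that joins the vertices outside of the paths with the paths and the
boundary. -/
lemma exists_forest (e₀ : Γ.Link) (H : Set (V × Fin 3))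
    (hS : ∀ S : Set V, S.Nonempty →
      ∃ l, l.1 ∈ S ∧ Γ.farEnd l ∉ Γ.region S ∅ ∧ Γ.link l ≠ e₀) :
    ∃ (d : V → ℕ) (leg : V → Fin 3), ∀ x, (∀ a, (x, a) ∉ H) →
      Γ.link (x, leg x) ≠ e₀ ∧ (Γ.glue (x, leg x) = (x, leg x) ∨
        d (Γ.glue (x, leg x)).1 < d x) := by
  let r : V → V → Prop := fun x y => ∃ a, Γ.link (x, a) ≠ e₀ ∧ (Γ.glue (x, a)).1 = y
  let B : Set V := {x | (∃ a, (x, a) ∈ H) ∨ ∃ a, Γ.link (x, a) ≠ e₀ ∧ Γ.glue (x, a) = (x, a)}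
  obtain ⟨d, hd⟩ := exists_depth r B
  have hreach : ∀ x, ∃ b ∈ B, Relation.ReflTransGen r x b := by
    by_contra hcon
    push Not at hcon
    -- The vertices that do not reach `B` would have a leaving link other than `e₀`, and it leads to
    -- the boundary or to a vertex that does reach `B`.
    obtain ⟨l, h1, h2, h3⟩ := hS {x | ∀ b ∈ B, ¬ Relation.ReflTransGen r x b} hcon
    by_cases ho : Γ.glue l = l
    · exact h1 l.1 (Or.inr ⟨l.2, h3, ho⟩) Relation.ReflTransGen.refl
    · rw [Γ.farEnd_of_ne ho, inl_mem_region, Set.mem_ofPred_eq] at h2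
      push Not at h2
      obtain ⟨b, hb, h⟩ := h2
      exact h1 b hb (h.head ⟨l.2, h3, rfl⟩)
  have key : ∀ x, ∃ a, (∀ a, (x, a) ∉ H) → Γ.link (x, a) ≠ e₀ ∧
      (Γ.glue (x, a) = (x, a) ∨ d (Γ.glue (x, a)).1 < d x) := by
    intro x
    by_cases hx : x ∈ B
    · rcases hx with ⟨a, ha⟩ | ⟨a, ha, ha'⟩
      -- On path vertices the value of `leg` is arbitrary.
      · exact ⟨0, fun h => absurd ha (h a)⟩
      · exact ⟨a, fun _ => ⟨ha, Or.inl ha'⟩⟩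
    · obtain ⟨y, ⟨a, ha, rfl⟩, hdy, _⟩ := hd x hx (hreach x)
      exact ⟨a, fun _ => ⟨ha, Or.inr hdy⟩⟩
  choose leg hleg using key
  exact ⟨d, leg, hleg⟩

end Network

/-! ### Diagrams with local processes -/

/-- Local processes at the vertices of a network: pairings of the copies on each leg, and gauge
parameters for some of the copies. A copy without gauge parameter is joined with the same copy on
all legs, and this copy has a gauge parameter. -/
structure Propagation (V : Type*) (N : ℕ) (L : Type*) where
  pairing : V × Fin 3 → Copies N → Copies N
  pairing_invol : ∀ l, Function.Involutive (pairing l)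
  pairing_ne : ∀ l c, pairing l c ≠ c
  label : V → Copies N → Option L
  label_inj : ∀ {x c x' c' i}, label x c = some i → label x' c' = some i → x = x' ∧ c = c'
  pairing_of_none : ∀ {x c}, label x c = none → ∀ a b, pairing (x, a) c = pairing (x, b) c
  label_pairing : ∀ {x c}, label x c = none → ∀ a, label x (pairing (x, a) c) ≠ none

lemma freeStrand_ne {N : ℕ} (ρ : Equiv.Perm (Fin N)) (c : Copies N) : freeStrand ρ c ≠ c := by
  rcases c with k | k <;> simp [freeStrand]

lemma freeStrand_injective {N : ℕ} {ρ ρ' : Equiv.Perm (Fin N)}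
    (h : freeStrand ρ = freeStrand ρ') : ρ = ρ' := by
  ext k
  have := congrFun h (Sum.inl k)
  simp only [freeStrand, Sum.inr.injEq] at this
  rw [this]

namespace Network

variable {V : Type*} (Γ : Network V) {N : ℕ} {R : Set Γ.OpenLeg}

lemma contraction_of_open {l : V × Fin 3} (h : Γ.glue l = l) (c : Copies N) :
    Γ.contraction N R (l, c) = (l, freeStrand (Γ.boundaryPerm N R (Γ.openLeg l h)) c) :=
  dif_pos h

lemma contraction_of_ne {l : V × Fin 3} (h : Γ.glue l ≠ l) (c : Copies N) :
    Γ.contraction N R (l, c) = (Γ.glue l, c) := dif_neg h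

lemma contraction_ne (p : Point V N) : Γ.contraction N R p ≠ p := by
  obtain ⟨l, c⟩ := p
  by_cases h : Γ.glue l = l
  · rw [Γ.contraction_of_open h]
    exact fun e => freeStrand_ne _ c (Prod.mk.inj e).2
  · rw [Γ.contraction_of_ne h]
    exact fun e => h (Prod.mk.inj e).1

lemma link_contraction (p : Point V N) : Γ.link (Γ.contraction N R p).1 = Γ.link p.1 := by
  obtain ⟨l, c⟩ := p
  by_cases h : Γ.glue l = l
  · rw [Γ.contraction_of_open h]
  · rw [Γ.contraction_of_ne h, Γ.link_glue]

end Network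

namespace Propagation

variable {V : Type*} {N : ℕ} {L : Type*} (𝒬 : Propagation V N L) (Γ : Network V)
  (R : Set Γ.OpenLeg)

/-- The diagram of the local processes `𝒬`. -/
def diagram : StrandedDiagram (Network.Point V N) L where
  contract := Γ.contraction N R
  strand p := (p.1, 𝒬.pairing p.1 p.2)
  contract_invol := Γ.contraction_invol N R
  strand_invol _ := Prod.ext rfl (𝒬.pairing_invol _ _)
  gauge p := (𝒬.label p.1.1 p.2).elim 1 FreeGroup.of

/-- The pairing of the copies at the far end of a leg. -/
def farPairing (l : V × Fin 3) : Copies N → Copies N :=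
  if h : Γ.glue l = l then freeStrand (Γ.boundaryPerm N R (Γ.openLeg l h))
  else 𝒬.pairing (Γ.glue l)

variable {𝒬 Γ R}

lemma face_pairing (l : V × Fin 3) (c : Copies N) :
    (𝒬.diagram Γ R).face (l, 𝒬.pairing l c) = (𝒬.diagram Γ R).face (l, c) :=
  (𝒬.diagram Γ R).face_strand (l, c)

lemma face_glue {l : V × Fin 3} (h : Γ.glue l ≠ l) (c : Copies N) :
    (𝒬.diagram Γ R).face (Γ.glue l, c) = (𝒬.diagram Γ R).face (l, c) := by
  have := (𝒬.diagram Γ R).face_contract (l, c)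
  rwa [show (𝒬.diagram Γ R).contract (l, c) = (Γ.glue l, c) from Γ.contraction_of_ne h c] at this

lemma face_open {l : V × Fin 3} (h : Γ.glue l = l) (c : Copies N) :
    (𝒬.diagram Γ R).face (l, freeStrand (Γ.boundaryPerm N R (Γ.openLeg l h)) c) =
      (𝒬.diagram Γ R).face (l, c) := by
  have := (𝒬.diagram Γ R).face_contract (l, c)
  rwa [show (𝒬.diagram Γ R).contract (l, c) = _ from Γ.contraction_of_open h c] at this

/-- Seen from the leg `l`, a face is closed under the pairing at both ends of its link; `farPairing`
is the one at the other end. -/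
lemma face_farPairing (l : V × Fin 3) (c : Copies N) :
    (𝒬.diagram Γ R).face (l, 𝒬.farPairing Γ R l c) = (𝒬.diagram Γ R).face (l, c) := by
  by_cases h : Γ.glue l = l
  · rw [farPairing, dif_pos h, face_open]
  · rw [farPairing, dif_neg h, ← face_glue h, face_pairing, face_glue h]

lemma farPairing_ne (l : V × Fin 3) (c : Copies N) : 𝒬.farPairing Γ R l c ≠ c := by
  by_cases h : Γ.glue l = l
  · rw [farPairing, dif_pos h]; exact freeStrand_ne _ _
  · rw [farPairing, dif_neg h]; exact 𝒬.pairing_ne _ _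

variable (𝒬 Γ R) in
/-- The link on which a face runs. -/
def faceLink (f : (𝒬.diagram Γ R).Face) : Γ.Link :=
  Γ.link (Quotient.out (s := (𝒬.diagram Γ R).faceSetoid) f).1

lemma link_eq_of_face_eq {p q : Network.Point V N}
    (h : (𝒬.diagram Γ R).face p = (𝒬.diagram Γ R).face q) : Γ.link p.1 = Γ.link q.1 :=
  (𝒬.diagram Γ R).eq_of_face_eq (fun p => Γ.link p.1) (fun _ => rfl)
    (fun p => Γ.link_contraction p) h

lemma faceLink_face (p : Network.Point V N) :
    𝒬.faceLink Γ R ((𝒬.diagram Γ R).face p) = Γ.link p.1 :=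
  link_eq_of_face_eq ((𝒬.diagram Γ R).face_out _)

lemma exists_copy {f : (𝒬.diagram Γ R).Face} {l : V × Fin 3}
    (h : 𝒬.faceLink Γ R f = Γ.link l) : ∃ c, (𝒬.diagram Γ R).face (l, c) = f := by
  obtain ⟨q, rfl⟩ : ∃ q, (𝒬.diagram Γ R).face q = f := ⟨_, (𝒬.diagram Γ R).face_out f⟩
  rw [faceLink_face, Γ.link_eq_iff] at h
  obtain ⟨l', c⟩ := q
  by_cases ho : Γ.glue l = l
  · rw [ho, or_self] at h
    exact ⟨c, by rw [show l' = l from h]⟩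
  · rcases h with h | h
    · exact ⟨c, by rw [show l' = l from h]⟩
    · exact ⟨c, by rw [show l' = Γ.glue l from h, face_glue ho]⟩

lemma two_le_fiber_card (l : V × Fin 3) {f : (𝒬.diagram Γ R).Face}
    (h : 𝒬.faceLink Γ R f = Γ.link l) :
    2 ≤ (Finset.univ.filter fun c => (𝒬.diagram Γ R).face (l, c) = f).card := by
  obtain ⟨c, rfl⟩ := exists_copy h
  refine Nat.succ_le_iff.2 (Finset.one_lt_card.2 ?_)
  exact ⟨c, by simp, 𝒬.pairing l c, by simp [face_pairing], (𝒬.pairing_ne l c).symm⟩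

/-! ### Counting the faces on a link -/

section Count

variable [Finite V]

lemma sum_fiber_card (l : V × Fin 3) :
    ∑ f : (𝒬.diagram Γ R).Face with 𝒬.faceLink Γ R f = Γ.link l,
      (Finset.univ.filter fun c => (𝒬.diagram Γ R).face (l, c) = f).card = 2 * N := by
  have h := Finset.card_eq_sum_card_fiberwise (s := (Finset.univ : Finset (Copies N)))
    (t := Finset.univ.filter fun f => 𝒬.faceLink Γ R f = Γ.link l)
    (f := fun c => (𝒬.diagram Γ R).face (l, c)) (fun c _ => by simp [faceLink_face])
  rw [← h]
  simp [two_mul]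

/-- A leg has `2N` copies, and each face on its link takes at least two of them, a copy and its
partner. -/
lemma card_faces_le (e : Γ.Link) :
    (Finset.univ.filter fun f => 𝒬.faceLink Γ R f = e).card ≤ N := by
  obtain ⟨l, rfl⟩ := Γ.exists_link e
  have h1 := sum_fiber_card (𝒬 := 𝒬) (R := R) l
  have h2 := Finset.card_nsmul_le_sum
    (Finset.univ.filter fun f => 𝒬.faceLink Γ R f = Γ.link l)
    (fun f => (Finset.univ.filter fun c => (𝒬.diagram Γ R).face (l, c) = f).card) 2
    (fun f hf => two_le_fiber_card l (Finset.mem_filter.1 hf).2)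
  rw [h1, smul_eq_mul] at h2
  omega

/-- Where the pairings of the two ends disagree, a face takes three copies: `c` and its two
different partners. -/
lemma card_faces_lt {l : V × Fin 3} (h : 𝒬.pairing l ≠ 𝒬.farPairing Γ R l) :
    (Finset.univ.filter fun f => 𝒬.faceLink Γ R f = Γ.link l).card < N := by
  obtain ⟨c, hc⟩ := Function.ne_iff.1 h
  have h1 := sum_fiber_card (𝒬 := 𝒬) (R := R) l
  have h2 := Finset.sum_lt_sum (s := Finset.univ.filter fun f => 𝒬.faceLink Γ R f = Γ.link l)
    (f := fun _ => 2)
    (g := fun f => (Finset.univ.filter fun c => (𝒬.diagram Γ R).face (l, c) = f).card)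
    (fun f hf => two_le_fiber_card l (Finset.mem_filter.1 hf).2)
    ⟨(𝒬.diagram Γ R).face (l, c), by simp [faceLink_face], by
      rw [Finset.two_lt_card]
      exact ⟨c, by simp, 𝒬.pairing l c, by simp [face_pairing], 𝒬.farPairing Γ R l c,
        by simp [face_farPairing], (𝒬.pairing_ne l c).symm, (farPairing_ne l c).symm, hc⟩⟩
  rw [h1, Finset.sum_const, smul_eq_mul] at h2
  omega

lemma one_le_card_faces (hN : 0 < N) (e : Γ.Link) :
    1 ≤ (Finset.univ.filter fun f => 𝒬.faceLink Γ R f = e).card := by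
  obtain ⟨l, rfl⟩ := Γ.exists_link e
  refine Finset.card_pos.2 ⟨(𝒬.diagram Γ R).face (l, Sum.inl ⟨0, hN⟩), ?_⟩
  simp [faceLink_face]

/-- If both ends pair by the same `ρ`, the index of the incoming copy is constant along a face and
distinguishes `N` faces. -/
lemma le_card_faces {l : V × Fin 3} {ρ : Equiv.Perm (Fin N)} (h1 : 𝒬.pairing l = freeStrand ρ)
    (h2 : 𝒬.farPairing Γ R l = freeStrand ρ) :
    N ≤ (Finset.univ.filter fun f => 𝒬.faceLink Γ R f = Γ.link l).card := by
  let φ : Copies N → Fin N := fun c => Sum.elim id ρ.symm c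
  have hφ : ∀ c, φ (freeStrand ρ c) = φ c := by
    rintro (k | k) <;> simp [φ, freeStrand]
  have hinj : Function.Injective fun k : Fin N => (𝒬.diagram Γ R).face (l, Sum.inl k) := by
    intro k k' h
    have h' := (𝒬.diagram Γ R).eq_of_face_eq
      (fun p => if Γ.link p.1 = Γ.link l then some (φ p.2) else none) ?_ ?_ h
    · simpa [φ] using h'
    · rintro ⟨l', c⟩
      change (if Γ.link l' = Γ.link l then some (φ (𝒬.pairing l' c)) else none) =
        if Γ.link l' = Γ.link l then some (φ c) else none
      split_ifs with hl
      · rw [Γ.link_eq_iff] at hl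
        by_cases ho : Γ.glue l = l
        · rw [ho, or_self] at hl
          rw [hl, h1, hφ]
        · rw [farPairing, dif_neg ho] at h2
          rcases hl with rfl | rfl
          · rw [h1, hφ]
          · rw [h2, hφ]
      · rfl
    · rintro ⟨l', c⟩
      change (if Γ.link (Γ.contraction N R (l', c)).1 = Γ.link l then
          some (φ (Γ.contraction N R (l', c)).2) else none) =
        if Γ.link l' = Γ.link l then some (φ c) else none
      rw [Γ.link_contraction]
      split_ifs with hl
      · by_cases ho' : Γ.glue l' = l'
        · have : l' = l := by
            rw [Eq.comm, Γ.link_eq_iff, ho', or_self] at hl; exact hl.symm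
          subst this
          rw [farPairing, dif_pos ho'] at h2
          rw [Γ.contraction_of_open ho', h2, hφ]
        · rw [Γ.contraction_of_ne ho']
      · rfl
  calc N = (Finset.univ.image fun k : Fin N => (𝒬.diagram Γ R).face (l, Sum.inl k)).card := by
        rw [Finset.card_image_of_injective _ hinj]; simp
    _ ≤ _ := by
        refine Finset.card_le_card fun f hf => ?_
        obtain ⟨k, _, rfl⟩ := Finset.mem_image.1 hf
        simp [faceLink_face]

end Count

end Propagation

/-! ### Counting the links of a path system -/

namespace Network

variable {V : Type*} {Γ : Network V} {R : Set Γ.OpenLeg} {e₀ : Γ.Link} {k : ℕ}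
  {H : Set (V × Fin 3)}

lemma eq_of_link_eq (hloop : ∀ l, Γ.glue l ≠ l → (Γ.glue l).1 ≠ l.1) {x : V} {a b : Fin 3}
    (h : Γ.link (x, a) = Γ.link (x, b)) : a = b := by
  rcases Γ.link_eq_iff.1 h with h | h
  · exact (Prod.mk.inj h).2
  · by_cases ho : Γ.glue (x, b) = (x, b)
    · rw [ho] at h
      exact (Prod.mk.inj h).2
    · exact absurd (by rw [← h]) (hloop _ ho)

lemma PathSystem.mem_of_link_eq (hH : Γ.PathSystem R e₀ k H) {l l' : V × Fin 3} (hl : l ∈ H)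
    (h : Γ.link l' = Γ.link l) : l' ∈ H := by
  rcases Γ.link_eq_iff.1 h with rfl | rfl
  · exact hl
  · exact hH.glue_mem _ hl

lemma PathSystem.eq_of_mem (hH : Γ.PathSystem R e₀ k H) {x : V} {a b c : Fin 3} (ha : (x, a) ∈ H)
    (hb : (x, b) ∈ H) (hc : (x, c) ∈ H) (hab : a ≠ b) (hac : a ≠ c) : b = c := by
  by_contra hbc
  have h2 := hH.two x a ha
  have h3 : ({a, b, c} : Set (Fin 3)).ncard ≤ {d | (x, d) ∈ H}.ncard := by
    refine Set.ncard_le_ncard ?_ (Set.toFinite _)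
    rintro d (rfl | rfl | rfl) <;> assumption
  rw [h2, Set.ncard_eq_three.2 ⟨a, b, c, hab, hac, hbc, rfl⟩] at h3
  omega

/-- Double counting of legs: a glued link has two and an open link one, a path vertex has two, and
`2k` legs are open. So twice the number of links is twice the number of vertices plus `2k`. -/
lemma PathSystem.ncard_links [Fintype V] (hH : Γ.PathSystem R e₀ k H) :
    (Γ.link '' H).ncard = {x | ∃ a, (x, a) ∈ H}.ncard + k := by
  have h1 : ∑ l ∈ H.toFinset, (if Γ.glue l = l then 2 else 1) = 2 * (Γ.link '' H).ncard := by
    rw [← Finset.sum_fiberwise_of_maps_to (s := H.toFinset) (t := (Γ.link '' H).toFinset)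
      (g := Γ.link) (fun l hl => by
        rw [Set.mem_toFinset] at hl ⊢
        exact Set.mem_image_of_mem _ hl)]
    rw [Set.ncard_eq_toFinset_card', mul_comm, ← smul_eq_mul, ← Finset.sum_const]
    refine Finset.sum_congr rfl fun e he => ?_
    rw [Set.mem_toFinset] at he
    obtain ⟨l, hl, rfl⟩ := he
    have hfil : H.toFinset.filter (fun l' => Γ.link l' = Γ.link l) = {l, Γ.glue l} := by
      ext l'
      rw [Finset.mem_filter, Set.mem_toFinset, Γ.link_eq_iff, Finset.mem_insert,
        Finset.mem_singleton]
      refine ⟨fun h => h.2, fun h => ⟨?_, h⟩⟩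
      rcases h with rfl | rfl
      · exact hl
      · exact hH.glue_mem _ hl
    rw [hfil]
    by_cases ho : Γ.glue l = l
    · simp [ho]
    · rw [Finset.sum_pair (Ne.symm ho), if_neg ho, if_neg (Γ.glue_glue_ne ho)]
  have h2 : ∑ l ∈ H.toFinset, (if Γ.glue l = l then 2 else 1) = H.ncard + 2 * k := by
    have h3 : ∀ l ∈ H.toFinset, (if Γ.glue l = l then 2 else 1) =
        1 + (if l ∈ Γ.openIn R then 1 else 0) + (if l ∈ Γ.openIn Rᶜ then 1 else 0) := by
      intro l _
      rw [openIn_compl]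
      by_cases ho : Γ.glue l = l
      · by_cases hR : l ∈ Γ.openIn R <;> simp [ho, hR]
      · have hR : l ∉ Γ.openIn R := fun h => ho (glue_eq_of_openIn h)
        simp [ho, hR]
    rw [Finset.sum_congr rfl h3, Finset.sum_add_distrib, Finset.sum_add_distrib,
      ← Finset.card_filter, ← Finset.card_filter, ← Finset.card_eq_sum_ones,
      Set.ncard_eq_toFinset_card' H]
    have h4 : (H.toFinset.filter fun l => l ∈ Γ.openIn R).card = k := by
      rw [← hH.card_in, Set.ncard_eq_toFinset_card']
      congr 1
      ext l
      rw [Finset.mem_filter, Set.mem_toFinset, Set.mem_toFinset]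
      rfl
    have h5 : (H.toFinset.filter fun l => l ∈ Γ.openIn Rᶜ).card = k := by
      rw [← hH.card_out, Set.ncard_eq_toFinset_card']
      congr 1
      ext l
      rw [Finset.mem_filter, Set.mem_toFinset, Set.mem_toFinset]
      rfl
    omega
  have h6 : H.ncard = 2 * {x | ∃ a, (x, a) ∈ H}.ncard := by
    rw [Set.ncard_eq_toFinset_card' H]
    rw [Finset.card_eq_sum_card_fiberwise (f := Prod.fst)
      (t := {x | ∃ a, (x, a) ∈ H}.toFinset) (fun l hl => by
        simp only [Set.coe_toFinset] at hl ⊢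
        exact ⟨l.2, hl⟩)]
    rw [Set.ncard_eq_toFinset_card' {x | ∃ a, (x, a) ∈ H}, mul_comm, ← smul_eq_mul,
      ← Finset.sum_const]
    refine Finset.sum_congr rfl fun x hx => ?_
    rw [Set.mem_toFinset] at hx
    obtain ⟨a, ha⟩ := hx
    rw [← hH.two x a ha, Set.ncard_eq_toFinset_card']
    refine Finset.card_bij' (fun l _ => l.2) (fun b _ => (x, b)) ?_ ?_ ?_ ?_
    · rintro ⟨y, b⟩ h
      simp only [Finset.mem_filter, Set.mem_toFinset] at h
      obtain ⟨h, rfl⟩ := h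
      simpa using h
    · intro b hb
      simp only [Finset.mem_filter, Set.mem_toFinset]
      exact ⟨by simpa using hb, trivial⟩
    · rintro ⟨y, b⟩ h
      simp only [Finset.mem_filter, Set.mem_toFinset] at h
      rw [← h.2]
    · intro b _
      rfl
  omega

end Network

/-! ### Connectedness of the faces on a path -/

namespace Propagation

variable {V : Type*} {N : ℕ} {L : Type*} (𝒬 : Propagation V N L) (Γ : Network V)
  (R : Set Γ.OpenLeg)

/-- Two faces that share a gauge parameter of a vertex on one of the paths. -/
def Touch (H : Set (V × Fin 3)) (f f' : (𝒬.diagram Γ R).Face) : Prop :=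
  ∃ x a b c, (x, a) ∈ H ∧ (x, b) ∈ H ∧ 𝒬.label x c ≠ none ∧
    (𝒬.diagram Γ R).face ((x, a), c) = f ∧ (𝒬.diagram Γ R).face ((x, b), c) = f'

variable {𝒬 Γ R} {H : Set (V × Fin 3)} {e₀ : Γ.Link} {k : ℕ}

lemma reflTransGen_touch_symm {f f' : (𝒬.diagram Γ R).Face}
    (h : Relation.ReflTransGen (𝒬.Touch Γ R H) f f') :
    Relation.ReflTransGen (𝒬.Touch Γ R H) f' f := by
  induction h with
  | refl => exact Relation.ReflTransGen.refl
  | tail _ hn ih =>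
    obtain ⟨x, a, b, c, h1, h2, h3, h4, h5⟩ := hn
    exact ih.head ⟨x, b, a, c, h2, h1, h3, h5, h4⟩

/-- Along a path the same copy can be followed from face to face. At a vertex where the copy has no
gauge parameter, its partner has one and lies on the same faces. -/
lemma reflTransGen_touch_of_near {l l' : V × Fin 3}
    (h : Relation.ReflTransGen (Γ.Near H) l l') (c : Copies N) :
    Relation.ReflTransGen (𝒬.Touch Γ R H) ((𝒬.diagram Γ R).face (l, c))
      ((𝒬.diagram Γ R).face (l', c)) := by
  induction h with
  | refl => exact Relation.ReflTransGen.refl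
  | @tail l₁ l₂ _ hn ih =>
    refine ih.trans ?_
    obtain ⟨h1, h2, rfl | h3⟩ := hn
    · by_cases ho : Γ.glue l₁ = l₁
      · rw [ho]
      · rw [face_glue ho]
    · obtain ⟨x, a⟩ := l₁
      obtain ⟨y, b⟩ := l₂
      obtain rfl : x = y := h3
      by_cases hc : 𝒬.label x c = none
      · rw [← face_pairing (x, a) c, ← face_pairing (x, b) c, 𝒬.pairing_of_none hc b a]
        exact Relation.ReflTransGen.single
          ⟨x, a, b, _, h1, h2, 𝒬.label_pairing hc a, rfl, rfl⟩
      · exact Relation.ReflTransGen.single ⟨x, a, b, c, h1, h2, hc, rfl, rfl⟩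

/-- All faces on a path are connected through gauge parameters of its vertices. -/
lemma reflTransGen_touch_root (hN : 0 < N) (hH : Γ.PathSystem R e₀ k H) {l : V × Fin 3}
    (hl : l ∈ H) (c : Copies N) : ∃ l₀ ∈ H, l₀ ∈ Γ.openIn R ∧
      Relation.ReflTransGen (𝒬.Touch Γ R H) ((𝒬.diagram Γ R).face (l, c))
        ((𝒬.diagram Γ R).face (l₀, Sum.inl ⟨0, hN⟩)) := by
  obtain ⟨l₀, h₀, hR, hconn⟩ := hH.conn_in l hl
  obtain ⟨l₁, h₁, hR', hconn'⟩ := hH.conn_out l₀ h₀ hR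
  refine ⟨l₀, h₀, hR, ?_⟩
  refine (reflTransGen_touch_symm (reflTransGen_touch_of_near hconn c)).trans ?_
  -- The identity at the far end of the path joins the outgoing with the incoming copy of the same
  -- number.
  have hout : ∀ k, Relation.ReflTransGen (𝒬.Touch Γ R H)
      ((𝒬.diagram Γ R).face (l₀, Sum.inr k)) ((𝒬.diagram Γ R).face (l₀, Sum.inl k)) := by
    intro k
    refine (reflTransGen_touch_of_near hconn' (Sum.inr k)).trans ?_
    refine Relation.ReflTransGen.trans ?_
      (reflTransGen_touch_symm (reflTransGen_touch_of_near hconn' (Sum.inl k)))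
    obtain ⟨ho, hoR⟩ := hR'
    have := face_open (𝒬 := 𝒬) (R := R) ho (Sum.inl k)
    rw [Network.boundaryPerm, if_neg hoR] at this
    rw [← this]
    exact Relation.ReflTransGen.refl
  -- Combined with the cyclic permutation at the end in `R`, this joins the incoming copies `k` and
  -- `k + 1`, and all copies are connected with the copy `0`.
  have hrot : ∀ k, Relation.ReflTransGen (𝒬.Touch Γ R H)
      ((𝒬.diagram Γ R).face (l₀, Sum.inl (finRotate N k)))
      ((𝒬.diagram Γ R).face (l₀, Sum.inl k)) := by
    intro k
    refine (reflTransGen_touch_symm (hout _)).trans ?_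
    obtain ⟨ho, hoR⟩ := hR
    have := face_open (𝒬 := 𝒬) (R := R) ho (Sum.inl k)
    rw [Network.boundaryPerm, if_pos hoR] at this
    rw [← this]
    exact Relation.ReflTransGen.refl
  have hin : ∀ k, Relation.ReflTransGen (𝒬.Touch Γ R H)
      ((𝒬.diagram Γ R).face (l₀, Sum.inl k))
      ((𝒬.diagram Γ R).face (l₀, Sum.inl ⟨0, hN⟩)) := by
    obtain ⟨n, rfl⟩ : ∃ n, N = n + 1 := ⟨N - 1, by omega⟩
    intro k
    induction k using Fin.induction with
    | zero => exact Relation.ReflTransGen.refl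
    | succ i ih =>
      refine Relation.ReflTransGen.trans ?_ ih
      have := hrot i.castSucc
      rwa [finRotate_apply, Fin.coeSucc_eq_succ] at this
  rcases c with k | k
  · exact hin k
  · exact (hout k).trans (hin k)

end Propagation

/-! ### Elimination of faces along the forest and the paths -/

namespace Propagation

variable {V : Type*} {N : ℕ} {L : Type*} {𝒬 : Propagation V N L} {Γ : Network V}
  {R : Set Γ.OpenLeg} {H : Set (V × Fin 3)} {e₀ : Γ.Link} {k : ℕ}

/-- The label of the gauge parameter at a field argument. -/
def pointLabel (𝒬 : Propagation V N L) (p : Network.Point V N) : Option L := 𝒬.label p.1.1 p.2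

lemma eq_of_pointLabel_eq {p q : Network.Point V N} (hq : 𝒬.pointLabel q ≠ none)
    (h : 𝒬.pointLabel p = 𝒬.pointLabel q) : p.1.1 = q.1.1 ∧ p.2 = q.2 := by
  obtain ⟨i, hi⟩ := Option.ne_none_iff_exists'.1 hq
  exact 𝒬.label_inj (h.trans hi) hi

/-- The faces on the forest, and all but one face on each path, can be eliminated. -/
lemma exists_eliminable [Fintype V] (hN : 0 < N)
    (hloop : ∀ l, Γ.glue l ≠ l → (Γ.glue l).1 ≠ l.1) (hH : Γ.PathSystem R e₀ k H)
    {d : V → ℕ} {leg : V → Fin 3}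
    (hleg : ∀ x, (∀ a, (x, a) ∉ H) → Γ.link (x, leg x) ≠ e₀ ∧
      (Γ.glue (x, leg x) = (x, leg x) ∨ d (Γ.glue (x, leg x)).1 < d x)) :
    ∃ (I : Finset (𝒬.diagram Γ R).Face) (pt : (𝒬.diagram Γ R).Face → Network.Point V N)
      (ht : (𝒬.diagram Γ R).Face → ℕ), (𝒬.diagram Γ R).Eliminable I pt 𝒬.pointLabel ht ∧
      ∃ J : Finset (𝒬.diagram Γ R).Face, J.card ≤ k ∧ ∀ f ∉ I, f ∈ J ∨
        ((∀ l ∈ H, 𝒬.faceLink Γ R f ≠ Γ.link l) ∧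
          ∀ x, (∀ a, (x, a) ∉ H) → 𝒬.faceLink Γ R f ≠ Γ.link (x, leg x)) := by
  let 𝒢 := 𝒬.diagram Γ R
  let onPath : 𝒢.Face → Prop := fun f => ∃ l ∈ H, 𝒬.faceLink Γ R f = Γ.link l
  let onTree : 𝒢.Face → Prop := fun f =>
    ∃ x, (∀ a, (x, a) ∉ H) ∧ 𝒬.faceLink Γ R f = Γ.link (x, leg x)
  have onPath_iff : ∀ l c, onPath (𝒢.face (l, c)) ↔ l ∈ H := by
    intro l c
    refine ⟨?_, fun h => ⟨l, h, faceLink_face (𝒬 := 𝒬) (l, c)⟩⟩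
    rintro ⟨l', hl', h⟩
    exact hH.mem_of_link_eq hl' ((faceLink_face (𝒬 := 𝒬) (l, c)).symm.trans h)
  -- One face on each path is given up; the other faces on the path are ordered by their distance
  -- `d'` from these roots.
  let roots : Finset 𝒢.Face := {l | l ∈ H ∧ l ∈ Γ.openIn R}.toFinset.image
    fun l => 𝒢.face (l, Sum.inl ⟨0, hN⟩)
  have hroots : roots.card ≤ k := by
    refine Finset.card_image_le.trans ?_
    rw [← hH.card_in, Set.ncard_eq_toFinset_card']
  obtain ⟨d', hd'⟩ := exists_depth (𝒬.Touch Γ R H) (roots : Set 𝒢.Face)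
  obtain ⟨M, hM⟩ : ∃ M, ∀ x, d x ≤ M := by
    obtain ⟨M, hM⟩ := (Set.finite_range d).bddAbove
    exact ⟨M, fun x => hM ⟨x, rfl⟩⟩
  let I : Finset 𝒢.Face := Finset.univ.filter fun f => onTree f ∨ (onPath f ∧ f ∉ roots)
  have hpt : ∀ f, ∃ q : Network.Point V N, f ∈ I → 𝒢.face q = f ∧ 𝒬.pointLabel q ≠ none ∧
      ((onPath f ∧ q.1 ∈ H ∧ ∃ b, (q.1.1, b) ∈ H ∧ d' (𝒢.face ((q.1.1, b), q.2)) < d' f) ∨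
        (¬ onPath f ∧ (∀ a, (q.1.1, a) ∉ H) ∧ q.1.2 = leg q.1.1)) := by
    intro f
    by_cases hf : f ∈ I
    swap
    · exact ⟨Quotient.out (s := 𝒢.faceSetoid) f, fun h => absurd h hf⟩
    rcases (Finset.mem_filter.1 hf).2 with ⟨x, hx, hfx⟩ | ⟨hp, hr⟩
    · obtain ⟨c, hc⟩ := exists_copy hfx
      have hnp : ¬ onPath f := by
        rw [← hc]
        exact fun h => hx _ ((onPath_iff _ c).1 h)
      by_cases hl : 𝒬.label x c = none
      · refine ⟨((x, leg x), 𝒬.pairing (x, leg x) c), fun _ => ⟨?_, ?_, Or.inr ⟨hnp, hx, rfl⟩⟩⟩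
        · rw [← hc]; exact face_pairing _ _
        · exact 𝒬.label_pairing hl _
      · exact ⟨((x, leg x), c), fun _ => ⟨hc, hl, Or.inr ⟨hnp, hx, rfl⟩⟩⟩
    · have hreach : ∃ b ∈ (roots : Set 𝒢.Face), Relation.ReflTransGen (𝒬.Touch Γ R H) f b := by
        obtain ⟨l, hl, hfl⟩ := hp
        obtain ⟨c, rfl⟩ := exists_copy hfl
        obtain ⟨l₀, h₀, h₁, h⟩ := reflTransGen_touch_root (𝒬 := 𝒬) hN hH hl c
        refine ⟨_, ?_, h⟩
        refine Finset.mem_coe.2 (Finset.mem_image_of_mem _ ?_)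
        rw [Set.mem_toFinset]
        exact ⟨h₀, h₁⟩
      obtain ⟨f', ⟨x, a, b, c, h1, h2, h3, h4, h5⟩, hlt, _⟩ := hd' f (by simpa using hr) hreach
      exact ⟨((x, a), c), fun _ => ⟨h4, h3, Or.inl ⟨hp, h1, b, h2, by rw [← h5] at hlt; exact hlt⟩⟩⟩
  choose pt hpt using hpt
  -- Forest faces come before all path faces, the deepest first. Since `M` bounds `d`, the truncated
  -- subtraction reverses the order faithfully.
  let ht : 𝒢.Face → ℕ := fun f => if onPath f then M + 1 + d' f else M - d (pt f).1.1
  refine ⟨I, pt, ht, ⟨fun f hf => (hpt f hf).1, fun f hf => (hpt f hf).2.1, ?_, ?_⟩,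
    roots, hroots, ?_⟩
  · intro f hf q hq hlab
    obtain ⟨h1, h2, _⟩ := hpt f hf
    obtain ⟨hx, hc⟩ := eq_of_pointLabel_eq h2 hlab
    have hlink := link_eq_of_face_eq (hq.trans h1.symm)
    obtain ⟨⟨x, a⟩, c⟩ := q
    refine Prod.ext (Prod.ext hx ?_) hc
    have : (pt f).1 = (x, (pt f).1.2) := Prod.ext hx.symm rfl
    rw [this] at hlink
    exact Network.eq_of_link_eq hloop hlink
  · intro f hf q hqI hlab hne
    obtain ⟨h1, h2, h3⟩ := hpt f hf
    obtain ⟨hx, hc⟩ := eq_of_pointLabel_eq h2 hlab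
    obtain ⟨⟨x, a'⟩, c⟩ := q
    obtain ⟨⟨⟨y, a⟩, c'⟩, hpf⟩ : ∃ q, pt f = q := ⟨_, rfl⟩
    rw [hpf] at h1 h2 h3 hx hc
    obtain rfl : x = y := hx
    obtain rfl : c = c' := hc
    have haa : a ≠ a' := by
      rintro rfl
      exact hne h1
    rcases h3 with ⟨hp, haH, b, hbH, hlt⟩ | ⟨hnp, hx, hleg'⟩
    · simp only at haH hbH hlt
      have hab : a ≠ b := by
        rintro rfl
        have h1' : 𝒢.face ((x, a), c) = f := h1
        rw [h1'] at hlt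
        exact lt_irrefl _ hlt
      by_cases ha' : (x, a') ∈ H
      · obtain rfl := hH.eq_of_mem haH hbH ha' hab haa
        have : onPath (𝒢.face ((x, b), c)) := (onPath_iff _ _).2 hbH
        change ht (𝒢.face ((x, b), c)) < ht f
        simp only [ht, if_pos hp, if_pos this]
        omega
      · have : ¬ onPath (𝒢.face ((x, a'), c)) := fun h => ha' ((onPath_iff _ _).1 h)
        change ht (𝒢.face ((x, a'), c)) < ht f
        simp only [ht, if_pos hp, if_neg this]
        omega
    · simp only at hx hleg'
      have hnp' : ¬ onPath (𝒢.face ((x, a'), c)) := fun h => hx _ ((onPath_iff _ _).1 h)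
      obtain ⟨g1, g2, g3⟩ := hpt _ hqI
      rcases g3 with ⟨h, _⟩ | ⟨_, hy, hylink⟩
      · exact absurd h hnp'
      have hlink := link_eq_of_face_eq g1
      change ht (𝒢.face ((x, a'), c)) < ht f
      simp only [ht, if_neg hnp, if_neg hnp', hpf]
      change Γ.link (pt (𝒢.face ((x, a'), c))).1 = Γ.link (x, a') at hlink
      change (pt (𝒢.face ((x, a'), c))).1.2 = leg (pt (𝒢.face ((x, a'), c))).1.1 at hylink
      change ∀ a, ((pt (𝒢.face ((x, a'), c))).1.1, a) ∉ H at hy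
      generalize pt (𝒢.face ((x, a'), c)) = q at hlink hylink hy ⊢
      obtain ⟨⟨y, b⟩, c'⟩ := q
      simp only at hlink hylink hy ⊢
      subst hylink
      have hne' : (y, leg y) ≠ (x, a') := by
        intro h
        obtain ⟨rfl, h'⟩ := Prod.mk.inj h
        exact haa (hleg'.trans h')
      rcases Γ.link_eq_iff.1 hlink with h | h
      · exact absurd h hne'
      -- The other face lies on the forest link from `y` down to `x`, so `y` is deeper and its face
      -- is lower in height.
      · have hback : Γ.glue (y, leg y) = (x, a') := by rw [h, Γ.glue_glue]
        rcases (hleg y hy).2 with ho | hlt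
        · rw [hback] at ho
          exact absurd ho.symm hne'
        · rw [hback] at hlt
          have := hM y
          simp only at hlt
          omega
  · intro f hf
    rw [Finset.mem_filter, not_and] at hf
    have := hf (Finset.mem_univ _)
    push Not at this
    by_cases hr : f ∈ roots
    · exact Or.inl hr
    · refine Or.inr ⟨fun l hl h => hr (this.2 ⟨l, hl, h⟩), fun x hx h => this.1 ⟨x, hx, h⟩⟩

/-- Paths and forest cover `|V| + |τ|` links and leave at most `|τ|` faces there. They avoid the
link of `l₀`, so a mismatch on this link lowers the count of the remaining faces. -/
lemma exists_eliminable_card_le [Fintype V] (hN : 0 < N) (hbdry : Nonempty Γ.OpenLeg)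
    (htree : ¬ Γ.CoarseGrainable) {τ : Set Γ.Link} (hτ : Γ.IsMinCut R τ)
    (huniq : ∀ τ', Γ.IsMinCut R τ' → τ' = τ) {l₀ : V × Fin 3} (hl₀ : Γ.link l₀ ∉ τ) :
    ∃ (I : Finset (𝒬.diagram Γ R).Face) (pt : (𝒬.diagram Γ R).Face → Network.Point V N)
      (ht : (𝒬.diagram Γ R).Face → ℕ), (𝒬.diagram Γ R).Eliminable I pt 𝒬.pointLabel ht ∧
      (Iᶜ.card : ℤ) ≤ N * ((Nat.card Γ.Link : ℤ) - Nat.card V) - (N - 1) * τ.ncard -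
        if 𝒬.pairing l₀ = 𝒬.farPairing Γ R l₀ then 0 else 1 := by
  have hloop : ∀ l, Γ.glue l ≠ l → (Γ.glue l).1 ≠ l.1 := fun l =>
    Network.glue_fst_ne hbdry htree
  -- Omitting the link of `l₀` costs no capacity: a cut that fell below `|τ|` would be minimal,
  -- hence equal to `τ`, which does not contain this link.
  obtain ⟨H, hH⟩ := Network.exists_pathSystem (R := R) (Γ.link l₀) τ.ncard (by
    intro X
    have hle := hτ.2 _ (Γ.separates_cut X R)
    by_cases hmem : Γ.link l₀ ∈ Γ.cut X R
    · have h1 := Set.ncard_sdiff_singleton_add_one hmem (Set.toFinite _)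
      by_contra hlt
      have hmin : Γ.IsMinCut R (Γ.cut X R) :=
        ⟨Γ.separates_cut X R, fun τ' h' => le_trans (by omega) (hτ.2 τ' h')⟩
      exact hl₀ (huniq _ hmin ▸ hmem)
    · rwa [Set.sdiff_singleton_eq_self hmem])
  obtain ⟨d, leg, hleg⟩ := Network.exists_forest (Γ.link l₀) H (fun S hS => by
    obtain ⟨l, h1, h2, _, h4⟩ :=
      Network.exists_leaving_link_notMem hbdry htree hτ huniq hS (Γ.link l₀)
    exact ⟨l, h1, h2, h4⟩)
  obtain ⟨I, pt, ht, hI, J, hJ, hIJ⟩ := exists_eliminable (𝒬 := 𝒬) hN hloop hH hleg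
  refine ⟨I, pt, ht, hI, ?_⟩
  let T : Set Γ.Link := (fun x => Γ.link (x, leg x)) '' {x | ∃ a, (x, a) ∈ H}ᶜ
  have hoff : ∀ x, x ∈ {x | ∃ a, (x, a) ∈ H}ᶜ ↔ ∀ a, (x, a) ∉ H := fun x => by
    rw [Set.mem_compl_iff]
    exact not_exists
  -- Two vertices with the same forest link would each be deeper than the other.
  have hTinj : Set.InjOn (fun x => Γ.link (x, leg x)) {x | ∃ a, (x, a) ∈ H}ᶜ := by
    intro x hx y hy hxy
    rw [hoff] at hx hy
    rcases Γ.link_eq_iff.1 hxy with h | h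
    · exact (Prod.mk.inj h).1
    · have h' : Γ.glue (x, leg x) = (y, leg y) := by rw [h, Γ.glue_glue]
      rcases (hleg x hx).2 with h1 | h1
      · rw [h'] at h1
        exact (Prod.mk.inj h1).1.symm
      · rcases (hleg y hy).2 with h2 | h2
        · rw [← h] at h2
          exact (Prod.mk.inj h2).1
        · rw [h'] at h1
          rw [← h] at h2
          simp only at h1 h2
          omega
  have hTH : Disjoint (Γ.link '' H) T := by
    rw [Set.disjoint_left]
    rintro _ ⟨l, hl, rfl⟩ ⟨x, hx, hxl⟩
    rw [hoff] at hx
    exact hx _ (hH.mem_of_link_eq hl hxl)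
  have hU : (Γ.link '' H ∪ T).ncard = Nat.card V + τ.ncard := by
    rw [Set.ncard_union_eq hTH (Set.toFinite _) (Set.toFinite _), hH.ncard_links,
      hTinj.ncard_image]
    have := Set.ncard_add_ncard_compl {x | ∃ a, (x, a) ∈ H} (Set.toFinite _) (Set.toFinite _)
    omega
  let U : Finset Γ.Link := (Γ.link '' H ∪ T).toFinset
  have hUcard : U.card = Nat.card V + τ.ncard := by
    rw [← hU, Set.ncard_eq_toFinset_card']
  have hUc : (Uᶜ.card : ℤ) = Nat.card Γ.Link - (Nat.card V + τ.ncard) := by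
    have := Finset.card_add_card_compl U
    rw [Nat.card_eq_fintype_card (α := Γ.Link), ← this, hUcard]
    push_cast
    ring
  have hl₀U : Γ.link l₀ ∈ Uᶜ := by
    rw [Finset.mem_compl, Set.mem_toFinset]
    rintro (⟨l, hl, h⟩ | ⟨x, hx, h⟩)
    · exact hH.avoid l hl h
    · exact (hleg x ((hoff x).1 hx)).1 h
  let w : Γ.Link → ℕ := fun e => (Finset.univ.filter fun f => 𝒬.faceLink Γ R f = e).card
  have hw : ∀ e, w e ≤ N := fun e => card_faces_le e
  have hI1 : Iᶜ.card ≤ τ.ncard + ∑ e ∈ Uᶜ, w e := by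
    have hsub : Iᶜ ⊆ J ∪ Finset.univ.filter fun f => 𝒬.faceLink Γ R f ∈ Uᶜ := by
      intro f hf
      rw [Finset.mem_compl] at hf
      rw [Finset.mem_union, Finset.mem_filter]
      rcases hIJ f hf with h | ⟨h1, h2⟩
      · exact Or.inl h
      · refine Or.inr ⟨Finset.mem_univ _, ?_⟩
        rw [Finset.mem_compl, Set.mem_toFinset]
        rintro (⟨l, hl, h⟩ | ⟨x, hx, h⟩)
        · exact h1 l hl h.symm
        · exact h2 x ((hoff x).1 hx) h.symm
    refine (Finset.card_le_card hsub).trans ((Finset.card_union_le _ _).trans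
      (add_le_add hJ (le_of_eq ?_)))
    rw [Finset.card_eq_sum_card_fiberwise
      (s := Finset.univ.filter fun f => 𝒬.faceLink Γ R f ∈ Uᶜ) (f := 𝒬.faceLink Γ R) (t := Uᶜ)
      (fun f hf => Finset.mem_coe.2 (Finset.mem_filter.1 (Finset.mem_coe.1 hf)).2)]
    refine Finset.sum_congr rfl fun e he => ?_
    congr 1
    ext f
    simp only [Finset.mem_filter, Finset.mem_univ, true_and]
    exact ⟨fun h => h.2, fun h => ⟨h ▸ he, h⟩⟩
  -- No link has a negative deficit relative to `N` faces, so the deficit at the link of `l₀` bounds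
  -- the total one from below.
  have hI2 : (if 𝒬.pairing l₀ = 𝒬.farPairing Γ R l₀ then 0 else 1 : ℤ) ≤
      ∑ e ∈ Uᶜ, ((N : ℤ) - w e) := by
    refine le_trans ?_ (Finset.single_le_sum (f := fun e => (N : ℤ) - w e)
      (fun e _ => sub_nonneg.2 (by exact_mod_cast hw e)) hl₀U)
    have h1 := hw (Γ.link l₀)
    split_ifs with h
    · exact sub_nonneg.2 (by exact_mod_cast h1)
    · have h2 : w (Γ.link l₀) < N := card_faces_lt h
      omega
  rw [Finset.sum_sub_distrib, Finset.sum_const, nsmul_eq_mul, hUc] at hI2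
  have hI3 : (Iᶜ.card : ℤ) ≤ τ.ncard + ∑ e ∈ Uᶜ, (w e : ℤ) := by exact_mod_cast hI1
  linarith

end Propagation

/-! ### Free diagrams and diagrams with a single interaction -/

variable {V : Type*} {N : ℕ}

/-- The local processes of a free diagram. -/
def freePropagation (π : V → Equiv.Perm (Fin N)) : Propagation V N (V × Fin N) where
  pairing l := freeStrand (π l.1)
  pairing_invol l := freeStrand_invol _
  pairing_ne l := freeStrand_ne _
  label x := Sum.elim (fun k => some (x, k)) fun _ => none
  label_inj := by
    rintro x (k | k) x' (k' | k') i h h'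
    · simp only [Sum.elim_inl, Option.some.injEq] at h h'
      obtain ⟨h1, h2⟩ := Prod.mk.inj (h.trans h'.symm)
      exact ⟨h1, by rw [h2]⟩
    all_goals simp at h h'
  pairing_of_none _ _ _ := rfl
  label_pairing := by
    rintro x (k | k) h a
    · simp at h
    · simp [freeStrand]

lemma freeDiagram_eq (Γ : Network V) (R : Set Γ.OpenLeg) (π : V → Equiv.Perm (Fin N)) :
    Γ.freeDiagram R π = (freePropagation π).diagram Γ R := by
  unfold Network.freeDiagram Propagation.diagram freePropagation
  congr 1
  funext p
  rcases p with ⟨l, k | k⟩ <;> rfl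

lemma intStrand_ne (ρ : Equiv.Perm (Fin N)) {i j : Fin N} (hij : i ≠ j) (a : Fin 3)
    (c : Copies N) : intStrand ρ i j a c ≠ c := by
  fin_cases a
  · exact freeStrand_ne _ _
  · exact freeStrand_ne _ _
  · rcases c with k | k
    · change (if k = i then Sum.inl j else if k = j then Sum.inl i else Sum.inr (ρ k) : Copies N)
        ≠ Sum.inl k
      split_ifs with h1 h2
      · rw [h1]; simpa using hij.symm
      · rw [h2]; simpa using hij
      · simp
    · change (if k = ρ i then Sum.inr (ρ j) else if k = ρ j then Sum.inr (ρ i)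
        else Sum.inl (ρ.symm k) : Copies N) ≠ Sum.inr k
      split_ifs with h1 h2
      · rw [h1]; simpa using hij.symm
      · rw [h2]; simpa using hij
      · simp

/-- An outgoing copy that does not take part in the interaction has the same partner on all legs,
which allows it to have no gauge parameter. -/
lemma intStrand_of_ne (ρ : Equiv.Perm (Fin N)) {i j k : Fin N} (hi : k ≠ ρ i) (hj : k ≠ ρ j)
    (a : Fin 3) : intStrand ρ i j a (Sum.inr k) = Sum.inl (ρ.symm k) := by
  have hi' : ρ.symm k ≠ i := fun h => hi (by rw [← h]; simp)
  have hj' : ρ.symm k ≠ j := fun h => hj (by rw [← h]; simp)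
  fin_cases a
  · rfl
  · change (Sum.inl ((ρ * Equiv.swap i j).symm k) : Copies N) = _
    congr 1
    rw [Equiv.symm_apply_eq, Equiv.Perm.mul_apply, Equiv.swap_apply_of_ne_of_ne hi' hj']
    simp
  · simp [intStrand, hi, hj]

/-- The local processes of a diagram with a single interaction. -/
def interactionPropagation (I : Interaction V N) : Propagation V N ((V × Fin N) ⊕ Fin 2) where
  pairing l := if l.1 = I.node then intStrand (I.perm l.1) I.fst I.snd l.2
    else freeStrand (I.perm l.1)
  pairing_invol l := by
    split_ifs
    · exact intStrand_invol _ _ _ _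
    · exact freeStrand_invol _
  pairing_ne l c := by
    split_ifs
    · exact intStrand_ne _ I.fst_ne_snd _ _
    · exact freeStrand_ne _ _
  label x := Sum.elim (fun k => some (Sum.inl (x, k))) fun k =>
    if x = I.node ∧ k = I.perm x I.fst then some (Sum.inr 0)
    else if x = I.node ∧ k = I.perm x I.snd then some (Sum.inr 1) else none
  label_inj := by
    have hfs := I.fst_ne_snd
    rintro x (k | k) x' (k' | k') i h h'
    · simp only [Sum.elim_inl, Option.some.injEq] at h h'
      obtain ⟨h1, h2⟩ := Prod.mk.inj (Sum.inl.inj (h.trans h'.symm))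
      exact ⟨h1, by rw [h2]⟩
    · exfalso
      simp only [Sum.elim_inl, Sum.elim_inr, Option.some.injEq] at h h'
      split_ifs at h' <;> simp [← h] at h'
    · exfalso
      simp only [Sum.elim_inl, Sum.elim_inr, Option.some.injEq] at h h'
      split_ifs at h <;> simp [← h'] at h
    · simp only [Sum.elim_inr] at h h'
      split_ifs at h with h1 h2 <;> split_ifs at h' with h3 h4 <;>
        simp only [Option.some.injEq] at h h'
      · exact ⟨h1.1.trans h3.1.symm, by rw [h1.2, h3.2, h1.1, h3.1]⟩
      · simp [← h] at h'
      · simp [← h] at h'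
      · exact ⟨h2.1.trans h4.1.symm, by rw [h2.2, h4.2, h2.1, h4.1]⟩
  pairing_of_none := by
    rintro x (k | k) h a b
    · simp at h
    · simp only [Sum.elim_inr] at h
      split_ifs at h with h1 h2
      by_cases hx : x = I.node
      · rw [if_pos hx, if_pos hx, intStrand_of_ne, intStrand_of_ne] <;> tauto
      · rw [if_neg hx, if_neg hx]
  label_pairing := by
    rintro x (k | k) h a
    · simp at h
    · simp only [Sum.elim_inr] at h
      split_ifs at h with h1 h2
      by_cases hx : x = I.node
      · rw [if_pos hx, intStrand_of_ne _ (fun e => h1 ⟨hx, e⟩) (fun e => h2 ⟨hx, e⟩)]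
        simp
      · rw [if_neg hx]
        simp [freeStrand]

lemma interactionDiagram_eq (Γ : Network V) (R : Set Γ.OpenLeg) (I : Interaction V N) :
    Γ.interactionDiagram R I = (interactionPropagation I).diagram Γ R := by
  unfold Network.interactionDiagram Propagation.diagram interactionPropagation
  congr 1
  · funext p
    by_cases h : p.1.1 = I.node <;> simp [h]
  · funext p
    rcases p with ⟨l, k | k⟩
    · rfl
    · simp only [Sum.elim_inr]
      split_ifs <;> rfl

/-! ### Mismatches outside of the minimal cut -/

namespace Network

variable {Γ : Network V} {R : Set Γ.OpenLeg} {τ : Set Γ.Link}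

lemma IsMinCut.mem_iff [Finite V] (hτ : Γ.IsMinCut R τ) {l : V × Fin 3} (hl : Γ.link l ∉ τ) :
    l.1 ∈ Γ.wallSide R τ ↔ Γ.farEnd l ∈ Γ.region (Γ.wallSide R τ) R := by
  rw [← hτ.cut_eq, link_mem_cut] at hl
  exact not_not.1 hl

lemma wallPattern_eq (x : V) :
    Γ.wallPattern N R τ x = if x ∈ Γ.wallSide R τ then finRotate N else 1 := rfl

lemma boundaryPerm_eq_wallPattern [Finite V] (hτ : Γ.IsMinCut R τ) {l : V × Fin 3}
    (ho : Γ.glue l = l) (hl : Γ.link l ∉ τ) {x : V}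
    (hx : x ∈ Γ.wallSide R τ ↔ l.1 ∈ Γ.wallSide R τ) :
    Γ.boundaryPerm N R (Γ.openLeg l ho) = Γ.wallPattern N R τ x := by
  have h := hτ.mem_iff hl
  rw [Γ.farEnd_of_open ho, inr_mem_region] at h
  rw [wallPattern_eq, boundaryPerm]
  by_cases hR : Γ.openLeg l ho ∈ R
  · rw [if_pos hR, if_pos (hx.2 (h.2 hR))]
  · rw [if_neg hR, if_neg fun h' => hR (h.1 (hx.1 h'))]

/-- The wall pattern jumps only across the cut of its wall side, which is `τ` itself by minimality.
-/
lemma wall_farPairing [Finite V] (hτ : Γ.IsMinCut R τ) {l : V × Fin 3} (hl : Γ.link l ∉ τ) :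
    (freePropagation (Γ.wallPattern N R τ)).farPairing Γ R l =
      freeStrand (Γ.wallPattern N R τ l.1) := by
  by_cases ho : Γ.glue l = l
  · rw [Propagation.farPairing, dif_pos ho, boundaryPerm_eq_wallPattern hτ ho hl Iff.rfl]
  · rw [Propagation.farPairing, dif_neg ho]
    have h := hτ.mem_iff hl
    rw [Γ.farEnd_of_ne ho, inl_mem_region] at h
    change freeStrand (Γ.wallPattern N R τ (Γ.glue l).1) = _
    rw [wallPattern_eq, wallPattern_eq]
    simp only [h]

/-- A free pattern other than the one of the minimal cut jumps on a link outside of the cut. -/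
lemma exists_mismatch_free [Finite V] (hbdry : Nonempty Γ.OpenLeg)
    (htree : ¬ Γ.CoarseGrainable) (hτ : Γ.IsMinCut R τ)
    (huniq : ∀ τ', Γ.IsMinCut R τ' → τ' = τ) {π : V → Equiv.Perm (Fin N)}
    (hπ : π ≠ Γ.wallPattern N R τ) :
    ∃ l, Γ.link l ∉ τ ∧ (freePropagation π).pairing l ≠ (freePropagation π).farPairing Γ R l := by
  by_contra hcon
  push Not at hcon
  obtain ⟨x, hx⟩ := Function.ne_iff.1 hπ
  -- Without jumps outside of `τ`, a link leaving `S` outside of `τ` either ends in `S` or forces `π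
  -- x` to be the boundary value, that is, the wall pattern.
  let S : Set V := {y | (y ∈ Γ.wallSide R τ ↔ x ∈ Γ.wallSide R τ) ∧ π y = π x}
  obtain ⟨l, ⟨hl1, hl2⟩, hfar, hlτ, -⟩ := exists_leaving_link_notMem hbdry htree hτ huniq
    (S := S) ⟨x, Iff.rfl, rfl⟩ (Γ.link (x, 0))
  have hpair := hcon l hlτ
  change freeStrand (π l.1) = _ at hpair
  by_cases ho : Γ.glue l = l
  · rw [Propagation.farPairing, dif_pos ho, boundaryPerm_eq_wallPattern hτ ho hlτ hl1.symm] at hpair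
    exact hx (hl2.symm.trans (freeStrand_injective hpair))
  · rw [Propagation.farPairing, dif_neg ho] at hpair
    have h := hτ.mem_iff hlτ
    rw [Γ.farEnd_of_ne ho, inl_mem_region] at h hfar
    exact hfar ⟨h.symm.trans hl1, (freeStrand_injective hpair).symm.trans hl2⟩

/-- In a diagram with an interaction, the strands jump on a link outside of the cut. -/
lemma exists_mismatch_interaction [Finite V] (hbdry : Nonempty Γ.OpenLeg)
    (htree : ¬ Γ.CoarseGrainable) (hτ : Γ.IsMinCut R τ)
    (huniq : ∀ τ', Γ.IsMinCut R τ' → τ' = τ) (I : Interaction V N) :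
    ∃ l, Γ.link l ∉ τ ∧
      (interactionPropagation I).pairing l ≠ (interactionPropagation I).farPairing Γ R l := by
  by_contra hcon
  push Not at hcon
  have hpv : ∀ a, (interactionPropagation I).pairing (I.node, a) =
      intStrand (I.perm I.node) I.fst I.snd a := fun a => if_pos rfl
  have hpx : ∀ l : V × Fin 3, l.1 ≠ I.node →
      (interactionPropagation I).pairing l = freeStrand (I.perm l.1) := fun l hl => if_neg hl
  have hloop : ∀ l, Γ.glue l ≠ l → (Γ.glue l).1 ≠ l.1 := fun l => glue_fst_ne hbdry htree
  -- On the third leg the interaction joins two incoming copies, which no free process and no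
  -- boundary does. The mismatch can only be hidden in `τ`.
  have hthird : Γ.link (I.node, 2) ∈ τ := by
    by_contra hn
    have h := congrFun ((hpv 2).symm.trans (hcon _ hn)) (Sum.inl I.fst)
    have hl : intStrand (I.perm I.node) I.fst I.snd 2 (Sum.inl I.fst) = Sum.inl I.snd := by
      simp [intStrand]
    rw [hl] at h
    by_cases ho : Γ.glue (I.node, 2) = (I.node, 2)
    · rw [Propagation.farPairing, dif_pos ho] at h
      simp [freeStrand] at h
    · rw [Propagation.farPairing, dif_neg ho, hpx _ (hloop _ ho)] at h
      simp [freeStrand] at h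
  have hleave : ∀ a : Fin 3, ∃ b, b ≠ a ∧ b ≠ 2 ∧ Γ.link (I.node, b) ∉ τ := by
    intro a
    obtain ⟨⟨y, b⟩, hy, -, hτ', hne⟩ := exists_leaving_link_notMem hbdry htree hτ huniq
      (Set.singleton_nonempty I.node) (Γ.link (I.node, a))
    obtain rfl : y = I.node := hy
    refine ⟨b, ?_, ?_, hτ'⟩
    · rintro rfl; exact hne rfl
    · rintro rfl; exact hτ' hthird
  -- The interaction vertex has two leaving links outside of `τ`, which must be those of the other
  -- two legs.
  have h01 : ∀ a : Fin 3, a ≠ 2 → Γ.link (I.node, a) ∉ τ := by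
    intro a ha
    have hfin : ∀ a : Fin 3, a ≠ 2 → ∃ c, ∀ b : Fin 3, b ≠ c → b ≠ 2 → b = a := by decide
    obtain ⟨c, hc⟩ := hfin a ha
    obtain ⟨b, h1, h2, h3⟩ := hleave c
    rwa [hc b h1 h2] at h3
  obtain ⟨ρ, hρ, hρ01⟩ : ∃ ρ : Fin 3 → Equiv.Perm (Fin N),
      (∀ a, a ≠ 2 → (interactionPropagation I).pairing (I.node, a) = freeStrand (ρ a)) ∧
      ρ 0 ≠ ρ 1 := by
    refine ⟨![I.perm I.node, I.perm I.node * Equiv.swap I.fst I.snd, 1], ?_, ?_⟩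
    · intro a ha
      rw [hpv]
      fin_cases a
      · rfl
      · rfl
      · exact absurd rfl ha
    · intro h
      have h1 : Equiv.swap I.fst I.snd = 1 := by
        have h2 : I.perm I.node = I.perm I.node * Equiv.swap I.fst I.snd := h
        exact mul_eq_left.1 h2.symm
      exact I.fst_ne_snd (Equiv.swap_eq_one_iff.1 h1)
  -- The permutations on these two legs differ by a transposition, so at least one of them is not
  -- that of the wall pattern.
  obtain ⟨a, ha2, haW, haρ⟩ : ∃ a : Fin 3, a ≠ 2 ∧ ρ a ≠ Γ.wallPattern N R τ I.node ∧
      ∀ b, b ≠ 2 → b ≠ a → ρ b ≠ ρ a := by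
    by_cases h0 : ρ 0 = Γ.wallPattern N R τ I.node
    · refine ⟨1, by decide, fun h1 => hρ01 (h0.trans h1.symm), fun b hb hb' => ?_⟩
      fin_cases b
      · exact hρ01
      · exact absurd rfl hb'
      · exact absurd rfl hb
    · refine ⟨0, by decide, h0, fun b hb hb' => ?_⟩
      fin_cases b
      · exact absurd rfl hb'
      · exact hρ01.symm
      · exact absurd rfl hb
  -- The wrong permutation spreads from the leg `a` over `S`. A second link leaving `S` outside of
  -- `τ` would carry it to the boundary or to the other leg of the interaction vertex, and it fits
  -- neither.
  let S : Set V := {y | y ≠ I.node ∧ (y ∈ Γ.wallSide R τ ↔ I.node ∈ Γ.wallSide R τ) ∧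
    I.perm y = ρ a}
  have hS : S.Nonempty := by
    have hpair := (hρ a ha2).symm.trans (hcon _ (h01 a ha2))
    by_cases ho : Γ.glue (I.node, a) = (I.node, a)
    · rw [Propagation.farPairing, dif_pos ho,
        boundaryPerm_eq_wallPattern hτ ho (h01 a ha2) (x := I.node) Iff.rfl] at hpair
      exact absurd (freeStrand_injective hpair) haW
    · rw [Propagation.farPairing, dif_neg ho, hpx _ (hloop _ ho)] at hpair
      have h := hτ.mem_iff (h01 a ha2)
      rw [Γ.farEnd_of_ne ho, inl_mem_region] at h
      exact ⟨_, hloop _ ho, h.symm, (freeStrand_injective hpair).symm⟩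
  obtain ⟨l, ⟨hl0, hl1, hl2⟩, hfar, hlτ, hlne⟩ := exists_leaving_link_notMem hbdry htree hτ huniq
    hS (Γ.link (I.node, a))
  have hpair := hcon l hlτ
  rw [hpx l hl0, hl2] at hpair
  by_cases ho : Γ.glue l = l
  · rw [Propagation.farPairing, dif_pos ho, boundaryPerm_eq_wallPattern hτ ho hlτ hl1.symm] at hpair
    exact haW (freeStrand_injective hpair)
  · rw [Propagation.farPairing, dif_neg ho] at hpair
    have h := hτ.mem_iff hlτ
    rw [Γ.farEnd_of_ne ho, inl_mem_region] at h hfar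
    by_cases hv : (Γ.glue l).1 = I.node
    · obtain ⟨b, hb⟩ : ∃ b, Γ.glue l = (I.node, b) := ⟨(Γ.glue l).2, Prod.ext hv rfl⟩
      have hlink : Γ.link (I.node, b) = Γ.link l := by rw [← hb, Γ.link_glue]
      have hb2 : b ≠ 2 := by rintro rfl; exact hlτ (hlink ▸ hthird)
      have hba : b ≠ a := by rintro rfl; exact hlne hlink.symm
      rw [hb, hρ b hb2] at hpair
      exact haρ b hb2 hba (freeStrand_injective hpair).symm
    · rw [hpx _ hv] at hpair
      exact hfar ⟨hv, h.symm.trans hl1, (freeStrand_injective hpair).symm⟩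

end Network

/-! ### Divergence degrees -/

namespace Network

/-- This makes `Z_0` an instance of the general argument, with an empty region and an empty wall. -/
lemma isMinCut_empty {V : Type*} [Finite V] (Γ : Network V) :
    Γ.IsMinCut ∅ ∅ ∧ ∀ τ, Γ.IsMinCut ∅ τ → τ = ∅ := by
  have h : Γ.Separates ∅ ∅ := fun a ha => absurd ha (Set.notMem_empty a)
  refine ⟨⟨h, fun τ _ => by simp⟩, fun τ hτ => ?_⟩
  have := hτ.2 ∅ h
  rw [Set.ncard_empty] at this
  exact (Set.ncard_eq_zero (Set.toFinite _)).1 (Nat.le_zero.1 this)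

variable {V : Type*} [Fintype V] (Γ : Network V) (N : ℕ)

/-- The amplitude of the pattern with the domain wall `τ` is comparable to the power of `δ(e)` with
exponent `Γ.wallDegree N τ`, and all other amplitudes are positive and smaller by a power. -/
structure AmplitudeBounds (R : Set Γ.OpenLeg) (τ : Set Γ.Link) {G : Type*} [Group G]
    [MeasurableSpace G] (μ : Measure G) (δ : G → ℝ) (κ : ℝ) : Prop where
  le_wall : κ * δ 1 ^ (Γ.wallDegree N τ) ≤
    (Γ.freeDiagram R (Γ.wallPattern N R τ)).amplitude μ δ
  wall_le : (Γ.freeDiagram R (Γ.wallPattern N R τ)).amplitude μ δ ≤ δ 1 ^ (Γ.wallDegree N τ)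
  free_pos : ∀ π : V → Equiv.Perm (Fin N), 0 < (Γ.freeDiagram R π).amplitude μ δ
  free_le : ∀ π : V → Equiv.Perm (Fin N), π ≠ Γ.wallPattern N R τ →
    (Γ.freeDiagram R π).amplitude μ δ ≤ δ 1 ^ (Γ.wallDegree N τ - 1)
  int_pos : ∀ I : Interaction V N, 0 < (Γ.interactionDiagram R I).amplitude μ δ
  int_le : ∀ I : Interaction V N,
    (Γ.interactionDiagram R I).amplitude μ δ ≤ δ 1 ^ (Γ.wallDegree N τ - 1)

/-- The number of diagrams, weighted with the coupling. -/
def diagramCount (coupling : ℝ) : ℝ :=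
  Fintype.card (V → Equiv.Perm (Fin N)) + |coupling| * Fintype.card (Interaction V N)

variable {Γ N} {R : Set Γ.OpenLeg} {τ : Set Γ.Link} {G : Type*} [Group G] [MeasurableSpace G]
  {μ : Measure G} {δ : G → ℝ} {κ : ℝ}

lemma AmplitudeBounds.abs_sub_le (h : Γ.AmplitudeBounds N R τ μ δ κ) (hδ : 0 ≤ δ 1)
    (coupling : ℝ) :
    |Γ.partitionFunction N R coupling μ δ -
      (Γ.freeDiagram R (Γ.wallPattern N R τ)).amplitude μ δ| ≤
      diagramCount (V := V) N coupling * δ 1 ^ (Γ.wallDegree N τ - 1) := by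
  have hp : 0 ≤ δ 1 ^ (Γ.wallDegree N τ - 1) := Real.rpow_nonneg hδ _
  have h1 : |∑ π ∈ Finset.univ.erase (Γ.wallPattern N R τ), (Γ.freeDiagram R π).amplitude μ δ| ≤
      Fintype.card (V → Equiv.Perm (Fin N)) * δ 1 ^ (Γ.wallDegree N τ - 1) := by
    rw [abs_of_nonneg (Finset.sum_nonneg fun π _ => (h.free_pos π).le)]
    refine (Finset.sum_le_card_nsmul _ _ _ fun π hπ =>
      h.free_le π (Finset.ne_of_mem_erase hπ)).trans ?_
    rw [nsmul_eq_mul]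
    gcongr
    exact Finset.card_le_univ _
  have h2 : |coupling * ∑ I : Interaction V N, (Γ.interactionDiagram R I).amplitude μ δ| ≤
      |coupling| * (Fintype.card (Interaction V N) * δ 1 ^ (Γ.wallDegree N τ - 1)) := by
    rw [abs_mul, abs_of_nonneg (Finset.sum_nonneg fun I _ => (h.int_pos I).le)]
    refine mul_le_mul_of_nonneg_left ?_ (abs_nonneg _)
    refine (Finset.sum_le_card_nsmul _ _ _ fun I _ => h.int_le I).trans ?_
    rw [nsmul_eq_mul, Finset.card_univ]
  rw [partitionFunction, ← Finset.add_sum_erase _ _ (Finset.mem_univ (Γ.wallPattern N R τ))]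
  calc _ = |∑ π ∈ Finset.univ.erase (Γ.wallPattern N R τ), (Γ.freeDiagram R π).amplitude μ δ -
        coupling * ∑ I : Interaction V N, (Γ.interactionDiagram R I).amplitude μ δ| := by
        congr 1; ring
    _ ≤ _ := (abs_sub _ _).trans (add_le_add h1 h2)
    _ = _ := by unfold diagramCount; ring

lemma AmplitudeBounds.ratio_bounds (h : Γ.AmplitudeBounds N R τ μ δ κ) (hδ : 0 < δ 1)
    (coupling : ℝ) :
    κ - diagramCount (V := V) N coupling / δ 1 ≤
      Γ.partitionFunction N R coupling μ δ / δ 1 ^ (Γ.wallDegree N τ) ∧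
    Γ.partitionFunction N R coupling μ δ / δ 1 ^ (Γ.wallDegree N τ) ≤
      1 + diagramCount (V := V) N coupling / δ 1 := by
  have hp : 0 < δ 1 ^ (Γ.wallDegree N τ) := Real.rpow_pos_of_pos hδ _
  have h1 := abs_le.1 (h.abs_sub_le hδ.le coupling)
  rw [Real.rpow_sub_one hδ.ne'] at h1
  have h2 := h.le_wall
  have h3 := h.wall_le
  have h4 : diagramCount (V := V) N coupling * (δ 1 ^ (Γ.wallDegree N τ) / δ 1) =
      diagramCount (V := V) N coupling / δ 1 * δ 1 ^ (Γ.wallDegree N τ) := by ring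
  rw [h4] at h1
  rw [le_div_iff₀ hp, div_le_iff₀ hp]
  constructor <;> nlinarith [h1.1, h1.2]

/-- The two wall degrees differ by `(1 - N) |σ|`, which yields the main term. The prefactor `1 / (1
- N)` has absolute value at most `1`. -/
lemma renyiEntropy_sub_eq (hN : 2 ≤ N) (hδ : 0 < δ 1) (coupling : ℝ) {A : Set Γ.OpenLeg}
    {σ : Set Γ.Link}
    (h0 : 0 < Γ.partitionFunction N ∅ coupling μ δ / δ 1 ^ (Γ.wallDegree N ∅))
    (hA : 0 < Γ.partitionFunction N A coupling μ δ / δ 1 ^ (Γ.wallDegree N σ)) :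
    |Γ.renyiEntropy N A coupling μ δ - (σ.ncard : ℝ) * Real.log (δ 1)| ≤
      |Real.log (Γ.partitionFunction N A coupling μ δ / δ 1 ^ (Γ.wallDegree N σ))| +
      |Real.log (Γ.partitionFunction N ∅ coupling μ δ / δ 1 ^ (Γ.wallDegree N ∅))| := by
  have hN' : (2 : ℝ) ≤ N := by exact_mod_cast hN
  have hp0 : 0 < δ 1 ^ (Γ.wallDegree N ∅) := Real.rpow_pos_of_pos hδ _
  have hpA : 0 < δ 1 ^ (Γ.wallDegree N σ) := Real.rpow_pos_of_pos hδ _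
  have hZ0 : 0 < Γ.partitionFunction N ∅ coupling μ δ := by
    have := mul_pos h0 hp0
    rwa [div_mul_cancel₀ _ hp0.ne'] at this
  have hZA : 0 < Γ.partitionFunction N A coupling μ δ := by
    have := mul_pos hA hpA
    rwa [div_mul_cancel₀ _ hpA.ne'] at this
  have hw : Γ.wallDegree N σ - Γ.wallDegree N ∅ = (1 - N) * (σ.ncard : ℝ) := by
    simp [wallDegree]
    ring
  have hne : (1 : ℝ) - N ≠ 0 := by linarith
  rw [renyiEntropy, Real.log_div hZA.ne' hZ0.ne', Real.log_div hZA.ne' hpA.ne',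
    Real.log_div hZ0.ne' hp0.ne', Real.log_rpow hδ, Real.log_rpow hδ]
  set a := Real.log (Γ.partitionFunction N A coupling μ δ)
  set b := Real.log (Γ.partitionFunction N ∅ coupling μ δ)
  have heq : 1 / (1 - (N : ℝ)) * (a - b) - (σ.ncard : ℝ) * Real.log (δ 1) =
      (1 / (1 - (N : ℝ))) * ((a - Γ.wallDegree N σ * Real.log (δ 1)) -
        (b - Γ.wallDegree N ∅ * Real.log (δ 1))) := by
    have : Γ.wallDegree N σ = Γ.wallDegree N ∅ + (1 - N) * (σ.ncard : ℝ) := by linarith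
    rw [this]
    field_simp
    ring
  rw [heq, abs_mul]
  refine (mul_le_of_le_one_left (abs_nonneg _) ?_).trans (abs_sub _ _)
  rw [abs_div, abs_one, div_le_one (abs_pos.2 hne), le_abs]
  right
  linarith

/-! ### Upper and lower bounds for all amplitudes -/

section Bounds

variable [MeasurableMul₂ G] [MeasurableInv G] [IsProbabilityMeasure μ] [μ.IsMulLeftInvariant]

lemma _root_.GFT.Propagation.amplitude_le {L : Type*} [Fintype L] {𝒬 : Propagation V N L}
    (hδ : IsDeltaFunction μ δ) (hδ1 : 1 ≤ δ 1)
    (hN : 0 < N) (hbdry : Nonempty Γ.OpenLeg)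
    (htree : ¬ Γ.CoarseGrainable) (hτ : Γ.IsMinCut R τ)
    (huniq : ∀ τ', Γ.IsMinCut R τ' → τ' = τ) {l₀ : V × Fin 3} (hl₀ : Γ.link l₀ ∉ τ) :
    (𝒬.diagram Γ R).amplitude μ δ ≤ δ 1 ^ (Γ.wallDegree N τ -
      if 𝒬.pairing l₀ = 𝒬.farPairing Γ R l₀ then 0 else 1) := by
  obtain ⟨I, pt, ht, hI, hcard⟩ :=
    Propagation.exists_eliminable_card_le (𝒬 := 𝒬) hN hbdry htree hτ huniq hl₀
  refine (StrandedDiagram.amplitude_le_pow hδ (fun p h => 𝒬.pairing_ne p.1 p.2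
    (congrArg Prod.snd h)) (fun p => Γ.contraction_ne p) (label := 𝒬.pointLabel)
    (fun q => rfl) I hI).trans ?_
  rw [← Real.rpow_natCast]
  refine Real.rpow_le_rpow_of_exponent_le hδ1 ?_
  have h2 : ((Iᶜ.card : ℤ) : ℝ) ≤ ((N * ((Nat.card Γ.Link : ℤ) - Nat.card V) -
      (N - 1) * τ.ncard - if 𝒬.pairing l₀ = 𝒬.farPairing Γ R l₀ then 0 else 1 : ℤ) : ℝ) :=
    Int.cast_le.2 hcard
  unfold wallDegree
  push_cast at h2
  exact h2

/-- A link outside of `τ` has equal pairings at both ends and hence `N` faces; a link of `τ` has at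
least one. For a lower bound of the amplitude no more is needed. -/
lemma card_faces_wall (hN : 0 < N) (hτ : Γ.IsMinCut R τ) :
    (N : ℝ) * Nat.card Γ.Link - (N - 1) * τ.ncard ≤
      Nat.card (Γ.freeDiagram R (Γ.wallPattern N R τ)).Face := by
  rw [freeDiagram_eq]
  set 𝒬 := freePropagation (Γ.wallPattern N R τ)
  have h1 : Nat.card (𝒬.diagram Γ R).Face =
      ∑ e : Γ.Link, (Finset.univ.filter fun f => 𝒬.faceLink Γ R f = e).card := by
    rw [Nat.card_eq_fintype_card, ← Finset.card_univ]
    exact Finset.card_eq_sum_card_fiberwise (fun f _ => Finset.mem_coe.2 (Finset.mem_univ _))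
  have h2 : ∀ e : Γ.Link, (N : ℝ) - (N - 1) * (if e ∈ τ then 1 else 0) ≤
      (Finset.univ.filter fun f => 𝒬.faceLink Γ R f = e).card := by
    intro e
    split_ifs with he
    · have : (1 : ℝ) ≤ (Finset.univ.filter fun f => 𝒬.faceLink Γ R f = e).card := by
        exact_mod_cast Propagation.one_le_card_faces hN e
      linarith
    · obtain ⟨l, rfl⟩ := Γ.exists_link e
      have : (N : ℝ) ≤ (Finset.univ.filter fun f => 𝒬.faceLink Γ R f = Γ.link l).card := by
        exact_mod_cast Propagation.le_card_faces (ρ := Γ.wallPattern N R τ l.1) rfl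
          (wall_farPairing hτ he)
      linarith
  rw [h1]
  push_cast
  refine le_trans (le_of_eq ?_) (Finset.sum_le_sum fun e _ => h2 e)
  rw [Finset.sum_sub_distrib, ← Finset.mul_sum, Finset.sum_const, Finset.card_univ,
    nsmul_eq_mul, Finset.sum_boole, Nat.card_eq_fintype_card, Set.ncard_eq_toFinset_card']
  have : (Finset.univ.filter fun e => e ∈ τ) = τ.toFinset := by ext; simp
  rw [this]
  ring

/-- The bounds for all amplitudes, given a neighbourhood `B` of the identity on which the
holonomies of the dominating pattern are small. -/
lemma amplitudeBounds (hδ : IsDeltaFunction μ δ) (hδ1 : 1 ≤ δ 1)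
    (hN : 0 < N) (hbdry : Nonempty Γ.OpenLeg)
    (htree : ¬ Γ.CoarseGrainable) (hτ : Γ.IsMinCut R τ)
    (huniq : ∀ τ', Γ.IsMinCut R τ' → τ' = τ) {B : Set G} (hB : MeasurableSet B) {c c' : ℝ}
    (hc : 0 < c) (hc' : 0 < c') (hBμ : c' / δ 1 ≤ μ.real B)
    (hfree : ∀ π : V → Equiv.Perm (Fin N), ∀ h : V × Fin N → G, (∀ l, h l ∈ B) →
      ∀ f, c * δ 1 ≤ δ ((Γ.freeDiagram R π).holonomy h f))
    (hinteraction : ∀ I : Interaction V N, ∀ h : (V × Fin N) ⊕ Fin 2 → G, (∀ l, h l ∈ B) →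
      ∀ f, c * δ 1 ≤ δ ((Γ.interactionDiagram R I).holonomy h f)) :
    Γ.AmplitudeBounds N R τ μ δ
      (c ^ Nat.card (Γ.freeDiagram R (Γ.wallPattern N R τ)).Face * c' ^ (Nat.card (V × Fin N)))
    := by
  have hδ0 : 0 < δ 1 := by linarith
  have hb : 0 < c * δ 1 := mul_pos hc hδ0
  have hBpos : 0 < μ.real B := lt_of_lt_of_le (div_pos hc' hδ0) hBμ
  have hpos : ∀ {n m : ℕ}, 0 < (c * δ 1) ^ n * μ.real B ^ m := fun {n m} =>
    mul_pos (pow_pos hb n) (pow_pos hBpos m)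
  refine ⟨?_, ?_, ?_, ?_, ?_, ?_⟩
  · refine le_trans ?_ ((Γ.freeDiagram R (Γ.wallPattern N R τ)).le_amplitude hδ hB hb.le
      (hfree _))
    set F := Nat.card (Γ.freeDiagram R (Γ.wallPattern N R τ)).Face with hF
    set n := Nat.card (V × Fin N) with hn
    -- Each face contributes one power of `δ(e)`, and each of the `N |V|` integrations takes one
    -- away.
    calc c ^ F * c' ^ n * δ 1 ^ (Γ.wallDegree N τ)
        ≤ c ^ F * c' ^ n * δ 1 ^ ((F : ℝ) - n) := by
          gcongr
          have h1 := card_faces_wall (R := R) hN hτ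
          rw [← hF] at h1
          have h2 : (n : ℝ) = N * Nat.card V := by
            rw [hn, Nat.card_prod, Nat.card_fin]; push_cast; ring
          rw [wallDegree, h2]
          linarith
      _ = (c * δ 1) ^ F * (c' / δ 1) ^ n := by
          rw [Real.rpow_sub hδ0, Real.rpow_natCast, Real.rpow_natCast, mul_pow, div_pow]
          ring
      _ ≤ (c * δ 1) ^ F * μ.real B ^ n := by gcongr
  -- Any leg outside of `τ` will do; a link from the set of all vertices to the boundary provides
  -- one, and the excluded link is arbitrary.
  · obtain ⟨w⟩ := id hbdry
    obtain ⟨l, -, -, hl, -⟩ := exists_leaving_link_notMem hbdry htree hτ huniq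
      (S := Set.univ) ⟨w.1.1, trivial⟩ (Γ.link w.1)
    have := Propagation.amplitude_le (𝒬 := freePropagation (Γ.wallPattern N R τ)) hδ hδ1 hN hbdry
      htree hτ huniq hl
    have he : (freePropagation (Γ.wallPattern N R τ)).pairing l =
        (freePropagation (Γ.wallPattern N R τ)).farPairing Γ R l := (wall_farPairing hτ hl).symm
    rwa [if_pos he, sub_zero, ← freeDiagram_eq] at this
  · exact fun π => hpos.trans_le ((Γ.freeDiagram R π).le_amplitude hδ hB hb.le (hfree π))
  · intro π hπ
    obtain ⟨l, hl, hne⟩ := exists_mismatch_free hbdry htree hτ huniq hπ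
    have := Propagation.amplitude_le (𝒬 := freePropagation π) hδ hδ1 hN hbdry htree hτ huniq hl
    rwa [if_neg hne, ← freeDiagram_eq] at this
  · exact fun I => hpos.trans_le
      ((Γ.interactionDiagram R I).le_amplitude hδ hB hb.le (hinteraction I))
  · intro I
    obtain ⟨l, hl, hne⟩ := exists_mismatch_interaction hbdry htree hτ huniq I
    have := Propagation.amplitude_le (𝒬 := interactionPropagation I) hδ hδ1 hN hbdry htree
      hτ huniq hl
    rwa [if_neg hne, ← interactionDiagram_eq] at this

end Bounds

end Network

/-! ### Finite groups -/

section FiniteGroup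

lemma uniformMeasure_eq_smul_count (G : Type*) [MeasurableSpace G] :
    uniformMeasure G = (Measure.count (Set.univ : Set G))⁻¹ • Measure.count := by
  rw [uniformMeasure, ProbabilityTheory.uniformOn, ProbabilityTheory.cond,
    Measure.restrict_univ]

lemma finiteDelta_one (G : Type*) [Group G] : finiteDelta G 1 = Nat.card G := if_pos rfl

variable (G : Type*) [Group G] [Finite G] [MeasurableSpace G] [MeasurableSingletonClass G]

instance : IsProbabilityMeasure (uniformMeasure G) :=
  inferInstanceAs (IsProbabilityMeasure (ProbabilityTheory.uniformOn Set.univ))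

instance : (uniformMeasure G).IsMulLeftInvariant := by
  rw [uniformMeasure_eq_smul_count]
  infer_instance

lemma uniformMeasure_real_singleton_one :
    (uniformMeasure G).real {1} = 1 / Nat.card G := by
  cases nonempty_fintype G
  rw [Measure.real, uniformMeasure, ProbabilityTheory.uniformOn_univ]
  simp

lemma isDeltaFunction_finiteDelta : IsDeltaFunction (uniformMeasure G) (finiteDelta G) where
  measurable := Measurable.of_discrete
  nonneg g := by unfold finiteDelta; positivity
  le_one g := by
    rw [finiteDelta_one, finiteDelta]
    split_ifs <;> simp
  central g k := by simp [finiteDelta, mul_inv_eq_one]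
  symm g := by simp [finiteDelta]
  integral_eq_one := by
    have h : finiteDelta G = Set.indicator {1} fun _ => (Nat.card G : ℝ) := by
      ext g
      simp [finiteDelta, Set.indicator_apply]
    have hD : (Nat.card G : ℝ) ≠ 0 := Nat.cast_ne_zero.2 Nat.card_pos.ne'
    rw [h, integral_indicator_const _ (measurableSet_singleton _),
      uniformMeasure_real_singleton_one, smul_eq_mul, one_div_mul_cancel hD]

end FiniteGroup

lemma StrandedDiagram.holonomy_of_forall_eq_one {P L : Type*} (𝒢 : StrandedDiagram P L)
    {G : Type*} [Group G] {h : L → G} (hh : ∀ l, h l = 1) (f : 𝒢.Face) :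
    𝒢.holonomy h f = 1 := by
  have : FreeGroup.lift h = 1 := by
    ext l
    simp [hh]
  rw [holonomy, this, MonoidHom.one_apply]

namespace Network

variable {V : Type*} [Fintype V] {Γ : Network V} {N : ℕ} {R : Set Γ.OpenLeg} {τ : Set Γ.Link}

/-- With `B = {1}` all holonomies are trivial and no constants are lost, so the degree of the wall
pattern is exact. -/
lemma amplitudeBounds_finiteDelta (hN : 0 < N) (hbdry : Nonempty Γ.OpenLeg)
    (htree : ¬ Γ.CoarseGrainable) (hτ : Γ.IsMinCut R τ)
    (huniq : ∀ τ', Γ.IsMinCut R τ' → τ' = τ) (G : Type*) [Group G] [Finite G]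
    [MeasurableSpace G] [MeasurableSingletonClass G] :
    Γ.AmplitudeBounds N R τ (uniformMeasure G) (finiteDelta G) 1 := by
  have h1 : (1 : ℝ) ≤ finiteDelta G 1 := by
    rw [finiteDelta_one]
    exact_mod_cast Nat.card_pos
  have h := amplitudeBounds (Γ := Γ) (N := N) (R := R) (τ := τ) (B := {(1 : G)}) (c := 1)
    (c' := 1) (isDeltaFunction_finiteDelta G) h1 hN hbdry htree hτ huniq
    (measurableSet_singleton _) one_pos one_pos
    (by rw [uniformMeasure_real_singleton_one, finiteDelta_one])
    (fun π h hh f => by rw [StrandedDiagram.holonomy_of_forall_eq_one _ hh, one_mul])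
    (fun I h hh f => by rw [StrandedDiagram.holonomy_of_forall_eq_one _ hh, one_mul])
  simpa using h

variable {G : Type*} [Group G] [MeasurableSpace G] {μ : Measure G} {δ : G → ℝ} {κ : ℝ}

lemma AmplitudeBounds.degree_free_le (h : Γ.AmplitudeBounds N R τ μ δ κ) (hδ : 1 < δ 1)
    {π : V → Equiv.Perm (Fin N)} (hπ : π ≠ Γ.wallPattern N R τ) :
    (Γ.freeDiagram R π).degree μ δ ≤ Γ.wallDegree N τ - 1 :=
  (Real.logb_le_iff_le_rpow hδ (h.free_pos π)).2 (h.free_le π hπ)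

lemma AmplitudeBounds.degree_interaction_le (h : Γ.AmplitudeBounds N R τ μ δ κ) (hδ : 1 < δ 1)
    (I : Interaction V N) : (Γ.interactionDiagram R I).degree μ δ ≤ Γ.wallDegree N τ - 1 :=
  (Real.logb_le_iff_le_rpow hδ (h.int_pos I)).2 (h.int_le I)

lemma AmplitudeBounds.degree_wall_le (h : Γ.AmplitudeBounds N R τ μ δ κ) (hδ : 1 < δ 1) :
    (Γ.freeDiagram R (Γ.wallPattern N R τ)).degree μ δ ≤ Γ.wallDegree N τ :=
  (Real.logb_le_iff_le_rpow hδ (h.free_pos _)).2 h.wall_le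

lemma AmplitudeBounds.le_degree_wall (h : Γ.AmplitudeBounds N R τ μ δ κ) (hδ : 1 < δ 1)
    (hκ : 0 < κ) : Real.logb (δ 1) κ + Γ.wallDegree N τ ≤
      (Γ.freeDiagram R (Γ.wallPattern N R τ)).degree μ δ := by
  have hδ0 : 0 < δ 1 := by linarith
  have hp : 0 < δ 1 ^ Γ.wallDegree N τ := Real.rpow_pos_of_pos hδ0 _
  have h1 := Real.logb_le_logb_of_le hδ (mul_pos hκ hp) h.le_wall
  rwa [Real.logb_mul hκ.ne' hp.ne', Real.logb_rpow hδ0 hδ.ne'] at h1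

/-- The partition function is positive once `δ(e)` is large, and comparable to the amplitude of
the dominating pattern. -/
lemma AmplitudeBounds.partitionFunction_pos (h : Γ.AmplitudeBounds N R τ μ δ κ) (hδ : 0 < δ 1)
    {coupling : ℝ} (hκ : diagramCount (V := V) N coupling / δ 1 < κ) :
    0 < Γ.partitionFunction N R coupling μ δ / δ 1 ^ (Γ.wallDegree N τ) ∧
      0 < Γ.partitionFunction N R coupling μ δ := by
  have hp : 0 < δ 1 ^ (Γ.wallDegree N τ) := Real.rpow_pos_of_pos hδ _
  have h1 : 0 < Γ.partitionFunction N R coupling μ δ / δ 1 ^ (Γ.wallDegree N τ) := by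
    linarith [(h.ratio_bounds hδ coupling).1]
  refine ⟨h1, ?_⟩
  have := mul_pos h1 hp
  rwa [div_mul_cancel₀ _ hp.ne'] at this

end Network

lemma abs_log_le_two_mul {x y : ℝ} (hx : x ≤ 1 / 2) (hl : 1 - x ≤ y) (hu : y ≤ 1 + x) :
    |Real.log y| ≤ 2 * x := by
  have hx0 : 0 ≤ x := by linarith
  have hy : 0 < y := by linarith
  rw [abs_le]
  constructor
  · have h1 := Real.one_sub_inv_le_log_of_pos hy
    -- `(1 - x) (1 + 2x) = 1 + x (1 - 2x) ≥ 1` for `0 ≤ x ≤ 1/2`.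
    have h2 : y⁻¹ ≤ 1 + 2 * x := by
      rw [inv_le_iff_one_le_mul₀ hy]
      nlinarith
    linarith
  · linarith [Real.log_le_sub_one_of_pos hy]

/-! ### Compact groups -/

section CompactGroup

lemma IsDeltaFunction.mul_measureReal_le_one {G : Type*} [Group G] [MeasurableSpace G]
    {μ : Measure G} [IsFiniteMeasure μ] {δ : G → ℝ}
    (hδ : IsDeltaFunction μ δ) {B : Set G} {b : ℝ} (hb : 0 ≤ b) (hB : ∀ g ∈ B, b ≤ δ g) :
    b * μ.real B ≤ 1 := by
  rw [← hδ.integral_eq_one]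
  exact (mul_le_mul_of_nonneg_left (measureReal_mono hB) hb).trans
    (mul_meas_ge_le_integral_of_nonneg (ae_of_all _ hδ.nonneg) hδ.integrable b)

variable {G : Type*} [Group G]

/-- For a left-invariant metric the distance to `1` is subadditive and invariant under inversion.
`M` is a word length and does not depend on `h`. -/
lemma exists_dist_lift_le [PseudoMetricSpace G] [IsIsometricSMul G G] {L : Type*}
    (w : FreeGroup L) :
    ∃ M : ℝ, ∀ (h : L → G) (ε : ℝ), (∀ l, dist (h l) 1 ≤ ε) →
      dist (FreeGroup.lift h w) 1 ≤ M * ε := by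
  induction w using FreeGroup.induction_on with
  | C1 => exact ⟨0, fun h ε _ => by simp⟩
  | of l => exact ⟨1, fun h ε hε => by simpa using hε l⟩
  | inv_of l _ =>
    refine ⟨1, fun h ε hε => ?_⟩
    have : dist (h l)⁻¹ 1 = dist (h l) 1 := by
      rw [← dist_mul_left (h l), mul_inv_cancel, mul_one, dist_comm]
    simpa [this] using hε l
  | mul x y hx hy =>
    obtain ⟨M, hM⟩ := hx
    obtain ⟨M', hM'⟩ := hy
    refine ⟨M + M', fun h ε hε => ?_⟩
    rw [map_mul]
    refine (dist_triangle _ (FreeGroup.lift h x) _).trans ?_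
    have : dist (FreeGroup.lift h x * FreeGroup.lift h y) (FreeGroup.lift h x) =
        dist (FreeGroup.lift h y) 1 := by
      conv_lhs => rw [← mul_one (FreeGroup.lift h x), mul_assoc, one_mul, dist_mul_left]
    rw [this]
    linarith [hM h ε hε, hM' h ε hε]

variable [MetricSpace G]

/-- On small balls all holonomies of a finite family of diagrams are in a ball of comparable
radius. -/
lemma exists_dist_holonomy_le [IsIsometricSMul G G] {ι P L : Type*} [Finite ι] [Finite P]
    (𝒢 : ι → StrandedDiagram P L) :
    ∃ M : ℝ, ∀ i (h : L → G) (ε : ℝ), 0 ≤ ε → (∀ l, h l ∈ Metric.closedBall 1 ε) →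
      ∀ f, dist ((𝒢 i).holonomy h f) 1 ≤ M * ε := by
  choose M hM using fun q : Σ i, (𝒢 i).Face =>
    exists_dist_lift_le (G := G) ((𝒢 q.1).word (Quotient.out (s := (𝒢 q.1).faceSetoid) q.2))
  obtain ⟨K, hK⟩ := (Set.finite_range M).bddAbove
  refine ⟨K, fun i h ε hε hh f => (hM ⟨i, f⟩ h ε hh).trans ?_⟩
  exact mul_le_mul_of_nonneg_right (hK ⟨_, rfl⟩) hε

variable [MeasurableSpace G]

lemma IsDeltaRegularisation.isDeltaFunction {μ : Measure G} {δ : ℕ → G → ℝ}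
    (h : IsDeltaRegularisation μ δ) (n : ℕ) : IsDeltaFunction μ (δ n) :=
  ⟨h.measurable n, h.nonneg n, h.le_one n, h.central n, h.symm n, h.integral_eq_one n⟩

/-- The delta functions are comparable to their largest value on a ball which is so small that
the ball of `K` times its radius has this property, and which still has a volume comparable to
the inverse of that value. -/
lemma IsDeltaRegularisation.exists_radius [IsTopologicalGroup G] [BorelSpace G]
    {μ : Measure G} [μ.IsHaarMeasure] [IsProbabilityMeasure μ]
    [IsUnifLocDoublingMeasure μ] {δ : ℕ → G → ℝ} (h : IsDeltaRegularisation μ δ) {K : ℝ}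
    (hK : 0 < K) :
    ∃ c c' : ℝ, 0 < c ∧ 0 < c' ∧ ∀ᶠ n in atTop, ∃ ε : ℝ, 0 ≤ ε ∧
      (∀ g : G, dist g 1 ≤ K * ε → c * δ n 1 ≤ δ n g) ∧
      c' / δ n 1 ≤ μ.real (Metric.closedBall 1 ε) := by
  obtain ⟨c, hc, hcomp⟩ := h.comparable
  set s := IsUnifLocDoublingMeasure.scalingScaleOf μ K with hs
  set C := IsUnifLocDoublingMeasure.scalingConstantOf μ K with hC
  have hs0 : 0 < s := IsUnifLocDoublingMeasure.scalingScaleOf_pos μ K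
  have hC1 : (1 : ℝ) ≤ C := by
    exact_mod_cast IsUnifLocDoublingMeasure.one_le_scalingConstantOf μ K
  have hm : 0 < μ.real (Metric.closedBall (1 : G) (K * s)) :=
    ENNReal.toReal_pos (Metric.measure_closedBall_pos μ 1 (mul_pos hK hs0)).ne'
      (measure_ne_top μ _)
  refine ⟨c, c / C, hc, div_pos hc (by linarith), ?_⟩
  filter_upwards [h.tendsto.eventually_gt_atTop 0,
    h.tendsto.eventually_gt_atTop (1 / (c * μ.real (Metric.closedBall (1 : G) (K * s))))]
    with n hn0 hn
  obtain ⟨r, hr, hball, hvol⟩ := hcomp n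
  -- Doubling applies only below the scale `s`. A larger radius would make `δ n` at least `c * δ n
  -- 1` on a fixed ball, which contradicts integral one as soon as `δ n 1` is large.
  have hrs : r / K ≤ s := by
    by_contra! hlt
    rw [lt_div_iff₀' hK] at hlt
    have h1 := (h.isDeltaFunction n).mul_measureReal_le_one (mul_nonneg hc.le hn0.le)
      (B := Metric.closedBall 1 (K * s))
      fun g hg => hball g (Metric.closedBall_subset_closedBall hlt.le hg)
    rw [div_lt_iff₀ (mul_pos hc hm)] at hn
    linarith
  -- Shrinking the ball by `K` costs at most the scaling constant `C` in volume, whence `c' = c /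
  -- C`.
  refine ⟨r / K, (div_pos hr hK).le, fun g hg => hball g ?_, ?_⟩
  · rwa [mul_div_cancel₀ _ hK.ne'] at hg
  · have h1 := IsUnifLocDoublingMeasure.measure_mul_le_scalingConstantOf_mul (μ := μ) (x := 1)
      (t := K) ⟨hK, le_rfl⟩ hrs
    rw [mul_div_cancel₀ _ hK.ne'] at h1
    have h2 : μ.real (Metric.closedBall 1 r) ≤ C * μ.real (Metric.closedBall 1 (r / K)) := by
      have := ENNReal.toReal_mono (ENNReal.mul_ne_top ENNReal.coe_ne_top (measure_ne_top μ _)) h1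
      rwa [ENNReal.toReal_mul] at this
    rw [div_div, div_le_iff₀ (mul_pos (by linarith) hn0)]
    refine hvol.trans ?_
    calc δ n 1 * μ.real (Metric.closedBall 1 r)
        ≤ δ n 1 * (C * μ.real (Metric.closedBall 1 (r / K))) := by gcongr
      _ = _ := by ring

/-- There are finitely many diagrams, so one expansion factor bounds all holonomies, and `κ` does
not depend on `n`. -/
lemma Network.exists_eventually_amplitudeBounds {V : Type*} [Fintype V] {Γ : Network V} {N : ℕ}
    {R : Set Γ.OpenLeg} {τ : Set Γ.Link} (hN : 0 < N) (hbdry : Nonempty Γ.OpenLeg)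
    (htree : ¬ Γ.CoarseGrainable) (hτ : Γ.IsMinCut R τ)
    (huniq : ∀ τ', Γ.IsMinCut R τ' → τ' = τ) [IsTopologicalGroup G] [CompactSpace G]
    [IsIsometricSMul G G] [BorelSpace G] {μ : Measure G} [μ.IsHaarMeasure]
    [IsProbabilityMeasure μ] [IsUnifLocDoublingMeasure μ] {δ : ℕ → G → ℝ}
    (h : IsDeltaRegularisation μ δ) :
    ∃ κ : ℝ, 0 < κ ∧ ∀ᶠ n in atTop, Γ.AmplitudeBounds N R τ μ (δ n) κ := by
  obtain ⟨M, hM⟩ := exists_dist_holonomy_le (G := G)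
    fun π : V → Equiv.Perm (Fin N) => Γ.freeDiagram R π
  obtain ⟨M', hM'⟩ := exists_dist_holonomy_le (G := G)
    fun I : Interaction V N => Γ.interactionDiagram R I
  obtain ⟨c, c', hc, hc', hev⟩ := h.exists_radius (K := max 1 (max M M')) (by positivity)
  refine ⟨c ^ Nat.card (Γ.freeDiagram R (Γ.wallPattern N R τ)).Face * c' ^ Nat.card (V × Fin N),
    by positivity, ?_⟩
  filter_upwards [hev, h.tendsto.eventually_ge_atTop 1] with n ⟨ε, hε, hball, hvol⟩ hn
  refine amplitudeBounds (h.isDeltaFunction n) hn hN hbdry htree hτ huniq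
    (B := Metric.closedBall 1 ε) Metric.isClosed_closedBall.measurableSet hc hc' hvol
    (fun π g hg f => hball _ ((hM π g ε hε hg f).trans ?_))
    (fun I g hg f => hball _ ((hM' I g ε hε hg f).trans ?_))
  · gcongr
    exact (le_max_left _ _).trans (le_max_right _ _)
  · gcongr
    exact (le_max_right _ _).trans (le_max_right _ _)

end CompactGroup

lemma abs_log_le_of_mem_Icc {a b y : ℝ} (ha : 0 < a) (hl : a ≤ y) (hu : y ≤ b) :
    |Real.log y| ≤ |Real.log a| + |Real.log b| := by
  have h1 := Real.log_le_log ha hl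
  have h2 := Real.log_le_log (ha.trans_le hl) hu
  rw [abs_le]
  constructor
  · linarith [neg_abs_le (Real.log a), abs_nonneg (Real.log b)]
  · linarith [le_abs_self (Real.log b), abs_nonneg (Real.log a)]

end GFT

end

/-! ### Degrees and entropy in both boundary situations -/

theorem mainTheorem1 {V : Type*} [Fintype V] (Γ : GFT.Network V)
    (A : Set Γ.OpenLeg) (σ : Set Γ.Link)
    (hΓ : Γ.Connected) (hbdry : Nonempty Γ.OpenLeg) (htree : ¬ Γ.CoarseGrainable)
    (hσ : Γ.IsMinCut A σ) (hσ_unique : ∀ τ, Γ.IsMinCut A τ → τ = σ)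
    (N : ℕ) (hN : 2 ≤ N) :
    -- finite groups: the two boundary situations `Z_0` (no wall) and `Z_A` (wall `σ`)
    (∀ (G : Type*) [Group G] [Finite G] [MeasurableSpace G] [MeasurableSingletonClass G],
      2 ≤ Nat.card G →
      ∀ (R : Set Γ.OpenLeg) (τ : Set Γ.Link), (R = ∅ ∧ τ = ∅) ∨ (R = A ∧ τ = σ) →
        (Γ.freeDiagram R (Γ.wallPattern N R τ)).degree (GFT.uniformMeasure G)
            (GFT.finiteDelta G) = Γ.wallDegree N τ ∧
        (∀ π : V → Equiv.Perm (Fin N), π ≠ Γ.wallPattern N R τ →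
          (Γ.freeDiagram R π).degree (GFT.uniformMeasure G) (GFT.finiteDelta G) <
            (Γ.freeDiagram R (Γ.wallPattern N R τ)).degree (GFT.uniformMeasure G)
              (GFT.finiteDelta G)) ∧
        (∀ I : GFT.Interaction V N,
          (Γ.interactionDiagram R I).degree (GFT.uniformMeasure G) (GFT.finiteDelta G) <
            (Γ.freeDiagram R (Γ.wallPattern N R τ)).degree (GFT.uniformMeasure G)
              (GFT.finiteDelta G))) ∧
    -- finite groups: the entropy formula, with error `O(1 / δ(e))`
    (∀ coupling : ℝ, ∃ (C : ℝ) (D₀ : ℕ),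
      ∀ (G : Type*) [Group G] [Finite G] [MeasurableSpace G] [MeasurableSingletonClass G],
        D₀ ≤ Nat.card G →
        0 < Γ.partitionFunction N ∅ coupling (GFT.uniformMeasure G) (GFT.finiteDelta G) ∧
        0 < Γ.partitionFunction N A coupling (GFT.uniformMeasure G) (GFT.finiteDelta G) ∧
        |Γ.renyiEntropy N A coupling (GFT.uniformMeasure G) (GFT.finiteDelta G)
            - (σ.ncard : ℝ) * Real.log (Nat.card G)| ≤ C / Nat.card G) ∧
    -- compact groups with a regularised delta function
    (∀ (G : Type*) [Group G] [MetricSpace G] [IsTopologicalGroup G] [CompactSpace G]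
      [IsIsometricSMul G G] [MeasurableSpace G] [BorelSpace G]
      (μ : Measure G) [μ.IsHaarMeasure] [IsProbabilityMeasure μ] [IsUnifLocDoublingMeasure μ]
      (δ : ℕ → G → ℝ), GFT.IsDeltaRegularisation μ δ →
      (∀ (R : Set Γ.OpenLeg) (τ : Set Γ.Link), (R = ∅ ∧ τ = ∅) ∨ (R = A ∧ τ = σ) →
        Tendsto (fun n => (Γ.freeDiagram R (Γ.wallPattern N R τ)).degree μ (δ n)) atTop
          (𝓝 (Γ.wallDegree N τ)) ∧
        (∀ π : V → Equiv.Perm (Fin N), π ≠ Γ.wallPattern N R τ →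
          ∃ ω < Γ.wallDegree N τ, ∀ᶠ n in atTop, (Γ.freeDiagram R π).degree μ (δ n) ≤ ω) ∧
        (∀ I : GFT.Interaction V N,
          ∃ ω < Γ.wallDegree N τ, ∀ᶠ n in atTop,
            (Γ.interactionDiagram R I).degree μ (δ n) ≤ ω)) ∧
      (∀ coupling : ℝ,
        (∀ᶠ n in atTop, 0 < Γ.partitionFunction N ∅ coupling μ (δ n) ∧
          0 < Γ.partitionFunction N A coupling μ (δ n)) ∧
        (fun n => Γ.renyiEntropy N A coupling μ (δ n) - (σ.ncard : ℝ) * Real.log (δ n 1))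
          =O[atTop] (fun _ => (1 : ℝ)))) := by
  have hN0 : 0 < N := by omega
  obtain ⟨hempty, hempty_unique⟩ := GFT.Network.isMinCut_empty Γ
  have hcut : ∀ (R : Set Γ.OpenLeg) (τ : Set Γ.Link), (R = ∅ ∧ τ = ∅) ∨ (R = A ∧ τ = σ) →
      Γ.IsMinCut R τ ∧ ∀ τ', Γ.IsMinCut R τ' → τ' = τ := by
    rintro R τ (⟨rfl, rfl⟩ | ⟨rfl, rfl⟩)
    exacts [⟨hempty, hempty_unique⟩, ⟨hσ, hσ_unique⟩]
  refine ⟨?_, ?_, ?_⟩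
  · intro G _ _ _ _ hG R τ hRτ
    obtain ⟨hτ, hτ_unique⟩ := hcut R τ hRτ
    have hb := GFT.Network.amplitudeBounds_finiteDelta hN0 hbdry htree hτ hτ_unique G
    have hδ : 1 < GFT.finiteDelta G 1 := by
      rw [GFT.finiteDelta_one]
      exact_mod_cast hG
    have hdeg : (Γ.freeDiagram R (Γ.wallPattern N R τ)).degree (GFT.uniformMeasure G)
        (GFT.finiteDelta G) = Γ.wallDegree N τ := by
      have := hb.le_degree_wall hδ one_pos
      rw [Real.logb_one, zero_add] at this
      exact le_antisymm (hb.degree_wall_le hδ) this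
    rw [hdeg]
    exact ⟨rfl, fun π hπ => (hb.degree_free_le hδ hπ).trans_lt (sub_one_lt _),
      fun I => (hb.degree_interaction_le hδ I).trans_lt (sub_one_lt _)⟩
  · intro coupling
    set M := GFT.Network.diagramCount (V := V) N coupling with hM
    -- `D₀` ensures `M / δ(e) ≤ 1/2`; each of the two logarithms is then at most `2M / δ(e)`.
    refine ⟨4 * M, max 1 ⌈2 * M⌉₊, fun G _ _ _ _ hG => ?_⟩
    have hb0 := GFT.Network.amplitudeBounds_finiteDelta hN0 hbdry htree hempty hempty_unique G
    have hbA := GFT.Network.amplitudeBounds_finiteDelta hN0 hbdry htree hσ hσ_unique G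
    have hδ1 : (1 : ℝ) ≤ Nat.card G := by exact_mod_cast (le_max_left _ _).trans hG
    have hδ2 : 2 * M ≤ Nat.card G := Nat.ceil_le.1 ((le_max_right _ _).trans hG)
    rw [← GFT.finiteDelta_one] at hδ1 hδ2 ⊢
    have hδ0 : 0 < GFT.finiteDelta G 1 := by linarith
    have hx : M / GFT.finiteDelta G 1 ≤ 1 / 2 := by
      rw [div_le_iff₀ hδ0]
      linarith
    obtain ⟨h0, h0'⟩ := hb0.partitionFunction_pos hδ0 (hx.trans_lt one_half_lt_one)
    obtain ⟨hA, hA'⟩ := hbA.partitionFunction_pos hδ0 (hx.trans_lt one_half_lt_one)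
    refine ⟨h0', hA', (GFT.Network.renyiEntropy_sub_eq hN hδ0 coupling h0 hA).trans ?_⟩
    obtain ⟨hl0, hu0⟩ := hb0.ratio_bounds hδ0 coupling
    obtain ⟨hlA, huA⟩ := hbA.ratio_bounds hδ0 coupling
    refine (add_le_add (GFT.abs_log_le_two_mul hx hlA huA)
      (GFT.abs_log_le_two_mul hx hl0 hu0)).trans (le_of_eq ?_)
    ring
  · intro G _ _ _ _ _ _ _ μ _ _ _ δ hδ
    constructor
    · intro R τ hRτ
      obtain ⟨hτ, hτ_unique⟩ := hcut R τ hRτ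
      obtain ⟨κ, hκ, hev⟩ := GFT.Network.exists_eventually_amplitudeBounds hN0 hbdry htree hτ
        hτ_unique hδ
      have hev1 := hδ.tendsto.eventually_gt_atTop 1
      refine ⟨?_, fun π hπ => ⟨_, sub_one_lt _, ?_⟩, fun I => ⟨_, sub_one_lt _, ?_⟩⟩
      -- The constant `κ` shifts the degree by `log κ / log δ(e)`, which tends to zero.
      · have hlim : Tendsto (fun n => Real.logb (δ n 1) κ + Γ.wallDegree N τ) atTop
            (𝓝 (Γ.wallDegree N τ)) := by
          have := (tendsto_const_nhds (x := Real.log κ)).div_atTop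
            (Real.tendsto_log_atTop.comp hδ.tendsto)
          simpa [Real.logb] using this.add_const (Γ.wallDegree N τ)
        refine tendsto_of_tendsto_of_tendsto_of_le_of_le' hlim tendsto_const_nhds ?_ ?_
        · filter_upwards [hev, hev1] with n hn hn1 using hn.le_degree_wall hn1 hκ
        · filter_upwards [hev, hev1] with n hn hn1 using hn.degree_wall_le hn1
      · filter_upwards [hev, hev1] with n hn hn1 using hn.degree_free_le hn1 hπ
      · filter_upwards [hev, hev1] with n hn hn1 using hn.degree_interaction_le hn1 I
    · intro coupling
      set M := GFT.Network.diagramCount (V := V) N coupling with hM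
      obtain ⟨κ₀, hκ₀, hev0⟩ := GFT.Network.exists_eventually_amplitudeBounds hN0 hbdry htree hempty
        hempty_unique hδ
      obtain ⟨κ, hκ, hevA⟩ := GFT.Network.exists_eventually_amplitudeBounds hN0 hbdry htree hσ
        hσ_unique hδ
      have hsmall : Tendsto (fun n => M / δ n 1) atTop (𝓝 0) :=
        tendsto_const_nhds.div_atTop hδ.tendsto
      have hpos := hδ.tendsto.eventually_gt_atTop 0
      have hs0 := hsmall.eventually_le_const (half_pos hκ₀)
      have hsA := hsmall.eventually_le_const (half_pos hκ)
      constructor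
      · filter_upwards [hpos, hs0, hsA, hev0, hevA] with n hn h0 hA hb0 hbA
        exact ⟨(hb0.partitionFunction_pos hn (h0.trans_lt (half_lt_self hκ₀))).2,
          (hbA.partitionFunction_pos hn (hA.trans_lt (half_lt_self hκ))).2⟩
      -- For large `n` the normalised partition functions lie between half of their constant `κ` or
      -- `κ₀` and `2`.
      · refine IsBigO.of_bound ((|Real.log (κ / 2)| + |Real.log 2|) +
          (|Real.log (κ₀ / 2)| + |Real.log 2|)) ?_
        filter_upwards [hpos, hs0, hsA, hev0, hevA,
          hsmall.eventually_le_const one_pos] with n hn h0 hA hb0 hbA h1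
        rw [norm_one, mul_one, Real.norm_eq_abs]
        refine (GFT.Network.renyiEntropy_sub_eq hN hn coupling
          (hb0.partitionFunction_pos hn (h0.trans_lt (half_lt_self hκ₀))).1
          (hbA.partitionFunction_pos hn (hA.trans_lt (half_lt_self hκ))).1).trans ?_
        obtain ⟨hl0, hu0⟩ := hb0.ratio_bounds hn coupling
        obtain ⟨hlA, huA⟩ := hbA.ratio_bounds hn coupling
        exact add_le_add
          (GFT.abs_log_le_of_mem_Icc (half_pos hκ) (by linarith) (by linarith))
          (GFT.abs_log_le_of_mem_Icc (half_pos hκ₀) (by linarith) (by linarith))
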